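/- A weighted graph is a finite simple undirected graph $G=(V,E)$ with edge weights $w:E\to[0,\infty)$. Write $\mathrm{dist}_G(u,v)$ for the minimum total weight of a $u$–$v$ path in $G$ (and $\infty$ if there is none), and $W_{\max}(G)$ for the maximum weight of an edge of $G$ (and $0$ if there is no edge). For integers $\alpha,\beta\ge 0$, an $(\alpha,\beta)$-spanner of $G$ is a subgraph $H$ of $G$ with the same vertex set and with the edge weights of $G$ such that $\mathrm{dist}_H(u,v)\le\alpha\,\mathrm{dist}_G(u,v)+\beta\,W_{\max}(G)$ for all $u,v\in V$. Theorem. There are constants $C,c$ such that for every integer $k\ge 2$ every weighted graph $G$ on $n\ge 0$ vertices has a $(k,k-1)$-spanner $H$ with at most $C\,n^{1+1/k}(1+\log n)^c$ edges (that is, $\tilde O(n^{1+1/k})$ edges, uniformly in $k$; for $n=0$ the bound is read as $0$). Moreover, such an $H$ can be computed in polynomial time: there are a fixed (deterministic) random access machine program and a polynomial $T$ such that for every integer $k\ge 2$ and every weighted graph $G$ on the vertex set $\{0,\dots,n-1\}$, the program, started with $n$, $k$, the adjacency matrix and the matrix of edge weights of $G$ in its memory, halts after at most $T(n)$ steps with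 the adjacency matrix of a $(k,k-1)$-spanner of $G$ with at most $C\,n^{1+1/k}(1+\log n)^c$ edges in its memory. Here the machine has memory for natural numbers and for real numbers, with computed addresses, and one step consists of a bounded number of additions, subtractions (of natural numbers: truncated at $0$), copies and comparisons. -/

import Mathlib

open scoped NNReal ENNReal

namespace WSpanner

/-! ### Weighted graphs, distances, spanners

A weighted graph is a simple graph `G` on `V` with a nonnegative real weight for every edge; the
values of `w` outside the edge set of `G` are never used. -/

/-- The total weight of a walk, every traversal of an edge being counted. -/
def walkWeight {V : Type*} {G : SimpleGraph V} (w : Sym2 V → ℝ≥0) {u v : V} (p : G.Walk u v) :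
    ℝ≥0 :=
  (p.edges.map w).sum

/-- The shortest path distance; it is `∞` if `u` and `v` are in different components. -/
noncomputable def wdist {V : Type*} (G : SimpleGraph V) (w : Sym2 V → ℝ≥0) (u v : V) : ℝ≥0∞ :=
  ⨅ p : G.Walk u v, (walkWeight w p : ℝ≥0∞)

/-- The maximum weight of an edge of `G` (and `0` if `G` has no edge). -/
noncomputable def maxWeight {V : Type*} (G : SimpleGraph V) (w : Sym2 V → ℝ≥0) : ℝ≥0∞ :=
  ⨆ e ∈ G.edgeSet, (w e : ℝ≥0∞)

/-- `H` is an `(α, β)`-spanner of `G`: a subgraph with the same vertices and the same weights whose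
distances are at most `α` times those of `G` plus `β` times the maximum weight of an edge of `G`. -/
def IsSpanner {V : Type*} (α β : ℕ) (G : SimpleGraph V) (w : Sym2 V → ℝ≥0) (H : SimpleGraph V) :
    Prop :=
  H ≤ G ∧ ∀ u v : V, wdist H w u v ≤ (α : ℝ≥0∞) * wdist G w u v + (β : ℝ≥0∞) * maxWeight G w

/-- A bound of the form `O(n ^ (1 + 1 / k) * polylog n)`; for `C` and `c` fixed it is
`Õ(n ^ (1 + 1 / k))`, with hidden constants that depend neither on `n` nor on `k`. -/
noncomputable def sizeBound (C c k n : ℕ) : ℝ :=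
  (C : ℝ) * (n : ℝ) ^ (1 + 1 / (k : ℝ)) * (1 + Real.log (n : ℝ)) ^ c

/-! ### A random access machine with real numbers

Structured programs over natural numbers (counters, addresses) and real numbers (weights).  The
memory consists of two-dimensional arrays of natural numbers and of real numbers, which are named
by natural numbers occurring in the program text; indices can be computed.  The only arithmetic
operations are addition and subtraction (there is no unit-cost multiplication and no rounding), and
real numbers can otherwise only be copied and compared. -/

/-- The memory: `nat a i j` and `real a i j` are the entries `(i, j)` of the arrays named `a`. -/
structure State where
  nat : ℕ → ℕ → ℕ → ℕ
  real : ℕ → ℕ → ℕ → ℝ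

/-- Expressions of type natural number; the subtraction is truncated at `0`. -/
inductive NExp where
  | const (c : ℕ)
  | load (a : ℕ) (i j : NExp)
  | add (e f : NExp)
  | sub (e f : NExp)

/-- Expressions of type real number. -/
inductive RExp where
  | zero
  | load (a : ℕ) (i j : NExp)
  | add (e f : RExp)
  | sub (e f : RExp)

/-- Tests. -/
inductive Test where
  | natLe (e f : NExp)
  | realLe (e f : RExp)
  | not (b : Test)
  | and (b c : Test)

/-- Programs. -/
inductive Prog where
  | skip
  | setNat (a : ℕ) (i j e : NExp)
  | setReal (a : ℕ) (i j : NExp) (e : RExp)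
  | seq (p q : Prog)
  | branch (b : Test) (p q : Prog)
  | loop (b : Test) (p : Prog)

/-- The value of an expression of type natural number. -/
def NExp.eval (s : State) : NExp → ℕ
  | .const c => c
  | .load a i j => s.nat a (i.eval s) (j.eval s)
  | .add e f => e.eval s + f.eval s
  | .sub e f => e.eval s - f.eval s

/-- The value of an expression of type real number. -/
noncomputable def RExp.eval (s : State) : RExp → ℝ
  | .zero => 0
  | .load a i j => s.real a (i.eval s) (j.eval s)
  | .add e f => e.eval s + f.eval s
  | .sub e f => e.eval s - f.eval s

/-- The truth of a test. -/
def Test.Holds (s : State) : Test → Prop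
  | .natLe e f => e.eval s ≤ f.eval s
  | .realLe e f => e.eval s ≤ f.eval s
  | .not b => ¬ b.Holds s
  | .and b c => b.Holds s ∧ c.Holds s

open Classical in
/-- Replace the entry `(i, j)` of an array `a`. -/
noncomputable def update {α : Type} (m : ℕ → ℕ → ℕ → α) (a i j : ℕ) (x : α) : ℕ → ℕ → ℕ → α :=
  fun a' i' j' => if a' = a ∧ i' = i ∧ j' = j then x else m a' i' j'

/-- `Exec p s t s'`: started in the memory `s`, the program `p` halts after `t` steps in the memory
`s'`.  Each assignment and each evaluation of a test is one step; an expression in a fixed program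
stands for a constant number of elementary operations. -/
inductive Exec : Prog → State → ℕ → State → Prop
  | skip (s : State) : Exec .skip s 1 s
  | setNat (a : ℕ) (i j e : NExp) (s : State) :
      Exec (.setNat a i j e) s 1
        { s with nat := update s.nat a (i.eval s) (j.eval s) (e.eval s) }
  | setReal (a : ℕ) (i j : NExp) (e : RExp) (s : State) :
      Exec (.setReal a i j e) s 1
        { s with real := update s.real a (i.eval s) (j.eval s) (e.eval s) }
  | seq {p q : Prog} {s s₁ s₂ : State} {t₁ t₂ : ℕ} :
      Exec p s t₁ s₁ → Exec q s₁ t₂ s₂ → Exec (.seq p q) s (t₁ + t₂) s₂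
  | branch_true {b : Test} {p q : Prog} {s s' : State} {t : ℕ} :
      b.Holds s → Exec p s t s' → Exec (.branch b p q) s (t + 1) s'
  | branch_false {b : Test} {p q : Prog} {s s' : State} {t : ℕ} :
      ¬ b.Holds s → Exec q s t s' → Exec (.branch b p q) s (t + 1) s'
  | loop_true {b : Test} {p : Prog} {s s₁ s₂ : State} {t₁ t₂ : ℕ} :
      b.Holds s → Exec p s t₁ s₁ → Exec (.loop b p) s₁ t₂ s₂ →
        Exec (.loop b p) s (t₁ + t₂ + 1) s₂
  | loop_false {b : Test} {p : Prog} {s : State} :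
      ¬ b.Holds s → Exec (.loop b p) s 1 s

open Classical in
/-- The initial memory for the input `(k, G, w)`, where `G` has the vertices `0, …, n - 1`.
Array `0` of naturals holds `n` at `(0, 0)` and `k` at `(0, 1)`, array `1` of naturals is the
adjacency matrix of `G`, array `0` of reals is the matrix of the edge weights (`0` at non-adjacent
pairs), and everything else is `0`. -/
noncomputable def input (k n : ℕ) (G : SimpleGraph (Fin n)) (w : Sym2 (Fin n) → ℝ≥0) : State where
  nat := fun a i j =>
    if a = 0 ∧ i = 0 ∧ j = 0 then n
    else if a = 0 ∧ i = 0 ∧ j = 1 then k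
    else if a = 1 ∧ ∃ u v : Fin n, i = u ∧ j = v ∧ G.Adj u v then 1
    else 0
  real := fun a i j =>
    if h : i < n ∧ j < n then
      if a = 0 ∧ G.Adj ⟨i, h.1⟩ ⟨j, h.2⟩ then (w s(⟨i, h.1⟩, ⟨j, h.2⟩) : ℝ) else 0
    else 0

/-- The memory `s` holds the graph `H` as the output: array `2` of naturals has the entry `1` at the
adjacent pairs of vertices and not at the other pairs of vertices. -/
def IsOutput {n : ℕ} (s : State) (H : SimpleGraph (Fin n)) : Prop :=
  ∀ u v : Fin n, H.Adj u v ↔ s.nat 2 u v = 1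

end WSpanner

open WSpanner

/-! Scan the edges by increasing weight and grow a graph H₀. An edge xy of weight W whose ends are
already at distance at most kW in H₀ is skipped. Otherwise consider the balls of radius ρW around x
and y in H₀ for two values of ρ, namely (k-1)/2 and k/2 rounded down; these sum to k-1. If all four
balls have at least r^ρ vertices, with r about n^(1/k), the edge is left out and the balls are
remembered; otherwise it is inserted. Afterwards choose small hitting sets ("centers") for the large
balls of each of the two types, and for each pair a, c of centers of different types insert an edge
xy minimizing d(a,x) + w(xy) + d(y,c), distances being taken in H₀.

Size. All edges of H₀ have weight at most W when xy is inserted, so x and y are more than k hops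
apart and H₀ never has a cycle with at most k+1 edges; also, some ball of ρ hops around x or y has
fewer than r^ρ vertices. If the insertion created a subgraph of minimum degree above r, the lack of
short cycles would make that ball grow by a factor r per hop (`ShortcutFree.pow_le_card_ball`). So
H₀ stays r-degenerate and has at most rn edges (`Degenerate.sup_edge`,
`Degenerate.ncard_edgeSet_le`). Greedy hitting sets have at most n(1+log n)/r^ρ elements, so the
number of pairs of centers is at most n²(1+log n)²/r^(k-1) (`edge_count`).

Stretch (`isSpanner_of_centers`). For a walk from x to v, bound the distances to v from centers of
both types simultaneously. At a left-out edge the bound for one type is obtained from that for the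
other, by way of the connecting edge and a center near the far end; the two bounds together grow by
2W + 2(k-1)W = 2kW, which is kW on average. Entering the system of centers at the first left-out
edge costs 2ρW for type ρ, which is (k-1)W on average: this is the additive term.

Running time. The algorithm is written in a language whose loops make n + c passes, so halting
within a polynomial bound holds by construction (`Cmd.exec_compile`), and invariants are proved for
the effect `Cmd.run`. The program works with min k (n+2) instead of k, which makes the time depend
on n only and costs at most a factor 2 in the size. -/

/-! ### Programs with bounded loops -/

namespace WSpanner

/-- Programs whose loops run over an initial segment of the natural numbers. -/
inductive Cmd where
  | skip
  | setNat (a : ℕ) (i j e : NExp)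
  | setReal (a : ℕ) (i j : NExp) (e : RExp)
  | seq (p q : Cmd)
  | branch (b : Test) (p q : Cmd)
  | loop (a c : ℕ) (p : Cmd)

/-- The scalar variable named `a`. -/
abbrev NExp.var (a : ℕ) : NExp := .load a (.const 0) (.const 0)

/-- The real scalar variable named `a`. -/
abbrev RExp.var (a : ℕ) : RExp := .load a (.const 0) (.const 0)

namespace Cmd

/-- Translation to programs; `Cmd.loop a c p` executes `p` for `a = 0, …, n + c - 1`. -/
def compile : Cmd → Prog
  | skip => .skip
  | setNat a i j e => .setNat a i j e
  | setReal a i j e => .setReal a i j e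
  | seq p q => .seq p.compile q.compile
  | branch b p q => .branch b p.compile q.compile
  | loop a c p =>
    .seq (.setNat a (.const 0) (.const 0) (.const 0))
      (.loop (.natLe (.add (.var a) (.const 1)) (.add (.var 0) (.const c)))
        (.seq p.compile (.setNat a (.const 0) (.const 0) (.add (.var a) (.const 1)))))

end Cmd

/-- Assign a value to an entry of an array of natural numbers. -/
noncomputable def State.setN (s : State) (a i j x : ℕ) : State :=
  { s with nat := update s.nat a i j x }

/-- Assign a value to an entry of an array of real numbers. -/
noncomputable def State.setR (s : State) (a i j : ℕ) (x : ℝ) : State :=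
  { s with real := update s.real a i j x }

@[simp] theorem State.setN_real (s : State) (a i j x : ℕ) : (s.setN a i j x).real = s.real := rfl

@[simp] theorem State.setR_nat (s : State) (a i j : ℕ) (x : ℝ) : (s.setR a i j x).nat = s.nat := rfl

theorem State.setN_nat (s : State) (a i j x a' i' j' : ℕ) :
    (s.setN a i j x).nat a' i' j' = if a' = a ∧ i' = i ∧ j' = j then x else s.nat a' i' j' := by
  simp [State.setN, update]

theorem State.setR_real (s : State) (a i j : ℕ) (x : ℝ) (a' i' j' : ℕ) :
    (s.setR a i j x).real a' i' j' = if a' = a ∧ i' = i ∧ j' = j then x else s.real a' i' j' := by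
  simp [State.setR, update]

theorem State.setN_nat_ne (s : State) (a i j x a' : ℕ) (h : a' ≠ a) :
    (s.setN a i j x).nat a' = s.nat a' := by
  funext i' j'; simp [State.setN_nat, h]

theorem State.setR_real_ne (s : State) (a i j : ℕ) (x : ℝ) (a' : ℕ) (h : a' ≠ a) :
    (s.setR a i j x).real a' = s.real a' := by
  funext i' j'; simp [State.setR_real, h]

namespace Cmd

/-- The state after `m` passes through the body of a loop. -/
noncomputable def iter (f : State → State) (a : ℕ) (s : State) : ℕ → State
  | 0 => s.setN a 0 0 0
  | m + 1 => (f (iter f a s m)).setN a 0 0 (m + 1)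

open Classical in
/-- The effect of a program on the memory. -/
noncomputable def run : Cmd → State → State
  | skip, s => s
  | setNat a i j e, s => s.setN a (i.eval s) (j.eval s) (e.eval s)
  | setReal a i j e, s => s.setR a (i.eval s) (j.eval s) (e.eval s)
  | seq p q, s => q.run (p.run s)
  | branch b p q, s => if b.Holds s then p.run s else q.run s
  | loop a c p, s => iter p.run a s (s.nat 0 0 0 + c)

/-! ### Write footprints, frame rules and running times -/

/-- Whether an array of natural numbers may be written by a program. -/
def writesNat : Cmd → ℕ → Bool
  | skip, _ => false
  | setNat a _ _ _, x => x == a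
  | setReal _ _ _ _, _ => false
  | seq p q, x => p.writesNat x || q.writesNat x
  | branch _ p q, x => p.writesNat x || q.writesNat x
  | loop a _ p, x => x == a || p.writesNat x

/-- Whether an array of real numbers may be written by a program. -/
def writesReal : Cmd → ℕ → Bool
  | skip, _ => false
  | setNat _ _ _ _, _ => false
  | setReal a _ _ _, x => x == a
  | seq p q, x => p.writesReal x || q.writesReal x
  | branch _ p q, x => p.writesReal x || q.writesReal x
  | loop _ _ p, x => p.writesReal x

/-- The loops of a program change neither their counters nor their bounds. -/
def WF : Cmd → Bool
  | seq p q => p.WF && q.WF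
  | branch _ p q => p.WF && q.WF
  | loop a _ p => a != 0 && !p.writesNat a && !p.writesNat 0 && p.WF
  | _ => true

/-- A bound for the running time. -/
noncomputable def time : Cmd → Polynomial ℕ
  | skip => 1
  | setNat _ _ _ _ => 1
  | setReal _ _ _ _ => 1
  | seq p q => p.time + q.time
  | branch _ p q => p.time + q.time + 1
  | loop _ c p => 2 + (.X + .C c) * (p.time + 2)

/-- The frame rule. The footprint is computed from the program text, so for concrete programs its
hypothesis is settled by evaluation. -/
theorem run_nat (p : Cmd) (a : ℕ) (h : p.writesNat a = false) (s : State) :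
    (p.run s).nat a = s.nat a := by
  induction p generalizing s with
  | skip => rfl
  | setNat a' i j e =>
    simp only [writesNat, beq_eq_false_iff_ne] at h
    exact State.setN_nat_ne _ _ _ _ _ _ h
  | setReal => rfl
  | seq p q hp hq =>
    simp only [writesNat, Bool.or_eq_false_iff] at h
    rw [run, hq h.2, hp h.1]
  | branch b p q hp hq =>
    simp only [writesNat, Bool.or_eq_false_iff] at h
    rw [run]; split_ifs
    · exact hp h.1 s
    · exact hq h.2 s
  | loop a' c p hp =>
    simp only [writesNat, Bool.or_eq_false_iff, beq_eq_false_iff_ne] at h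
    have (m : ℕ) : (iter p.run a' s m).nat a = s.nat a := by
      induction m with
      | zero => exact State.setN_nat_ne _ _ _ _ _ _ h.1
      | succ m ih => rw [iter, State.setN_nat_ne _ _ _ _ _ _ h.1, hp h.2, ih]
    exact this _

theorem run_real (p : Cmd) (a : ℕ) (h : p.writesReal a = false) (s : State) :
    (p.run s).real a = s.real a := by
  induction p generalizing s with
  | skip => rfl
  | setNat => rfl
  | setReal a' i j e =>
    simp only [writesReal, beq_eq_false_iff_ne] at h
    exact State.setR_real_ne _ _ _ _ _ _ h
  | seq p q hp hq =>
    simp only [writesReal, Bool.or_eq_false_iff] at h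
    rw [run, hq h.2, hp h.1]
  | branch b p q hp hq =>
    simp only [writesReal, Bool.or_eq_false_iff] at h
    rw [run]; split_ifs
    · exact hp h.1 s
    · exact hq h.2 s
  | loop a' c p hp =>
    simp only [writesReal] at h
    have (m : ℕ) : (iter p.run a' s m).real a = s.real a := by
      induction m with
      | zero => rfl
      | succ m ih => rw [iter, State.setN_real, hp h, ih]
    exact this _

theorem iter_counter (f : State → State) (a : ℕ) (s : State) (m : ℕ) :
    (iter f a s m).nat a 0 0 = m := by
  cases m <;> simp [iter, State.setN_nat]

theorem iter_nat {p : Cmd} {a' : ℕ} (s : State) {a : ℕ} (h : p.writesNat a = false) (ha : a ≠ a')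
    (m : ℕ) : (iter p.run a' s m).nat a = s.nat a := by
  induction m with
  | zero => exact State.setN_nat_ne _ _ _ _ _ _ ha
  | succ m ih => rw [iter, State.setN_nat_ne _ _ _ _ _ _ ha, run_nat p a h, ih]

/-- The compiled program has the effect `run` within the time `time`. -/
theorem exec_compile (p : Cmd) (hp : p.WF = true) (n : ℕ) (s : State) (hs : s.nat 0 0 0 = n)
    (h0 : p.writesNat 0 = false) : ∃ t ≤ p.time.eval n, Exec p.compile s t (p.run s) := by
  induction p generalizing s with
  | skip => exact ⟨1, by simp [time], .skip s⟩
  | setNat a i j e => exact ⟨1, by simp [time], .setNat a i j e s⟩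
  | setReal a i j e => exact ⟨1, by simp [time], .setReal a i j e s⟩
  | seq p q ihp ihq =>
    simp only [WF, writesNat, Bool.and_eq_true, Bool.or_eq_false_iff] at hp h0
    obtain ⟨t₁, ht₁, h₁⟩ := ihp hp.1 s hs h0.1
    obtain ⟨t₂, ht₂, h₂⟩ := ihq hp.2 (p.run s) (by rw [run_nat p 0 h0.1, hs]) h0.2
    exact ⟨t₁ + t₂, by simp only [time, Polynomial.eval_add]; omega, .seq h₁ h₂⟩
  | branch b p q ihp ihq =>
    simp only [WF, writesNat, Bool.and_eq_true, Bool.or_eq_false_iff] at hp h0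
    by_cases hb : b.Holds s
    · obtain ⟨t, ht, h⟩ := ihp hp.1 s hs h0.1
      refine ⟨t + 1, by simp only [time, Polynomial.eval_add, Polynomial.eval_one]; omega, ?_⟩
      simpa [run, hb, compile] using Exec.branch_true (q := q.compile) hb h
    · obtain ⟨t, ht, h⟩ := ihq hp.2 s hs h0.2
      refine ⟨t + 1, by simp only [time, Polynomial.eval_add, Polynomial.eval_one]; omega, ?_⟩
      simpa [run, hb, compile] using Exec.branch_false (p := p.compile) hb h
  | loop a c p ih =>
    simp only [WF, writesNat, Bool.and_eq_true, Bool.or_eq_false_iff, bne_iff_ne,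
      Bool.not_eq_true'] at hp h0
    obtain ⟨⟨⟨ha0, hpa⟩, hp0⟩, hpw⟩ := hp
    set b : Test := .natLe (.add (.var a) (.const 1)) (.add (.var 0) (.const c))
    set body : Prog :=
      .seq p.compile (.setNat a (.const 0) (.const 0) (.add (.var a) (.const 1)))
    have hn (m : ℕ) : (iter p.run a s m).nat 0 0 0 = n := by
      rw [iter_nat s hp0 (Ne.symm ha0), hs]
    have step (m : ℕ) : ∃ t ≤ p.time.eval n + 1,
        Exec body (iter p.run a s m) t (iter p.run a s (m + 1)) := by
      obtain ⟨t, ht, h⟩ := ih hpw (iter p.run a s m) (hn m) hp0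
      refine ⟨t + 1, by omega, ?_⟩
      have h' := Exec.setNat a (.const 0) (.const 0) (.add (.var a) (.const 1))
        (p.run (iter p.run a s m))
      have e : (NExp.add (.var a) (.const 1)).eval (p.run (iter p.run a s m)) = m + 1 := by
        simp only [NExp.eval]
        rw [run_nat p a hpa, iter_counter]
      rw [e] at h'
      exact .seq h h'
    -- Induction on the number `d` of passes still to be made. A pass costs the body, one counter
    -- assignment and one successful test; the final unit pays for the failing test.
    have whole (d : ℕ) : ∀ m, m + d = n + c → ∃ t ≤ d * (p.time.eval n + 2) + 1,
        Exec (.loop b body) (iter p.run a s m) t (iter p.run a s (n + c)) := by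
      induction d with
      | zero =>
        intro m hm
        refine ⟨1, by simp, ?_⟩
        rw [← hm]
        refine .loop_false ?_
        simp only [b, Test.Holds, NExp.eval, iter_counter, hn]
        omega
      | succ d ihd =>
        intro m hm
        obtain ⟨t₁, ht₁, h₁⟩ := step m
        obtain ⟨t₂, ht₂, h₂⟩ := ihd (m + 1) (by omega)
        refine ⟨t₁ + t₂ + 1, by rw [Nat.succ_mul]; omega, .loop_true ?_ h₁ h₂⟩
        simp only [b, Test.Holds, NExp.eval, iter_counter, hn]
        omega
    obtain ⟨t, ht, h⟩ := whole (n + c) 0 (by omega)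
    refine ⟨1 + t, ?_, ?_⟩
    · simp only [time, Polynomial.eval_add, Polynomial.eval_mul, Polynomial.eval_X,
        Polynomial.eval_C, Polynomial.eval_ofNat]
      omega
    · simp only [run, hs]
      exact .seq (.setNat a (.const 0) (.const 0) (.const 0) s) h

/-- Invariants of a loop, indexed by the number of passes. -/
theorem run_loop_nat {p : Cmd} {a c : ℕ} {s : State} (I : ℕ → State → Prop)
    (hI : ∀ m s x, I m s → I m (s.setN a 0 0 x)) (h0 : I 0 s)
    (step : ∀ m < s.nat 0 0 0 + c, ∀ s, s.nat a 0 0 = m → I m s → I (m + 1) (p.run s)) :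
    I (s.nat 0 0 0 + c) ((loop a c p).run s) := by
  have (m : ℕ) (hm : m ≤ s.nat 0 0 0 + c) : I m (iter p.run a s m) := by
    induction m with
    | zero => exact hI _ _ _ h0
    | succ m ih =>
      exact hI _ _ _ (step m (by omega) _ (iter_counter ..) (ih (by omega)))
  exact this _ le_rfl

/-- Invariants of a loop over all vertices, indexed by the set of the vertices that have been
dealt with. -/
theorem run_loop {p : Cmd} {a n : ℕ} {s : State} (hs : s.nat 0 0 0 = n)
    (I : Finset (Fin n) → State → Prop)
    (hI : ∀ P s x, I P s → I P (s.setN a 0 0 x)) (h0 : I ∅ s)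
    (step : ∀ P, ∀ x : Fin n, x ∉ P → ∀ s, s.nat a 0 0 = (x : ℕ) → I P s → I (insert x P) (p.run s)) :
    I Finset.univ ((loop a 0 p).run s) := by
  have := run_loop_nat (p := p) (a := a) (c := 0) (s := s)
    (fun m s => I (Finset.univ.filter fun x : Fin n => (x : ℕ) < m) s)
    (fun _ _ _ h => hI _ _ _ h) (by simpa using h0) (by
      intro m hm s' hm' h
      have hmn : m < n := by omega
      have := step _ ⟨m, hmn⟩ (by simp) s' hm' h
      convert this using 1
      ext x
      simp only [Finset.mem_filter, Finset.mem_univ, true_and, Finset.mem_insert, Fin.ext_iff]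
      omega)
  convert this using 1
  ext x
  have := x.2
  simp [hs]

/-- Invariants of a double loop over all vertices, indexed by the set of the pairs that have been
dealt with. -/
theorem run_loop_loop {p : Cmd} {a b n : ℕ} {s : State} (hs : s.nat 0 0 0 = n)
    (I : Finset (Fin n × Fin n) → State → Prop) (hab : a ≠ b) (ha : a ≠ 0) (hb : b ≠ 0)
    (hp0 : p.writesNat 0 = false)
    (hpa : p.writesNat a = false)
    (hIa : ∀ P s x, I P s → I P (s.setN a 0 0 x)) (hIb : ∀ P s x, I P s → I P (s.setN b 0 0 x))
    (h0 : I ∅ s)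
    (step : ∀ P (x y : Fin n), (x, y) ∉ P → ∀ s, s.nat a 0 0 = (x : ℕ) → s.nat b 0 0 = (y : ℕ) → I P s →
      I (insert (x, y) P) (p.run s)) :
    I Finset.univ ((loop a 0 (loop b 0 p)).run s) := by
  -- Between outer passes the pairs dealt with form `P ×ˢ univ`; within the pass for `x` the set
  -- `{x} ×ˢ Q` is added.
  have := (run_loop (p := loop b 0 p) (a := a) hs
    (fun P s => s.nat 0 0 0 = n ∧ I (P ×ˢ Finset.univ) s)
    (fun P s x h => ⟨by rw [State.setN_nat_ne _ _ _ _ _ _ (Ne.symm ha)]; exact h.1, hIa _ _ _ h.2⟩)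
    ⟨hs, by simpa using h0⟩ (by
      rintro P x hx s hsx ⟨hs0, hI⟩
      refine ⟨by rw [run_nat _ _ (by simp [writesNat, Ne.symm hb, hp0])]; exact hs0, ?_⟩
      have := (run_loop (p := p) (a := b) hs0
        (fun Q s => s.nat a 0 0 = (x : ℕ) ∧ I (P ×ˢ Finset.univ ∪ {x} ×ˢ Q) s)
        (fun P s x h => ⟨by rw [State.setN_nat_ne _ _ _ _ _ _ hab]; exact h.1, hIb _ _ _ h.2⟩)
        ⟨hsx, by simpa using hI⟩ (by
          rintro Q y hy s hsy ⟨hsx, hI⟩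
          refine ⟨by rw [run_nat _ _ hpa]; exact hsx, ?_⟩
          have := step _ x y (by simp [hx, hy]) s hsx hsy hI
          convert this using 1
          ext ⟨u, v⟩
          simp only [Finset.mem_union, Finset.mem_product, Finset.mem_insert, Finset.mem_singleton,
            Finset.mem_univ, Prod.mk.injEq, and_true]
          tauto)).2
      convert this using 1
      ext ⟨u, v⟩
      simp only [Finset.mem_union, Finset.mem_product, Finset.mem_insert, Finset.mem_singleton,
        Finset.mem_univ, and_true]
      tauto)).2
  simpa using this

end Cmd

end WSpanner

/-! ### Weighted distances -/

namespace WSpanner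

variable {V : Type*} {G H K : SimpleGraph V} {w : Sym2 V → ℝ≥0} {u v x y z : V}

theorem wdist_self (G : SimpleGraph V) (w : Sym2 V → ℝ≥0) (u : V) : wdist G w u u = 0 := by
  refine le_antisymm ((iInf_le _ (.nil : G.Walk u u)).trans ?_) bot_le
  simp [walkWeight]

theorem wdist_le (w : Sym2 V → ℝ≥0) (p : G.Walk u v) : wdist G w u v ≤ walkWeight w p :=
  iInf_le _ p

theorem wdist_of_adj (w : Sym2 V → ℝ≥0) (h : G.Adj u v) : wdist G w u v ≤ w s(u, v) := by
  simpa [walkWeight] using wdist_le w h.toWalk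

theorem wdist_triangle (G : SimpleGraph V) (w : Sym2 V → ℝ≥0) (u v x : V) :
    wdist G w u x ≤ wdist G w u v + wdist G w v x := by
  simp only [wdist]
  refine ENNReal.le_iInf_add_iInf fun p q => ?_
  refine (iInf_le _ (p.append q)).trans ?_
  simp [walkWeight]

theorem wdist_comm (G : SimpleGraph V) (w : Sym2 V → ℝ≥0) (u v : V) :
    wdist G w u v = wdist G w v u := by
  have (u v : V) : wdist G w u v ≤ wdist G w v u := by
    refine le_iInf fun p => (wdist_le w p.reverse).trans ?_
    simp [walkWeight]
  exact le_antisymm (this u v) (this v u)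

theorem wdist_mono (h : H ≤ G) (w : Sym2 V → ℝ≥0) (u v : V) : wdist G w u v ≤ wdist H w u v := by
  refine le_iInf fun p => (wdist_le w (p.mapLe h)).trans ?_
  simp [walkWeight]

theorem wdist_bot (w : Sym2 V → ℝ≥0) (h : u ≠ v) : wdist (⊥ : SimpleGraph V) w u v = ⊤ := by
  refine iInf_eq_top.2 fun p => ?_
  cases p with
  | nil => exact absurd rfl h
  | cons h' _ => exact absurd h' (by simp)

/-- It suffices to check lower bounds for distances on edges. -/
theorem le_wdist {f : V → ℝ≥0∞} (h0 : f v = 0)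
    (h : ∀ x y, G.Adj x y → f x ≤ w s(x, y) + f y) (u : V) : f u ≤ wdist G w u v := by
  refine le_iInf fun p => ?_
  induction p with
  | nil => simp [h0]
  | cons hadj p ih =>
    refine (h _ _ hadj).trans ?_
    simp only [walkWeight, SimpleGraph.Walk.edges_cons, List.map_cons, List.sum_cons,
      ENNReal.coe_add]
    gcongr
    exact ih h0

/-- A shortest path uses the new edge at most once, in one of two directions. For the lower bound
the right-hand side is treated as a potential in `u`: it vanishes at `v` and changes along each edge
by at most the weight, so no path has to be cut. -/
theorem wdist_sup_edge (H : SimpleGraph V) (w : Sym2 V → ℝ≥0) (hxy : x ≠ y) (u v : V) :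
    wdist (H ⊔ SimpleGraph.edge x y) w u v =
      min (wdist H w u v) (min (wdist H w u x + w s(x, y) + wdist H w y v)
        (wdist H w u y + w s(x, y) + wdist H w x v)) := by
  have hle : H ≤ H ⊔ SimpleGraph.edge x y := le_sup_left
  have hadj : (H ⊔ SimpleGraph.edge x y).Adj x y := by simp [SimpleGraph.edge_adj, hxy]
  have hw := wdist_of_adj w hadj
  refine le_antisymm (le_min (wdist_mono hle w u v) (le_min ?_ ?_)) ?_
  · refine (wdist_triangle _ w u y v).trans (add_le_add ((wdist_triangle _ w u x y).trans ?_) ?_)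
    · exact add_le_add (wdist_mono hle w _ _) hw
    · exact wdist_mono hle w _ _
  · refine (wdist_triangle _ w u x v).trans (add_le_add ((wdist_triangle _ w u y x).trans ?_) ?_)
    · rw [wdist_comm _ w y x]
      exact add_le_add (wdist_mono hle w _ _) hw
    · exact wdist_mono hle w _ _
  · refine le_wdist (f := fun u => min (wdist H w u v) (min (wdist H w u x + w s(x, y) +
      wdist H w y v) (wdist H w u y + w s(x, y) + wdist H w x v))) (by simp [wdist_self]) ?_ u
    intro a b hab
    rw [SimpleGraph.sup_adj, SimpleGraph.edge_adj] at hab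
    simp only [← min_add_add_left]
    rcases hab with hab | ⟨⟨rfl, rfl⟩ | ⟨rfl, rfl⟩, -⟩
    · have h1 (c : V) : wdist H w a c ≤ w s(a, b) + wdist H w b c :=
        (wdist_triangle H w a b c).trans (add_le_add (wdist_of_adj w hab) le_rfl)
      refine min_le_min (h1 v) (min_le_min ?_ ?_)
      · rw [← add_assoc, ← add_assoc]; gcongr; exact h1 x
      · rw [← add_assoc, ← add_assoc]; gcongr; exact h1 y
    · simp only [wdist_self, zero_add]
      refine le_min (min_le_of_right_le (min_le_left _ _)) (le_min ?_ ?_)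
      · refine min_le_of_right_le (min_le_of_left_le ?_)
        gcongr
        exact le_add_self
      · refine min_le_of_left_le ?_
        rw [← add_assoc]
        exact le_add_self
    · simp only [wdist_self, zero_add, Sym2.eq_swap (a := a) (b := b)]
      refine le_min (min_le_of_right_le (min_le_right _ _)) (le_min ?_ ?_)
      · refine min_le_of_left_le ?_
        rw [← add_assoc]
        exact le_add_self
      · refine min_le_of_right_le (min_le_of_right_le ?_)
        gcongr
        exact le_add_self

/-! ### Hop distances -/

/-- The number of edges of a shortest path. -/
noncomputable def hop (G : SimpleGraph V) (u v : V) : ℝ≥0∞ := wdist G (fun _ => 1) u v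

theorem exists_walk_of_hop_lt {t : ℕ} (h : hop G u v < t + 1) :
    ∃ p : G.Walk u v, p.length ≤ t := by
  obtain ⟨p, hp⟩ := iInf_lt_iff.1 h
  refine ⟨p, ?_⟩
  simp only [walkWeight, List.map_const', List.sum_replicate, SimpleGraph.Walk.length_edges,
    nsmul_eq_mul, mul_one] at hp
  have : (p.length : ℝ≥0∞) < (t + 1 : ℕ) := by exact_mod_cast hp
  have := Nat.cast_lt.1 this
  omega

theorem hop_le_walk (p : G.Walk u v) : hop G u v ≤ p.length := by
  refine (wdist_le _ p).trans ?_
  simp [walkWeight]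

theorem hop_le_of_lt {t : ℕ} (h : hop G u v < t + 1) : hop G u v ≤ t := by
  obtain ⟨p, hp⟩ := exists_walk_of_hop_lt h
  exact (hop_le_walk p).trans (by exact_mod_cast hp)

theorem one_le_hop (h : u ≠ v) : 1 ≤ hop G u v := by
  by_contra! hlt
  obtain ⟨p, hp⟩ := exists_walk_of_hop_lt (t := 0) (by simpa using hlt)
  exact h (SimpleGraph.Walk.eq_of_length_eq_zero (p := p) (by omega))

theorem hop_of_adj (h : G.Adj u v) : hop G u v ≤ 1 := by
  exact (wdist_of_adj (fun _ => 1) h).trans (by simp)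

theorem hop_comm (G : SimpleGraph V) (u v : V) : hop G u v = hop G v u := wdist_comm _ _ _ _

theorem hop_triangle (G : SimpleGraph V) (u v x : V) : hop G u x ≤ hop G u v + hop G v x :=
  wdist_triangle _ _ _ _ _

/-- Links weights to hops: in a graph with edges of weight at most `W`, a distance above `k * W`
forces more than `k` hops, and the ball of `t` hops lies in the ball of radius `t * W`. -/
theorem wdist_le_of_hop_le {t : ℕ} {W : ℝ≥0} (hW : ∀ x y, G.Adj x y → w s(x, y) ≤ W)
    (h : hop G u v ≤ t) : wdist G w u v ≤ t * W := by
  obtain ⟨p, hp⟩ := exists_walk_of_hop_lt (h.trans_lt (ENNReal.lt_add_right (by simp) (by simp)))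
  have key : walkWeight w p ≤ p.length * W := by
    clear hp h
    induction p with
    | nil => simp [walkWeight]
    | cons hadj p ih =>
      simp only [walkWeight, SimpleGraph.Walk.edges_cons, List.map_cons, List.sum_cons,
        SimpleGraph.Walk.length_cons] at ih ⊢
      push_cast
      rw [add_mul, one_mul, add_comm]
      exact add_le_add ih (hW _ _ hadj)
  refine (wdist_le w p).trans ?_
  have : walkWeight w p ≤ t * W := key.trans (by gcongr)
  exact_mod_cast this

/-! ### Graphs without short cycles -/

/-- Deleting an edge increases the distance of its ends to more than `k`; that is, the graph has
no cycle with at most `k + 1` edges. -/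
def ShortcutFree (k : ℕ) (H : SimpleGraph V) : Prop :=
  ∀ u v, H.Adj u v → (k : ℝ≥0∞) < hop (H \ SimpleGraph.edge u v) u v

theorem ShortcutFree.mono {k : ℕ} (h : ShortcutFree k H) (hK : K ≤ H) : ShortcutFree k K :=
  fun u v huv => (h u v (hK huv)).trans_le (wdist_mono (sdiff_le_sdiff_right hK) _ u v)

theorem sdiff_sup_edge (h : H.Adj u v) :
    (H \ SimpleGraph.edge u v) ⊔ SimpleGraph.edge u v = H :=
  sdiff_sup_cancel (by rw [SimpleGraph.edge_le_iff]; exact Or.inr h)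

theorem hop_sup_edge (H : SimpleGraph V) (hxy : x ≠ y) (u v : V) :
    hop (H ⊔ SimpleGraph.edge x y) u v =
      min (hop H u v) (min (hop H u x + 1 + hop H y v) (hop H u y + 1 + hop H x v)) := by
  simpa [hop] using wdist_sup_edge H (fun _ => 1) hxy u v

/-- A short cycle created by the insertion contains the new edge, and the rest of it joins `x` to
`y` in the old graph by at most `k` hops. For an old edge `uv` this is `htri`: the two parts of a
detour from `u` to `v` through `xy`, joined by `uv` itself, lead from `x` to `y`. -/
theorem ShortcutFree.sup_edge {k : ℕ} (h : ShortcutFree k H) (hxy : x ≠ y)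
    (hd : (k : ℝ≥0∞) < hop H x y) : ShortcutFree k (H ⊔ SimpleGraph.edge x y) := by
  classical
  have hdel {u v : V} (hne : u ≠ v) (huv : s(u, v) ≠ s(x, y)) :
      (H ⊔ SimpleGraph.edge x y) \ SimpleGraph.edge u v =
        (H \ SimpleGraph.edge u v) ⊔ SimpleGraph.edge x y := by
    rw [sup_sdiff]
    congr 1
    ext a b
    simp only [SimpleGraph.sdiff_adj, SimpleGraph.edge_adj]
    simp only [ne_eq, Sym2.eq_iff] at huv
    aesop
  intro u v huv
  have hne := huv.ne
  by_cases he : s(u, v) = s(x, y)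
  · have hle : (H ⊔ SimpleGraph.edge x y) \ SimpleGraph.edge u v ≤ H := by
      have : SimpleGraph.edge u v = SimpleGraph.edge x y := by
        simp only [SimpleGraph.edge, he]
      rw [this]
      exact sdiff_le_iff.2 (by rw [sup_comm])
    rcases Sym2.eq_iff.1 he with ⟨rfl, rfl⟩ | ⟨rfl, rfl⟩
    · exact hd.trans_le (wdist_mono hle _ _ _)
    · refine hd.trans_le (le_trans ?_ (wdist_mono hle _ _ _))
      exact (wdist_comm _ _ _ _).le
  · rw [hdel hne he, hop_sup_edge _ hxy]
    have hH : H.Adj u v := by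
      rw [SimpleGraph.sup_adj, SimpleGraph.edge_adj] at huv
      rcases huv with h | ⟨h, -⟩
      · exact h
      · exact absurd (by rw [Sym2.eq_iff]; tauto) he
    set H' := H \ SimpleGraph.edge u v
    have h1 := hop_of_adj hH
    have hle : H' ≤ H := sdiff_le
    have htri (a b : V) (hab : hop H a b ≤ 1) :
        hop H x y ≤ hop H' a x + 1 + hop H' y b := by
      calc hop H x y ≤ hop H x a + hop H a y := wdist_triangle _ _ _ _ _
        _ ≤ hop H x a + (hop H a b + hop H b y) := by
            gcongr; exact wdist_triangle _ _ _ _ _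
        _ ≤ hop H' x a + (1 + hop H' b y) := by
            gcongr <;> exact wdist_mono hle _ _ _
        _ = hop H' a x + 1 + hop H' y b := by
            rw [hop_comm _ x a, hop_comm _ b y, add_assoc]
    refine lt_min (h u v hH) (lt_min (hd.trans_le (htri u v h1)) (hd.trans_le ?_))
    refine (htri v u (by rw [hop_comm]; exact h1)).trans ?_
    rw [hop_comm _ v x, hop_comm _ y u]
    exact le_of_eq (by ring)

/-- In a graph without short cycles a vertex has at most one neighbor that is not farther from a
given vertex. -/
theorem ShortcutFree.neighbor_unique {k t : ℕ} (h : ShortcutFree k K) (ht : 2 * t + 1 ≤ k)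
    {u₁ u₂ : V} (hv : (t : ℝ≥0∞) ≤ hop K x v) (h₁ : K.Adj v u₁) (h₂ : K.Adj v u₂)
    (hu₁ : hop K x u₁ ≤ t) (hu₂ : hop K x u₂ ≤ t) : u₁ = u₂ := by
  by_contra hne
  set K' := K \ SimpleGraph.edge v u₁ with hK'
  have hK := sdiff_sup_edge h₁
  rw [← hK'] at hK
  have hle : K' ≤ K := sdiff_le
  -- Deleting the edge `v u₁` does not spoil `t`-hop paths from `x` to vertices other than `v`: a
  -- path through that edge visits `v`, at `t` hops or more, and needs at least one further hop.
  have hx (z : V) (hz : z ≠ v) (hd : hop K x z ≤ t) : hop K' x z ≤ t := by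
    have hlt : (t : ℝ≥0∞) < t + 1 := ENNReal.lt_add_right (by simp) (by simp)
    have hd' := hd
    rw [← hK, hop_sup_edge _ h₁.ne, min_le_iff, min_le_iff] at hd'
    rcases hd' with hd' | hd' | hd'
    · exact hd'
    · refine absurd hd' (not_le.2 (hlt.trans_le ?_))
      calc (t : ℝ≥0∞) + 1 ≤ hop K' x v + 1 := by
            gcongr; exact hv.trans (wdist_mono hle _ _ _)
        _ ≤ _ := le_self_add
    · refine absurd hd' (not_le.2 (hlt.trans_le ?_))
      refine add_le_add (hv.trans ?_) (one_le_hop (Ne.symm hz))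
      calc hop K x v ≤ hop K x u₁ + hop K u₁ v := wdist_triangle _ _ _ _ _
        _ ≤ hop K' x u₁ + 1 := by
          gcongr
          · exact wdist_mono hle _ _ _
          · exact hop_of_adj h₁.symm
  have hu₁' := hx u₁ h₁.ne' hu₁
  have hu₂' := hx u₂ h₂.ne' hu₂
  have h₂' : K'.Adj v u₂ := by
    rw [hK', SimpleGraph.sdiff_adj, SimpleGraph.edge_adj]
    refine ⟨h₂, ?_⟩
    have := h₂.ne
    have := h₁.ne
    rintro ⟨⟨-, h⟩ | ⟨h, -⟩, -⟩
    · exact hne h.symm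
    · exact this h
  -- The walk from `v` over `u₂` and `x` to `u₁` avoids the deleted edge and has at most `1 + 2 * t`
  -- edges.
  refine absurd (h v u₁ h₁) (not_lt.2 ?_)
  rw [← hK']
  calc hop K' v u₁ ≤ hop K' v u₂ + hop K' u₂ u₁ := wdist_triangle _ _ _ _ _
    _ ≤ hop K' v u₂ + (hop K' u₂ x + hop K' x u₁) := by gcongr; exact wdist_triangle _ _ _ _ _
    _ ≤ 1 + (t + t) := by
      gcongr
      · exact hop_of_adj h₂'
      · rw [hop_comm]; exact hu₂'
    _ ≤ k := by
      have : 1 + (t + t) ≤ k := by omega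
      exact_mod_cast this

open Classical in
/-- Balls in a graph without short cycles and with large degrees are large. -/
theorem ShortcutFree.pow_le_card_ball [Fintype V] {k l r : ℕ} (h : ShortcutFree k K)
    (hl : 2 * l ≤ k) (hx : r ≤ (K.neighborSet x).ncard)
    (hdeg : ∀ v, v ≠ x → hop K x v < l → r + 1 ≤ (K.neighborSet v).ncard) :
    r ^ l ≤ (Finset.univ.filter fun v => hop K x v ≤ l).card := by
  -- Double counting between consecutive spheres: a vertex has at least `r` neighbors in the next
  -- sphere and at most one in the previous one.
  have key : ∀ t ≤ l, r ^ t ≤ (Finset.univ.filter fun v => hop K x v = t).card := by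
    intro t
    induction t with
    | zero =>
      intro _
      rw [pow_zero, Nat.one_le_iff_ne_zero, Finset.card_ne_zero]
      exact ⟨x, by simp [hop, wdist_self]⟩
    | succ t ih =>
      intro ht
      refine (Nat.mul_le_mul_right r (ih (by omega))).trans ?_
      rw [← mul_one (Finset.card (Finset.univ.filter fun v => hop K x v = (t + 1 : ℕ)))]
      refine Finset.card_mul_le_card_mul K.Adj ?_ ?_
      · intro v hv
        simp only [Finset.mem_filter, Finset.mem_univ, true_and] at hv
        have hsub : (K.neighborSet v).toFinset.filter (fun u => ¬ hop K x u ≤ t) ⊆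
            (Finset.univ.filter fun u => hop K x u = (t + 1 : ℕ)).bipartiteAbove K.Adj v := by
          intro u hu
          simp only [Finset.mem_filter, Set.mem_toFinset, SimpleGraph.mem_neighborSet] at hu
          simp only [Finset.mem_bipartiteAbove, Finset.mem_filter, Finset.mem_univ, true_and]
          refine ⟨?_, hu.1⟩
          have : hop K x u ≤ (t + 1 : ℕ) := by
            push_cast
            rw [← hv]
            exact (hop_triangle _ _ v _).trans (by gcongr; exact hop_of_adj hu.1)
          refine le_antisymm this ?_
          by_contra! hlt
          exact hu.2 (hop_le_of_lt (by exact_mod_cast hlt))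
        refine le_trans ?_ (Finset.card_le_card hsub)
        have hsplit := Finset.card_filter_add_card_filter_not (s := (K.neighborSet v).toFinset)
          (fun u => hop K x u ≤ t)
        rw [← Set.ncard_eq_toFinset_card'] at hsplit
        -- The center has no neighbor at distance 0, so `r` neighbors suffice there; any other
        -- vertex may lose one neighbor that is not farther from the center.
        by_cases hvx : v = x
        · subst hvx
          have ht0 : t = 0 := by
            rw [hop, wdist_self] at hv
            exact_mod_cast hv.symm
          have : ((K.neighborSet v).toFinset.filter fun u => hop K v u ≤ t) = ∅ := by
            refine Finset.filter_eq_empty_iff.2 fun u hu hle => ?_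
            simp only [Set.mem_toFinset, SimpleGraph.mem_neighborSet] at hu
            have := (one_le_hop (G := K) hu.ne).trans hle
            rw [ht0] at this
            simp at this
          rw [this, Finset.card_empty] at hsplit
          omega
        · have h1 := hdeg v hvx (by rw [hv]; exact_mod_cast (show t < l by omega))
          have : ((K.neighborSet v).toFinset.filter fun u => hop K x u ≤ t).card ≤ 1 := by
            refine Finset.card_le_one.2 fun a ha b hb => ?_
            simp only [Finset.mem_filter, Set.mem_toFinset, SimpleGraph.mem_neighborSet] at ha hb
            exact h.neighbor_unique (t := t) (by omega) hv.ge ha.1 hb.1 ha.2 hb.2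
          omega
      · intro u hu
        simp only [Finset.mem_filter, Finset.mem_univ, true_and] at hu
        refine Finset.card_le_one.2 fun a ha b hb => ?_
        simp only [Finset.mem_bipartiteBelow, Finset.mem_filter, Finset.mem_univ,
          true_and] at ha hb
        exact h.neighbor_unique (t := t) (v := u) (x := x) (by omega)
          (by rw [hu]; push_cast; exact le_self_add) ha.2.symm hb.2.symm ha.1.le hb.1.le
  refine (key l le_rfl).trans (Finset.card_le_card fun v hv => ?_)
  simp only [Finset.mem_filter, Finset.mem_univ, true_and] at hv ⊢
  exact hv.le

/-! ### Degenerate graphs -/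

/-- Every subgraph with an edge has a vertex of small degree. -/
def Degenerate (r : ℕ) (H : SimpleGraph V) : Prop :=
  ∀ K ≤ H, K ≠ ⊥ → ∃ v ∈ K.support, (K.neighborSet v).ncard ≤ r

/-- Vertices of degree at most `r` are deleted one by one, and each deletion shrinks the support, on
whose size the induction runs. -/
theorem Degenerate.ncard_edgeSet_le [Fintype V] {r : ℕ} (h : Degenerate r H) :
    H.edgeSet.ncard ≤ r * Fintype.card V := by
  classical
  have key : ∀ m, ∀ K ≤ H, K.support.ncard ≤ m → K.edgeSet.ncard ≤ r * m := by
    intro m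
    induction m with
    | zero =>
      intro K _ hm
      have hK : K.support = ∅ := by
        rw [← Set.ncard_eq_zero]; omega
      have : K = ⊥ := by simpa using hK
      simp [this]
    | succ m ih =>
      intro K hK hm
      by_cases hbot : K = ⊥
      · simp [hbot]
      obtain ⟨v, hv, hdeg⟩ := h K hK hbot
      have hle : K.deleteIncidenceSet v ≤ K := K.deleteIncidenceSet_le v
      have hs := K.support_deleteIncidenceSet_subset v
      have h1 := ih _ (hle.trans hK) (by
        have := Set.ncard_le_ncard hs
        rw [Set.ncard_sdiff_singleton_of_mem hv] at this
        omega)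
      have h2 := K.card_edgeFinset_deleteIncidenceSet v
      rw [← SimpleGraph.coe_edgeFinset, Set.ncard_coe_finset] at h1
      rw [← SimpleGraph.coe_edgeFinset, Set.ncard_coe_finset, Nat.mul_succ]
      have h3 : K.degree v ≤ r := by
        rw [← SimpleGraph.card_neighborSet_eq_degree, ← Nat.card_eq_fintype_card]
        exact hdeg
      omega
  have := key (Fintype.card V) H le_rfl (by
    rw [← Nat.card_eq_fintype_card, ← Set.ncard_univ]
    exact Set.ncard_le_ncard (Set.subset_univ _))
  exact this

end WSpanner

namespace WSpanner

variable {V : Type*} {G H K : SimpleGraph V} {w : Sym2 V → ℝ≥0} {u v x y z : V}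

/-! ### The greedy phase -/

/-- The state of the greedy phase: `H` is the current graph, `D` the set of the edges that have been
dealt with, and `S b z`, if the flag `F b z` is set, a large set of vertices near `z`. -/
structure Greedy (G : SimpleGraph V) (w : Sym2 V → ℝ≥0) (k : ℕ) (ρ : Bool → ℕ) (r : ℕ)
    (H : SimpleGraph V) (D : V → V → Prop) (F : Bool → V → Prop) (S : Bool → V → V → Prop) :
    Prop where
  le : H ≤ G
  edge_le : ∀ u v, G.Adj u v → ¬ D u v → ∀ x y, H.Adj x y → w s(x, y) ≤ w s(u, v)
  row_le : ∀ b z, F b z → ∀ y, S b z y → ∀ u v, G.Adj u v → ¬ D u v →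
    wdist H w z y ≤ ρ b * w s(u, v)
  done : ∀ x y, G.Adj x y → D x y → wdist H w x y ≤ k * w s(x, y) ∨
    ∀ b z, z = x ∨ z = y → F b z ∧ ∀ v, S b z v → wdist H w z v ≤ ρ b * w s(x, y)
  large : ∀ b z, F b z → r ^ ρ b ≤ {v | S b z v}.ncard
  free : ShortcutFree k H
  degenerate : Degenerate r H

variable {k r : ℕ} {ρ : Bool → ℕ} {D : V → V → Prop} {F : Bool → V → Prop}
  {S : Bool → V → V → Prop}

theorem Greedy.init (hF : ∀ b z, ¬ F b z) (hD : ∀ x y, ¬ D x y) :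
    Greedy G w k ρ r ⊥ D F S where
  le := bot_le
  edge_le := by simp
  row_le := fun b z h => absurd h (hF b z)
  done := fun x y _ h => absurd h (hD x y)
  large := fun b z h => absurd h (hF b z)
  free := by intro u v h; simp at h
  degenerate := fun K hK hb => absurd (le_bot_iff.1 hK) hb

/-- The row that is overwritten is unflagged, and no clause of the invariant relies on unflagged
rows. Since `W` is at most the weight of every edge still to come, a ball of radius `ρ b₀ * W` also
satisfies `row_le` for all later edges. -/
theorem Greedy.settle (h : Greedy G w k ρ r H D F S) {W : ℝ≥0}
    (hW : ∀ u v, G.Adj u v → ¬ D u v → W ≤ w s(u, v)) {b₀ : Bool} {z₀ : V} (hF : ¬ F b₀ z₀)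
    {F' : Bool → V → Prop} {S' : Bool → V → V → Prop}
    (hF' : ∀ b z, ¬ (b = b₀ ∧ z = z₀) → (F' b z ↔ F b z))
    (hS' : ∀ b z, ¬ (b = b₀ ∧ z = z₀) → ∀ v, S' b z v ↔ S b z v)
    (hF₀ : F' b₀ z₀ → r ^ ρ b₀ ≤ {v | S' b₀ z₀ v}.ncard)
    (hS₀ : ∀ v, S' b₀ z₀ v ↔ wdist H w z₀ v ≤ ρ b₀ * W) : Greedy G w k ρ r H D F' S' where
  le := h.le
  edge_le := h.edge_le
  row_le := by
    intro b z hz y hy u v huv hD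
    by_cases hb : b = b₀ ∧ z = z₀
    · obtain ⟨rfl, rfl⟩ := hb
      exact ((hS₀ y).1 hy).trans (by gcongr; exact hW u v huv hD)
    · exact h.row_le b z ((hF' b z hb).1 hz) y ((hS' b z hb y).1 hy) u v huv hD
  done := by
    intro x y hxy hD
    refine (h.done x y hxy hD).imp_right fun h' b z hz => ?_
    obtain ⟨h1, h2⟩ := h' b z hz
    have hb : ¬ (b = b₀ ∧ z = z₀) := by
      rintro ⟨rfl, rfl⟩; exact hF h1
    exact ⟨(hF' b z hb).2 h1, fun v hv => h2 v ((hS' b z hb v).1 hv)⟩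
  large := by
    intro b z hz
    by_cases hb : b = b₀ ∧ z = z₀
    · obtain ⟨rfl, rfl⟩ := hb
      exact hF₀ hz
    · simp only [hS' b z hb]
      exact h.large b z ((hF' b z hb).1 hz)
  free := h.free
  degenerate := h.degenerate

/-- If the edge is left out because of flags, the stored balls may stem from an earlier, lighter
edge; `row_le` says that they fit into the radius belonging to the present edge. -/
theorem Greedy.skip_edge (h : Greedy G w k ρ r H D F S) (hxy : ¬ D x y)
    (hadj : G.Adj x y) {D' : V → V → Prop} (hD' : ∀ u v, D' u v ↔ D u v ∨ u = x ∧ v = y)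
    (hskip : wdist H w x y ≤ k * w s(x, y) ∨ ∀ b z, z = x ∨ z = y → F b z) :
    Greedy G w k ρ r H D' F S where
  le := h.le
  edge_le := fun u v huv hD => h.edge_le u v huv (fun h' => hD ((hD' u v).2 (.inl h')))
  row_le := fun b z hz y hy u v huv hD =>
    h.row_le b z hz y hy u v huv (fun h' => hD ((hD' u v).2 (.inl h')))
  done := by
    intro u v huv hD
    rcases (hD' u v).1 hD with hD | ⟨rfl, rfl⟩
    · exact h.done u v huv hD
    · refine hskip.imp_right fun h' b z hz => ⟨h' b z hz, fun v' hv' => ?_⟩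
      exact h.row_le b z (h' b z hz) v' hv' u v hadj hxy
  large := h.large
  free := h.free
  degenerate := h.degenerate

theorem mem_support_of_hop_lt_top (hne : x ≠ v) {l : ℕ} (h : hop K x v < l) : v ∈ K.support := by
  obtain ⟨p, -⟩ := exists_walk_of_hop_lt (h.trans (ENNReal.lt_add_right (by simp) (by simp)))
  generalize p.reverse = q at *
  cases q with
  | nil => exact absurd rfl hne
  | cons hadj _ => exact ⟨_, hadj⟩

/-- Only subgraphs `K` that contain the new edge matter. If all degrees in `K` exceeded `r`, then in
`K` without that edge `x` would keep `r` neighbors, and every other vertex within fewer than `l`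
hops of `x` would keep all of its neighbors, because `y` is more than `k` hops away. Growth of balls
then contradicts `hball`. -/
theorem Degenerate.sup_edge [Finite V] (h : Degenerate r H) {l : ℕ} (hne : x ≠ y)
    (hfree : ShortcutFree k H) (hl : 2 * l ≤ k) (hd : (k : ℝ≥0∞) < hop H x y)
    (hball : {v | hop H x v ≤ l}.ncard < r ^ l) : Degenerate r (H ⊔ SimpleGraph.edge x y) := by
  classical
  have := Fintype.ofFinite V
  intro K hK hbot
  by_cases hadj : K.Adj x y
  swap
  · refine h K (fun a b hab => ?_) hbot
    have := hK hab
    rw [SimpleGraph.sup_adj, SimpleGraph.edge_adj] at this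
    rcases this with h | ⟨⟨rfl, rfl⟩ | ⟨rfl, rfl⟩, -⟩
    · exact h
    · exact absurd hab hadj
    · exact absurd hab.symm hadj
  by_contra! hdeg
  set K' := K \ SimpleGraph.edge x y
  have hK' : K' ≤ H := sdiff_le_iff.2 (by rw [sup_comm]; exact hK)
  refine absurd ((hfree.mono hK').pow_le_card_ball (x := x) (r := r) hl ?_ ?_) (not_le.2 ?_)
  · have h1 := hdeg x ⟨y, hadj⟩
    have h2 : K.neighborSet x \ {y} ⊆ K'.neighborSet x := by
      intro a ha
      simp only [Set.mem_sdiff, SimpleGraph.mem_neighborSet, Set.mem_singleton_iff] at ha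
      simp only [K', SimpleGraph.mem_neighborSet, SimpleGraph.sdiff_adj, SimpleGraph.edge_adj]
      refine ⟨ha.1, ?_⟩
      rintro ⟨⟨-, h⟩ | ⟨h, -⟩, -⟩
      · exact ha.2 h
      · exact hne h
    have h3 := Set.ncard_le_ncard h2
    rw [Set.ncard_sdiff_singleton_of_mem (by exact hadj)] at h3
    omega
  · intro v hvx hv
    have hvy : v ≠ y := by
      rintro rfl
      have h1 : (l : ℝ≥0∞) ≤ k := by exact_mod_cast (by omega : l ≤ k)
      exact absurd (hd.trans_le (wdist_mono hK' _ _ _)) (not_lt.2 (hv.le.trans h1))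
    have hs := SimpleGraph.support_mono (sdiff_le : K' ≤ K)
      (mem_support_of_hop_lt_top hvx.symm hv)
    refine (Nat.succ_le_of_lt (hdeg v hs)).trans (Set.ncard_le_ncard ?_)
    intro a ha
    simp only [SimpleGraph.mem_neighborSet] at ha
    simp only [K', SimpleGraph.mem_neighborSet, SimpleGraph.sdiff_adj, SimpleGraph.edge_adj]
    exact ⟨ha, by tauto⟩
  · refine lt_of_le_of_lt ?_ hball
    rw [← Set.ncard_coe_finset]
    refine Set.ncard_le_ncard fun v hv => ?_
    simp only [Finset.coe_filter, Finset.mem_univ, true_and, Set.mem_ofPred_eq] at hv ⊢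
    exact (wdist_mono hK' _ _ _).trans hv

/-- Edges of `H` are no heavier than `xy`. Hence `hd` puts `x` and `y` more than `k` hops apart, and
the ball of `ρ b` hops around `z`, being contained in the weighted ball, is small as well: this is
the input for preserving `free` and `degenerate`. -/
theorem Greedy.add_edge [Finite V] (h : Greedy G w k ρ r H D F S) (hxy : ¬ D x y)
    (hadj : G.Adj x y) (hmin : ∀ u v, G.Adj u v → ¬ D u v → w s(x, y) ≤ w s(u, v))
    (hk : 1 ≤ k) (hρ : ∀ b, 2 * ρ b ≤ k)
    {D' : V → V → Prop} (hD' : ∀ u v, D' u v ↔ D u v ∨ u = x ∧ v = y)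
    (hd : ¬ wdist H w x y ≤ k * w s(x, y)) {b : Bool} (hz : z = x ∨ z = y)
    (hball : {v | wdist H w z v ≤ ρ b * w s(x, y)}.ncard < r ^ ρ b) :
    Greedy G w k ρ r (H ⊔ SimpleGraph.edge x y) D' F S := by
  have hle : H ≤ H ⊔ SimpleGraph.edge x y := le_sup_left
  have hHw := h.edge_le x y hadj hxy
  have hhop : (k : ℝ≥0∞) < hop H x y := by
    by_contra! hlt
    exact hd (wdist_le_of_hop_le hHw hlt)
  have hball' : {v | hop H z v ≤ ρ b}.ncard < r ^ ρ b :=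
    (Set.ncard_le_ncard fun v hv => wdist_le_of_hop_le hHw hv).trans_lt hball
  refine ⟨?_, ?_, ?_, ?_, h.large, h.free.sup_edge hadj.ne hhop, ?_⟩
  · refine sup_le h.le ?_
    rw [SimpleGraph.edge_le_iff]
    exact Or.inr hadj
  · intro u v huv hD a b hab
    have hD : ¬ D u v := fun h' => hD ((hD' u v).2 (.inl h'))
    rw [SimpleGraph.sup_adj, SimpleGraph.edge_adj] at hab
    rcases hab with hab | ⟨⟨rfl, rfl⟩ | ⟨rfl, rfl⟩, -⟩
    · exact h.edge_le u v huv hD a b hab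
    · exact hmin u v huv hD
    · rw [Sym2.eq_swap]; exact hmin u v huv hD
  · intro b z hz y hy u v huv hD
    exact (wdist_mono hle _ _ _).trans
      (h.row_le b z hz y hy u v huv (fun h' => hD ((hD' u v).2 (.inl h'))))
  · intro u v huv hD
    rcases (hD' u v).1 hD with hD | ⟨rfl, rfl⟩
    · refine (h.done u v huv hD).imp (wdist_mono hle _ _ _).trans fun h' b z hz => ?_
      exact ⟨(h' b z hz).1, fun v hv => (wdist_mono hle _ _ _).trans ((h' b z hz).2 v hv)⟩
    · left
      refine (wdist_of_adj w ?_).trans (le_mul_of_one_le_left' (by exact_mod_cast hk))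
      simp [SimpleGraph.edge_adj, hadj.ne]
  · rcases hz with rfl | rfl
    · exact h.degenerate.sup_edge hadj.ne h.free (hρ b) hhop hball'
    · rw [SimpleGraph.edge_comm]
      exact h.degenerate.sup_edge hadj.ne' h.free (hρ b) (by rwa [hop_comm]) hball'

/-! ### The stretch -/

/-- Distances in a graph that connects two families of centers well. -/
theorem isSpanner_of_centers {k : ℕ} (hk : 2 ≤ k) {ρ : Bool → ℕ} (hρ : ρ false + ρ true = k - 1)
    {H₀ H : SimpleGraph V} (h₀ : H₀ ≤ H) (hH : H ≤ G) (A : Bool → V → Prop)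
    (hG : ∀ x y, G.Adj x y → wdist H₀ w x y ≤ k * w s(x, y) ∨
      ∀ b z, z = x ∨ z = y → ∃ a, A b a ∧ wdist H₀ w z a ≤ ρ b * w s(x, y))
    (hA : ∀ b a c, A b a → A (!b) c → ∀ x y, G.Adj x y →
      wdist H w a c ≤ wdist H₀ w a x + w s(x, y) + wdist H₀ w y c) :
    IsSpanner k (k - 1) G w H := by
  -- `φ b` is the excess for centers of type `b`. Only the sum of the two excesses is controlled,
  -- not each one separately.
  have centers {x v : V} (p : G.Walk x v) : ∃ φ : Bool → ℝ≥0∞,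
      φ false + φ true = 2 * (k * walkWeight w p) ∧
      ∀ b c, A b c → wdist H w c v ≤ wdist H₀ w c x + φ b := by
    induction p with
    | nil => exact ⟨fun _ => 0, by simp [walkWeight], fun b c _ => by
        simpa using wdist_mono h₀ w _ _⟩
    | @cons x y v hadj p ih =>
      obtain ⟨φ, hφ, hc⟩ := ih
      have hwt : (walkWeight w (.cons hadj p) : ℝ≥0∞) = w s(x, y) + walkWeight w p := by
        simp [walkWeight]
      rw [hwt]
      rcases hG x y hadj with hxy | hxy
      · refine ⟨fun b => k * w s(x, y) + φ b, ?_, fun b c hb => ?_⟩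
        · calc _ = 2 * (k * w s(x, y)) + (φ false + φ true) := by ring
            _ = _ := by rw [hφ]; ring
        · refine (hc b c hb).trans ?_
          rw [← add_assoc]
          gcongr
          exact (wdist_triangle _ _ _ x _).trans (by gcongr)
      -- At a left-out edge the types are exchanged: from `c` to a center `a` of the other type near
      -- `y`, then on from `a`, whose distance to `y` is paid a second time. Over both types this
      -- adds `2 + 2 * (k - 1) = 2 * k` times the weight.
      · refine ⟨fun b => w s(x, y) + 2 * (ρ (!b) * w s(x, y)) + φ (!b), ?_, fun b c hb => ?_⟩
        · have h1 : (2 : ℝ≥0∞) + 2 * (ρ false + ρ true) = 2 * k := by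
            have : 2 + 2 * (ρ false + ρ true) = 2 * k := by omega
            exact_mod_cast this
          calc _ = (2 + 2 * (ρ false + ρ true) : ℝ≥0∞) * w s(x, y) + (φ false + φ true) := by
                simp only [Bool.not_false, Bool.not_true]
                ring
            _ = _ := by rw [h1, hφ]; ring
        · obtain ⟨a, ha, hya⟩ := hxy (!b) y (.inr rfl)
          calc wdist H w c v ≤ wdist H w c a + wdist H w a v := wdist_triangle _ _ _ _ _
            _ ≤ (wdist H₀ w c x + w s(x, y) + wdist H₀ w y a) + (wdist H₀ w a y + φ (!b)) :=
              add_le_add (hA b c a hb ha x y hadj) (hc _ _ ha)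
            _ ≤ (wdist H₀ w c x + w s(x, y) + ρ (!b) * w s(x, y)) +
                (ρ (!b) * w s(x, y) + φ (!b)) := by
              rw [wdist_comm H₀ w a y]; gcongr
            _ = _ := by ring
  have main {x v : V} (p : G.Walk x v) :
      wdist H w x v ≤ k * walkWeight w p + (k - 1 : ℕ) * maxWeight G w := by
    induction p with
    | nil => simp [wdist_self]
    | @cons x y v hadj p ih =>
      have hwt : (walkWeight w (.cons hadj p) : ℝ≥0∞) = w s(x, y) + walkWeight w p := by
        simp [walkWeight]
      rcases hG x y hadj with hxy | hxy
      · rw [hwt]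
        calc wdist H w x v ≤ wdist H w x y + wdist H w y v := wdist_triangle _ _ _ _ _
          _ ≤ k * w s(x, y) + (k * walkWeight w p + (k - 1 : ℕ) * maxWeight G w) :=
            add_le_add ((wdist_mono h₀ _ _ _).trans hxy) ih
          _ = _ := by ring
      -- This is the first left-out edge of the walk, and `x` has centers of both types nearby.
      -- Entering through type `b` costs `2 * ρ b` times the weight; averaging over the two types
      -- leaves the factor `k - 1`.
      · obtain ⟨φ, hφ, hc⟩ := centers (.cons hadj p)
        have h1 (b : Bool) : wdist H w x v ≤ 2 * (ρ b * w s(x, y)) + φ b := by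
          obtain ⟨a, ha, hxa⟩ := hxy b x (.inl rfl)
          calc wdist H w x v ≤ wdist H w x a + wdist H w a v := wdist_triangle _ _ _ _ _
            _ ≤ wdist H₀ w x a + (wdist H₀ w a x + φ b) :=
              add_le_add (wdist_mono h₀ _ _ _) (hc _ _ ha)
            _ ≤ ρ b * w s(x, y) + (ρ b * w s(x, y) + φ b) := by
              rw [wdist_comm H₀ w a x]; gcongr
            _ = _ := by ring
        have hmax : (w s(x, y) : ℝ≥0∞) ≤ maxWeight G w :=
          le_iSup₂_of_le (f := fun e (_ : e ∈ G.edgeSet) => (w e : ℝ≥0∞)) s(x, y) hadj le_rfl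
        have h3 : (ρ false + ρ true : ℝ≥0∞) = (k - 1 : ℕ) := by exact_mod_cast hρ
        have h4 : 2 * wdist H w x v ≤
            2 * (k * walkWeight w (.cons hadj p) + (k - 1 : ℕ) * w s(x, y)) := by
          calc 2 * wdist H w x v = wdist H w x v + wdist H w x v := two_mul _
            _ ≤ (2 * (ρ false * w s(x, y)) + φ false) + (2 * (ρ true * w s(x, y)) + φ true) :=
              add_le_add (h1 _) (h1 _)
            _ = 2 * ((ρ false + ρ true) * w s(x, y)) + (φ false + φ true) := by ring
            _ = _ := by rw [hφ, h3]; ring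
        have h5 := (ENNReal.mul_le_mul_iff_right (by simp) (by simp)).1 h4
        exact h5.trans (by gcongr)
  refine ⟨hH, fun u v => ?_⟩
  rw [wdist, wdist, ENNReal.mul_iInf_of_ne (by simp; omega) (by simp), ENNReal.iInf_add]
  exact le_iInf main

/-! ### Hitting sets -/

open Real in
/-- The state of the greedy choice of a hitting set `A` for the rows `S x` with `F x` after `t`
rounds; `U` is the set of the rows that are not yet hit. -/
structure Hitting {n : ℕ} (s : ℕ) (S : Fin n → Fin n → Prop) (F : Fin n → Prop) (t : ℕ)
    (A U : Finset (Fin n)) : Prop where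
  hit : ∀ x, F x → x ∈ U ∨ ∃ v ∈ A, S x v
  sub : ∀ x ∈ U, F x
  card_unhit : U.card ≤ n - t
  exp_unhit : (U.card : ℝ) ≤ n * exp (-(t * s / n))
  card_le : A.card ≤ t
  size : (A.card * s : ℝ) ≤ n * (1 + log n)

section Hitting
variable {n s t : ℕ} {S : Fin n → Fin n → Prop} {F : Fin n → Prop} {A U : Finset (Fin n)}

theorem Hitting.init (hU : ∀ x, x ∈ U ↔ F x) : Hitting s S F 0 ∅ U where
  hit := fun x hx => .inl ((hU x).2 hx)
  sub := fun x hx => (hU x).1 hx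
  card_unhit := by simpa using Finset.card_le_univ U
  exp_unhit := by simpa using Finset.card_le_univ U
  card_le := by simp
  size := by
    have := Real.log_natCast_nonneg n
    simp only [Finset.card_empty, Nat.cast_zero, zero_mul]
    positivity

open Classical in
theorem sum_card_rows (S : Fin n → Fin n → Prop) (U : Finset (Fin n)) :
    ∑ v, (U.filter fun x => S x v).card = ∑ x ∈ U, (Finset.univ.filter fun v => S x v).card :=
  (Finset.sum_card_bipartiteAbove_eq_sum_card_bipartiteBelow S).symm

open Classical in
-- An unhit row is nonempty because `s` is positive, so if no vertex lies in an unhit row, then none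
-- is left and an idle round keeps all bounds.
theorem Hitting.of_exhausted (h : Hitting s S F t A U) (hs : ∀ x, F x → s ≤ {v | S x v}.ncard)
    (hs0 : 0 < s) (hv : ∀ v, (U.filter fun x => S x v).card = 0) : Hitting s S F (t + 1) A U := by
  have hU : U = ∅ := by
    refine Finset.eq_empty_of_forall_notMem fun x hx => ?_
    obtain ⟨v, hv'⟩ := Set.nonempty_of_ncard_ne_zero (hs0.trans_le (hs x (h.sub x hx))).ne'
    have := Finset.card_eq_zero.1 (hv v)
    exact absurd (Finset.mem_filter.2 ⟨hx, hv'⟩) (by rw [this]; simp)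
  subst hU
  exact ⟨h.hit, h.sub, by simp, by simp only [Finset.card_empty, Nat.cast_zero]; positivity,
    h.card_le.trans (Nat.le_succ t), h.size⟩

open Classical in
-- By averaging, the best vertex lies in at least the fraction `s / n` of the unhit rows, so their
-- number shrinks by a factor `1 - s / n ≤ exp (-(s / n))`. A vertex is picked only while a row is
-- unhit, so `1 ≤ n * exp (-(t * s / n))`, that is `t * s ≤ n * log n`; together with `s ≤ n` this
-- bounds `(t + 1) * s`.
theorem Hitting.pick (h : Hitting s S F t A U) (hs : ∀ x, F x → s ≤ {v | S x v}.ncard)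
    {v : Fin n} (hpos : 0 < (U.filter fun x => S x v).card)
    (hmax : ∀ u, (U.filter fun x => S x u).card ≤ (U.filter fun x => S x v).card) :
    Hitting s S F (t + 1) (insert v A) (U.filter fun x => ¬ S x v) := by
  obtain ⟨x₀, hx₀⟩ := Finset.card_pos.1 hpos
  rw [Finset.mem_filter] at hx₀
  have hn : 0 < n := x₀.pos
  have hn' : (0 : ℝ) < n := by exact_mod_cast hn
  have hsn : s ≤ n := by
    refine (hs x₀ (h.sub x₀ hx₀.1)).trans ?_
    simpa using Set.ncard_le_ncard (Set.subset_univ {v | S x₀ v})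
  have hsplit := Finset.card_filter_add_card_filter_not (s := U) (fun x => S x v)
  have hcount : U.card * s ≤ n * (U.filter fun x => S x v).card := by
    calc U.card * s ≤ ∑ x ∈ U, (Finset.univ.filter fun v => S x v).card := by
          rw [← smul_eq_mul]
          refine Finset.card_nsmul_le_sum _ _ _ fun x hx => ?_
          refine (hs x (h.sub x hx)).trans (le_of_eq ?_)
          rw [← Set.ncard_coe_finset]
          simp
      _ = ∑ v, (U.filter fun x => S x v).card := (sum_card_rows S U).symm
      _ ≤ ∑ _v : Fin n, (U.filter fun x => S x v).card := Finset.sum_le_sum fun u _ => hmax u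
      _ = _ := by simp
  have hU1 : 1 ≤ U.card := Finset.card_pos.2 ⟨x₀, hx₀.1⟩
  have hcard := h.card_unhit
  refine ⟨?_, ?_, by omega, ?_, ?_, ?_⟩
  · intro x hx
    by_cases hxv : S x v
    · exact .inr ⟨v, Finset.mem_insert_self _ _, hxv⟩
    · rcases h.hit x hx with h' | ⟨u, hu, hxu⟩
      · exact .inl (Finset.mem_filter.2 ⟨h', hxv⟩)
      · exact .inr ⟨u, Finset.mem_insert_of_mem hu, hxu⟩
  · exact fun x hx => h.sub x (Finset.mem_filter.1 hx).1
  · have h1 : ((U.filter fun x => ¬ S x v).card : ℝ) ≤ U.card * (1 - s / n) := by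
      have h2 : ((U.filter fun x => S x v).card : ℝ) + (U.filter fun x => ¬ S x v).card = U.card := by
        exact_mod_cast hsplit
      have h3 : (U.card : ℝ) * s ≤ n * (U.filter fun x => S x v).card := by exact_mod_cast hcount
      have h4 : (U.card : ℝ) * (s / n) ≤ (U.filter fun x => S x v).card := by
        rw [← mul_div_assoc, div_le_iff₀ hn']; linarith
      linarith
    calc ((U.filter fun x => ¬ S x v).card : ℝ) ≤ U.card * (1 - s / n) := h1
      _ ≤ U.card * Real.exp (-(s / n)) := by
        gcongr
        exact Real.one_sub_le_exp_neg _
      _ ≤ n * Real.exp (-(t * s / n)) * Real.exp (-(s / n)) := by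
        gcongr; exact h.exp_unhit
      _ = _ := by
        rw [mul_assoc, ← Real.exp_add]
        congr 2
        push_cast
        ring
  · exact (Finset.card_insert_le _ _).trans (by have := h.card_le; omega)
  · have h1 : (1 : ℝ) ≤ n * Real.exp (-(t * s / n)) :=
      le_trans (by exact_mod_cast hU1) h.exp_unhit
    have h2 : (t * s / n : ℝ) ≤ Real.log n := by
      have := Real.log_le_log one_pos h1
      rw [Real.log_one, Real.log_mul hn'.ne' (Real.exp_pos _).ne', Real.log_exp] at this
      linarith
    rw [div_le_iff₀ hn'] at h2
    have h3 : ((insert v A).card : ℝ) ≤ t + 1 := by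
      exact_mod_cast (Finset.card_insert_le _ _).trans (by have := h.card_le; omega)
    have h4 : (s : ℝ) ≤ n := by exact_mod_cast hsn
    calc ((insert v A).card * s : ℝ) ≤ (t + 1) * s := by gcongr
      _ ≤ _ := by linarith

/-- That `n` rounds leave no unhit row comes from `card_unhit`; the exponential bound serves only
for the size of `A`. -/
theorem Hitting.exists_mem (h : Hitting s S F n A U) {x : Fin n} (hx : F x) : ∃ v ∈ A, S x v := by
  rcases h.hit x hx with h' | h'
  · have := h.card_unhit
    rw [Nat.sub_self, Nat.le_zero, Finset.card_eq_zero] at this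
    simp [this] at h'
  · exact h'

end Hitting

/-! ### The number of edges -/

/-- With `q = n ^ (1 / k)` the hypotheses on `r` give `q ≤ r ≤ 2 * q`. Multiplying the bounds for
`a` and `b` gives `a * b ≤ (n * L) ^ 2 / q ^ (k - 1) = n * q * L ^ 2`, since `q ^ k = n`. -/
theorem edge_count {n k r i j a b E : ℕ} (hk : 1 ≤ k) (hn : 1 ≤ n) (hr : n ≤ r ^ k)
    (hr' : r = 1 ∨ (r - 1) ^ k < n) (hij : i + j = k - 1)
    (ha : (a * (r ^ i : ℕ) : ℝ) ≤ n * (1 + Real.log n))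
    (hb : (b * (r ^ j : ℕ) : ℝ) ≤ n * (1 + Real.log n)) (hE : E ≤ r * n + a * b) :
    (E : ℝ) ≤ 3 * (n : ℝ) ^ (1 + 1 / (k : ℝ)) * (1 + Real.log n) ^ 2 := by
  have hn' : (1 : ℝ) ≤ n := by exact_mod_cast hn
  have hn0 : (0 : ℝ) < n := by linarith
  have hk0 : (0 : ℝ) < k := by exact_mod_cast hk
  have hlog := Real.log_natCast_nonneg n
  set L := 1 + Real.log n
  have hL : 1 ≤ L := by linarith
  set q : ℝ := (n : ℝ) ^ (1 / (k : ℝ)) with hq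
  have hq1 : 1 ≤ q := Real.one_le_rpow hn' (by positivity)
  have hqk : q ^ k = n := by
    rw [hq, one_div, Real.rpow_inv_natCast_pow hn0.le (by omega)]
  have hnq : (n : ℝ) ^ (1 + 1 / (k : ℝ)) = n * q := by rw [Real.rpow_add hn0, Real.rpow_one]
  have hrq : q ≤ r := by
    refine le_of_pow_le_pow_left₀ (n := k) (by omega) (by positivity) ?_
    rw [hqk]; exact_mod_cast hr
  have hr2 : (r : ℝ) ≤ 2 * q := by
    rcases hr' with rfl | hr'
    · push_cast; linarith
    · have h1 : ((r - 1 : ℕ) : ℝ) ≤ q := by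
        refine le_of_pow_le_pow_left₀ (n := k) (by omega) (by positivity) ?_
        rw [hqk]; exact_mod_cast hr'.le
      have h2 : (r : ℝ) ≤ (r - 1 : ℕ) + 1 := by exact_mod_cast (by omega)
      linarith
  have hab : (a * b : ℝ) ≤ n * q * L ^ 2 := by
    have h1 : (a * b : ℝ) * q ^ (k - 1) ≤ (n * L) * (n * L) := by
      calc (a * b : ℝ) * q ^ (k - 1) ≤ (a * b : ℝ) * r ^ (k - 1) := by gcongr
        _ = (a * (r ^ i : ℕ)) * (b * (r ^ j : ℕ)) := by rw [← hij, pow_add]; push_cast; ring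
        _ ≤ _ := by gcongr
    have h2 : q ^ (k - 1) * q = n := by rw [← pow_succ, Nat.sub_add_cancel hk, hqk]
    have h3 : 0 < q ^ (k - 1) := by positivity
    refine le_of_mul_le_mul_right ?_ h3
    calc (a * b : ℝ) * q ^ (k - 1) ≤ (n * L) * (n * L) := h1
      _ = n * q * L ^ 2 * q ^ (k - 1) := by rw [← h2]; ring
  rw [hnq]
  calc (E : ℝ) ≤ r * n + a * b := by exact_mod_cast hE
    _ ≤ 2 * q * n + n * q * L ^ 2 := by gcongr
    _ ≤ 2 * q * n * L ^ 2 + n * q * L ^ 2 := by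
      refine add_le_add_left ?_ _
      exact le_mul_of_one_le_right (by positivity : 0 ≤ 2 * q * (n : ℝ)) (one_le_pow₀ hL)
    _ = _ := by ring

/-- Capping the exponent at `n + 2` costs a factor `n ^ (1 / (n + 2)) ≤ 2`, because `n ≤ 2 ^ n`;
this turns 3 into 6. -/
theorem sizeBound_of_min {n k : ℕ} (hn : 1 ≤ n) {x : ℝ}
    (hx : x ≤ 3 * (n : ℝ) ^ (1 + 1 / ((min k (n + 2) : ℕ) : ℝ)) * (1 + Real.log n) ^ 2) :
    x ≤ sizeBound 6 2 k n := by
  have hn' : (1 : ℝ) ≤ n := by exact_mod_cast hn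
  have hlog := Real.log_natCast_nonneg n
  refine hx.trans ?_
  rw [sizeBound]
  gcongr ?_ * _
  rcases le_total k (n + 2) with h | h
  · rw [min_eq_left h]
    push_cast
    gcongr
    norm_num
  · rw [min_eq_right h, Real.rpow_add (by positivity), Real.rpow_one, Real.rpow_add (by positivity),
      Real.rpow_one]
    have h1 : (n : ℝ) ^ (1 / ((n + 2 : ℕ) : ℝ)) ≤ 2 := by
      rw [one_div]
      rw [Real.rpow_inv_le_iff_of_pos (by positivity) (by positivity) (by positivity),
        Real.rpow_natCast]
      exact_mod_cast (Nat.lt_two_pow_self.le.trans (Nat.pow_le_pow_right two_pos (by omega)))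
    have h2 : 1 ≤ (n : ℝ) ^ (1 / (k : ℝ)) := Real.one_le_rpow hn' (by positivity)
    push_cast at h1 ⊢
    nlinarith

/-! ### Isomorphic graphs -/

theorem wdist_map_le {V' : Type*} {G' : SimpleGraph V'} (f : G →g G') (w : Sym2 V' → ℝ≥0)
    (u v : V) : wdist G' w (f u) (f v) ≤ wdist G (w ∘ Sym2.map f) u v := by
  refine le_iInf fun p => (wdist_le w (p.map f)).trans ?_
  simp [walkWeight]

theorem wdist_iso {V' : Type*} {G' : SimpleGraph V'} (f : G ≃g G') (w : Sym2 V' → ℝ≥0)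
    (u v : V) : wdist G' w (f u) (f v) = wdist G (w ∘ Sym2.map f) u v := by
  refine le_antisymm (wdist_map_le f.toHom w u v) ?_
  have := wdist_map_le f.symm.toHom (w ∘ Sym2.map f) (f u) (f v)
  have e : (w ∘ Sym2.map f) ∘ Sym2.map f.symm = w := by
    ext e
    induction e with | _ a b => simp
  simpa [e] using this

end WSpanner

namespace WSpanner

/-! ### Evaluation rules -/

attribute [simp] NExp.eval RExp.eval Test.Holds State.setN_nat State.setR_real

/-- The test whether a number is `1`. -/
def Test.isOne (e : NExp) : Test := .and (.natLe e (.const 1)) (.natLe (.const 1) e)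

@[simp] theorem Test.isOne_holds (e : NExp) (s : State) : (isOne e).Holds s ↔ e.eval s = 1 := by
  simp only [isOne, Holds, NExp.eval]; omega

namespace Cmd

/-- Assignment to a scalar variable. -/
abbrev setVar (a : ℕ) (e : NExp) : Cmd := .setNat a (.const 0) (.const 0) e

/-- Assignment to a real scalar variable. -/
abbrev setRVar (a : ℕ) (e : RExp) : Cmd := .setReal a (.const 0) (.const 0) e

@[simp] theorem run_skip (s : State) : skip.run s = s := rfl

@[simp] theorem run_setNat (a : ℕ) (i j e : NExp) (s : State) :
    (setNat a i j e).run s = s.setN a (i.eval s) (j.eval s) (e.eval s) := rfl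

@[simp] theorem run_setReal (a : ℕ) (i j : NExp) (e : RExp) (s : State) :
    (setReal a i j e).run s = s.setR a (i.eval s) (j.eval s) (e.eval s) := rfl

@[simp] theorem run_seq (p q : Cmd) (s : State) : (seq p q).run s = q.run (p.run s) := rfl

open Classical in
theorem run_branch (b : Test) (p q : Cmd) (s : State) :
    (branch b p q).run s = if b.Holds s then p.run s else q.run s := rfl

theorem run_branch_pos {b : Test} {p q : Cmd} {s : State} (h : b.Holds s) :
    (branch b p q).run s = p.run s := if_pos h

theorem run_branch_neg {b : Test} {p q : Cmd} {s : State} (h : ¬ b.Holds s) :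
    (branch b p q).run s = q.run s := if_neg h

/-! ### Powers -/

/-- Compute the power of two variables by repeated addition. -/
def power (a e o : ℕ) : Cmd :=
  .seq (.setVar o (.const 1)) (.loop 20 2 (.branch (.natLe (.add (.var 20) (.const 1)) (.var e))
    (.seq (.setVar 35 (.const 0)) (.seq
      (.loop 21 2 (.branch (.natLe (.add (.var 21) (.const 1)) (.var a))
        (.setVar 35 (.add (.var 35) (.var o))) .skip))
      (.setVar o (.var 35)))) .skip))

/-- Both loops always make `n + 2` passes and idle after enough of them. Hence the bounds on base
and exponent, and the minima in the invariants. -/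
theorem run_power {a e o n : ℕ} (ha : a ∉ [20, 21, 35, o]) (he : e ∉ [20, 21, 35, o])
    (ho : o ∉ [0, 20, 21, 35]) {s : State} (hs : s.nat 0 0 0 = n) (hA : s.nat a 0 0 ≤ n + 2)
    (hE : s.nat e 0 0 ≤ n + 2) :
    ((power a e o).run s).nat o 0 0 = s.nat a 0 0 ^ s.nat e 0 0 := by
  simp only [List.mem_cons, List.not_mem_nil, or_false, not_or] at ha he ho
  obtain ⟨ha1, ha2, ha3, ha4⟩ := ha
  obtain ⟨he1, he2, he3, he4⟩ := he
  obtain ⟨ho0, ho1, ho2, ho3⟩ := ho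
  generalize hx : s.nat a 0 0 = x at *
  generalize hy : s.nat e 0 0 = y at *
  rw [power, run_seq]
  have main := run_loop_nat (a := 20) (c := 2) (s := (setVar o (.const 1)).run s)
    (p := .branch (.natLe (.add (.var 20) (.const 1)) (.var e))
    (.seq (.setVar 35 (.const 0)) (.seq
      (.loop 21 2 (.branch (.natLe (.add (.var 21) (.const 1)) (.var a))
        (.setVar 35 (.add (.var 35) (.var o))) .skip))
      (.setVar o (.var 35)))) .skip)
    (fun m s => s.nat 0 0 0 = n ∧ s.nat a 0 0 = x ∧ s.nat e 0 0 = y ∧ s.nat o 0 0 = x ^ min m y)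
    (by
      rintro m s z ⟨h1, h2, h3, h4⟩
      simp [*])
    (by simp [*, Ne.symm ho0]) (by
      rintro m - s hm ⟨h1, h2, h3, h4⟩
      by_cases hmy : m + 1 ≤ y
      · rw [run_branch_pos (by simpa [hm, h3] using hmy)]
        have inner := run_loop_nat (a := 21) (c := 2) (s := (setVar 35 (.const 0)).run s)
          (p := .branch (.natLe (.add (.var 21) (.const 1)) (.var a))
            (.setVar 35 (.add (.var 35) (.var o))) .skip)
          (fun t s => s.nat 0 0 0 = n ∧ s.nat a 0 0 = x ∧ s.nat e 0 0 = y ∧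
            s.nat o 0 0 = x ^ m ∧ s.nat 35 0 0 = min t x * x ^ m)
          (by
            rintro t s z ⟨h1, h2, h3, h4, h5⟩
            simp [*])
          (by simp [*, min_eq_left (show m ≤ y by omega)]) (by
            rintro t - s ht ⟨h1, h2, h3, h4, h5⟩
            by_cases htx : t + 1 ≤ x
            · rw [run_branch_pos (by simpa [ht, h2] using htx)]
              simp [*, min_eq_left (show t ≤ x by omega)]
              ring
            · rw [run_branch_neg (by simpa [ht, h2] using htx)]
              refine ⟨h1, h2, h3, h4, ?_⟩
              rw [run_skip, h5, min_eq_right (show x ≤ t by omega), min_eq_right (show x ≤ t + 1 by omega)])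
        have e0 : ((setVar 35 (.const 0)).run s).nat 0 0 0 = n := by simp [h1]
        rw [e0, min_eq_right hA] at inner
        obtain ⟨i1, i2, i3, i4, i5⟩ := inner
        rw [run_seq, run_seq, run_setNat]
        simp only [State.setN_nat, NExp.eval]
        simp only [Ne.symm ho0, ha4, he4, false_and, if_false, i1, i2, i3, i5]
        simp [min_eq_left hmy, pow_succ, mul_comm]
      · rw [run_branch_neg (by simpa [hm, h3] using hmy)]
        refine ⟨h1, h2, h3, ?_⟩
        rw [run_skip, h4, min_eq_right (show y ≤ m by omega), min_eq_right (show y ≤ m + 1 by omega)])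
  have e0 : ((setVar o (.const 1)).run s).nat 0 0 0 = n := by simp [hs, Ne.symm ho0]
  rw [e0, min_eq_right hE] at main
  exact main.2.2.2

/-! ### The parameters -/

/-- Compute the parameters `k' = min k (n + 2)`, `r`, `(k' - 1) / 2` and `k' / 2`, and the powers
of `r` with these exponents. -/
def params : Cmd :=
  .seq (.branch (.natLe (.load 0 (.const 0) (.const 1)) (.add (.var 0) (.const 2)))
    (.setVar 28 (.load 0 (.const 0) (.const 1))) (.setVar 28 (.add (.var 0) (.const 2)))) <|
  .seq (.loop 20 2 (.branch (.natLe (.add (.var 20) (.const 2)) (.var 28))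
    (.seq (.setVar 35 (.var 30)) (.seq (.setVar 30 (.var 31))
      (.setVar 31 (.add (.var 35) (.const 1))))) .skip)) <|
  .seq (.setVar 29 (.const 1)) <|
  .seq (.loop 22 0 (.seq (power 22 28 36)
    (.branch (.natLe (.add (.var 36) (.const 1)) (.var 0)) (.setVar 29 (.add (.var 22) (.const 1)))
      .skip))) <|
  .seq (power 29 30 32) (power 29 31 33)

end Cmd

/-- The variable with the radius of the balls of type `b`. -/
def radiusVar (b : Bool) : ℕ := bif b then 31 else 30

/-- The variable with the least size of a large ball of type `b`. -/
def sizeVar (b : Bool) : ℕ := bif b then 33 else 32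

/-- The variables that are set by `params` have the intended values. -/
structure HasParams (n k r : ℕ) (ρ : Bool → ℕ) (s : State) : Prop where
  hn : s.nat 0 0 0 = n
  hk : s.nat 28 0 0 = k
  radius : ∀ b, s.nat (radiusVar b) 0 0 = ρ b
  size : ∀ b, s.nat (sizeVar b) 0 0 = r ^ ρ b

namespace Cmd

theorem run_params {n k : ℕ} (hk : 2 ≤ k) {s : State} (hs : s.nat 0 0 0 = n) (hs' : s.nat 0 0 1 = k)
    (h0 : s.nat 30 0 0 = 0) (h1 : s.nat 31 0 0 = 0) :
    ∃ r, 1 ≤ r ∧ n ≤ r ^ min k (n + 2) ∧ (r = 1 ∨ (r - 1) ^ min k (n + 2) < n) ∧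
      HasParams n (min k (n + 2)) r
        (fun b => bif b then min k (n + 2) / 2 else (min k (n + 2) - 1) / 2) (params.run s) := by
  set kk := min k (n + 2) with hkk
  have hkk2 : 2 ≤ kk := by omega
  rw [params]
  simp only [run_seq]
  set s₁ := (branch (.natLe (.load 0 (.const 0) (.const 1)) (.add (.var 0) (.const 2)))
    (.setVar 28 (.load 0 (.const 0) (.const 1))) (.setVar 28 (.add (.var 0) (.const 2)))).run s
    with hs₁
  have a1 : s₁.nat 0 0 0 = n ∧ s₁.nat 28 0 0 = kk ∧ s₁.nat 30 0 0 = 0 ∧ s₁.nat 31 0 0 = 0 := by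
    rw [hs₁, run_branch]
    split_ifs with h
    · simp only [Test.Holds, NExp.eval, hs, hs'] at h
      simp [*]
    · simp only [Test.Holds, NExp.eval, hs, hs'] at h
      simp [hs, h0, h1]
      omega
  clear_value s₁
  clear hs₁
  obtain ⟨a0, a28, a30, a31⟩ := a1
  -- Halving without division: an active pass replaces `(p, q)` by `(q, p + 1)`, so `m` of them turn
  -- `(0, 0)` into `(m / 2, (m + 1) / 2)`. The test stops this after `kk - 1` passes.
  have b := run_loop_nat (a := 20) (c := 2) (s := s₁)
    (p := .branch (.natLe (.add (.var 20) (.const 2)) (.var 28))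
      (.seq (.setVar 35 (.var 30)) (.seq (.setVar 30 (.var 31))
      (.setVar 31 (.add (.var 35) (.const 1))))) .skip)
    (fun m s => s.nat 0 0 0 = n ∧ s.nat 28 0 0 = kk ∧ s.nat 30 0 0 = min m (kk - 1) / 2 ∧
      s.nat 31 0 0 = (min m (kk - 1) + 1) / 2)
    (by rintro m s z ⟨h1, h2, h3, h4⟩; simp [*]) (by simp [*]) (by
      rintro m - s hm ⟨h1, h2, h3, h4⟩
      by_cases h : m + 2 ≤ kk
      · rw [run_branch_pos (by simpa [hm, h2] using h)]
        simp [*]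
        omega
      · rw [run_branch_neg (by simpa [hm, h2] using h)]
        refine ⟨h1, h2, ?_, ?_⟩ <;> simp only [run_skip, h3, h4] <;> omega)
  rw [a0] at b
  generalize run _ s₁ = s₂ at b ⊢
  obtain ⟨b0, b28, b30, b31⟩ := b
  have c0 : ((setVar 29 (.const 1)).run s₂).nat 0 0 0 = n := by simp [b0]
  -- The final value `r` is one more than the last `x < n` with `x ^ kk < n`, and the initial 1 if
  -- there is none.
  have c := run_loop_nat (a := 22) (c := 0) (s := (setVar 29 (.const 1)).run s₂)
    (p := .seq (power 22 28 36)
    (.branch (.natLe (.add (.var 36) (.const 1)) (.var 0)) (.setVar 29 (.add (.var 22) (.const 1)))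
      .skip))
    (fun m s => s.nat 0 0 0 = n ∧ s.nat 28 0 0 = kk ∧ s.nat 30 0 0 = (kk - 1) / 2 ∧
      s.nat 31 0 0 = kk / 2 ∧ 1 ≤ s.nat 29 0 0 ∧ s.nat 29 0 0 ≤ n + 2 ∧
      (s.nat 29 0 0 = 1 ∨ (s.nat 29 0 0 - 1) ^ kk < n) ∧
      ∀ x < m, x ^ kk < n → x + 1 ≤ s.nat 29 0 0)
    (by rintro m s z h; simpa using h)
    (by simp [b0, b28, b30, b31]; omega) (by
      rintro m hm s hm' ⟨h1, h2, h3, h4, h5, h6, h7, h8⟩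
      rw [c0, add_zero] at hm
      have hp := run_power (a := 22) (e := 28) (o := 36) (n := n) (s := s) (by decide) (by decide)
        (by decide) h1 (by omega) (by omega)
      have frame (a : ℕ) (ha : (power 22 28 36).writesNat a = false) :=
        run_nat (power 22 28 36) a ha s
      rw [hm', h2] at hp
      rw [run_seq]
      generalize (power 22 28 36).run s = s' at *
      rw [← frame 0 (by decide)] at h1
      rw [← frame 28 (by decide)] at h2
      rw [← frame 30 (by decide)] at h3
      rw [← frame 31 (by decide)] at h4
      rw [← frame 29 (by decide)] at h5 h6 h7 h8
      rw [← frame 22 (by decide)] at hm'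
      by_cases h : m ^ kk < n
      · rw [run_branch_pos (by simpa [hp, h1] using h)]
        refine ⟨by simp [h1], by simp [h2], by simp [h3], by simp [h4], by simp, ?_, ?_, ?_⟩
        · simp [hm']; omega
        · simp [hm', h]
        · intro x hx _
          simp [hm']; omega
      · rw [run_branch_neg (by simpa [hp, h1] using h)]
        refine ⟨h1, h2, h3, h4, h5, h6, h7, fun x hx hxn => ?_⟩
        rcases Nat.lt_succ_iff_lt_or_eq.1 hx with hx | rfl
        · exact h8 x hx hxn
        · exact absurd hxn h)
  rw [c0] at c
  generalize run _ (run _ s₂) = s₃ at c ⊢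
  obtain ⟨h1, h2, h3, h4, h5, h6, h7, h8⟩ := c
  refine ⟨s₃.nat 29 0 0, h5, ?_, h7, ?_⟩
  · by_contra! hlt
    -- If `r ^ kk < n`, then `r < n` was itself a candidate, which would force `r + 1 ≤ r`.
    have hle : s₃.nat 29 0 0 ≤ s₃.nat 29 0 0 ^ kk := Nat.le_self_pow (by omega) _
    have := h8 _ (by omega) hlt
    omega
  · have p1 := run_power (a := 29) (e := 30) (o := 32) (n := n) (s := s₃) (by decide) (by decide)
      (by decide) h1 h6 (by omega)
    have frame (a : ℕ) (ha : (power 29 30 32).writesNat a = false) :=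
      run_nat (power 29 30 32) a ha s₃
    generalize (power 29 30 32).run s₃ = s₄ at *
    have p2 := run_power (a := 29) (e := 31) (o := 33) (n := n) (s := s₄) (by decide) (by decide)
      (by decide) (by rw [frame 0 (by decide), h1]) (by rw [frame 29 (by decide)]; exact h6)
      (by rw [frame 31 (by decide)]; omega)
    have frame' (a : ℕ) (ha : (power 29 31 33).writesNat a = false) :=
      run_nat (power 29 31 33) a ha s₄
    generalize (power 29 31 33).run s₄ = s₅ at *
    refine ⟨?_, ?_, ?_, ?_⟩
    · rw [frame' 0 (by decide), frame 0 (by decide), h1]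
    · rw [frame' 28 (by decide), frame 28 (by decide), h2]
    · rintro (_ | _)
      · simp only [radiusVar, cond_false]
        rw [frame' 30 (by decide), frame 30 (by decide), h3]
      · simp only [radiusVar, cond_true]
        rw [frame' 31 (by decide), frame 31 (by decide), h4]
    · rintro (_ | _)
      · simp only [sizeVar, cond_false]
        rw [frame' 32 (by decide), p1, h3]
      · simp only [sizeVar, cond_true]
        rw [p2, frame 29 (by decide), frame 31 (by decide), h4]

/-! ### Minimization over pairs of vertices -/

/-- Find a pair of vertices (with the loop variables `20`, `21`) that satisfies a test and minimizes
a real expression. -/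
def findMin (test : Test) (val : RExp) : Cmd :=
  .seq (.setVar 24 (.const 0)) (.loop 20 0 (.loop 21 0
    (.branch (.and test (.not (.and (.isOne (.var 24)) (.realLe (.var 2) val))))
      (.seq (.setRVar 2 val) (.seq (.setVar 24 (.const 1)) (.seq (.setVar 25 (.var 20))
        (.setVar 26 (.var 21))))) .skip)))

/-- Equality of memories up to the variables used by `findMin`. -/
structure Agree (s s' : State) : Prop where
  nat : ∀ a, a ∉ [20, 21, 24, 25, 26] → s'.nat a = s.nat a
  real : ∀ a, a ≠ 2 → s'.real a = s.real a

/-- The search writes its own scratch variables, so the test and the value have to be read correctly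
in every memory that agrees with `s` outside them. -/
theorem run_findMin {n : ℕ} {test : Test} {val : RExp} {s : State} (hs : s.nat 0 0 0 = n)
    (p : Fin n → Fin n → Prop) (f : Fin n → Fin n → ℝ)
    (hp : ∀ s' (x y : Fin n), Agree s s' → s'.nat 20 0 0 = (x : ℕ) → s'.nat 21 0 0 = (y : ℕ) →
      (test.Holds s' ↔ p x y))
    (hf : ∀ s' (x y : Fin n), Agree s s' → s'.nat 20 0 0 = (x : ℕ) → s'.nat 21 0 0 = (y : ℕ) →
      p x y → val.eval s' = f x y) :
    let s' := (findMin test val).run s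
    (s'.nat 24 0 0 = 0 ∧ ∀ x y, ¬ p x y) ∨
    (s'.nat 24 0 0 = 1 ∧ ∃ x y : Fin n, s'.nat 25 0 0 = x ∧ s'.nat 26 0 0 = y ∧ p x y ∧
      ∀ x' y', p x' y' → f x y ≤ f x' y') := by
  intro s'
  have main := run_loop_loop (a := 20) (b := 21) (n := n) (s := (setVar 24 (.const 0)).run s)
    (p := .branch (.and test (.not (.and (.isOne (.var 24)) (.realLe (.var 2) val))))
      (.seq (.setRVar 2 val) (.seq (.setVar 24 (.const 1)) (.seq (.setVar 25 (.var 20))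
        (.setVar 26 (.var 21))))) .skip)
    (by simp [hs])
    (fun P s' => Agree s s' ∧ ((s'.nat 24 0 0 = 0 ∧ ∀ x y, (x, y) ∈ P → ¬ p x y) ∨
      (s'.nat 24 0 0 = 1 ∧ ∃ x y : Fin n, s'.nat 25 0 0 = x ∧ s'.nat 26 0 0 = y ∧ p x y ∧
        s'.real 2 0 0 = f x y ∧ ∀ x' y', (x', y') ∈ P → p x' y' → f x y ≤ f x' y')))
    (by decide) (by decide) (by decide) rfl rfl
    (by
      rintro P s' x ⟨h1, h2⟩
      refine ⟨⟨fun a ha => ?_, h1.real⟩, by simpa using h2⟩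
      rw [State.setN_nat_ne _ _ _ _ _ _ (by rintro rfl; simp at ha), h1.nat a ha])
    (by
      rintro P s' x ⟨h1, h2⟩
      refine ⟨⟨fun a ha => ?_, h1.real⟩, by simpa using h2⟩
      rw [State.setN_nat_ne _ _ _ _ _ _ (by rintro rfl; simp at ha), h1.nat a ha])
    (by
      refine ⟨⟨fun a ha => ?_, fun _ _ => rfl⟩, by simp⟩
      rw [run_setNat, State.setN_nat_ne _ _ _ _ _ _ (by rintro rfl; simp at ha)])
    (by
      rintro P x y - s' hx hy ⟨h1, h2⟩
      have hp' := hp s' x y h1 hx hy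
      have hf' := hf s' x y h1 hx hy
      rw [run_branch]
      split_ifs with h
      · simp only [Test.Holds, Test.isOne_holds, NExp.eval, RExp.eval] at h
        have hpxy := hp'.1 h.1
        refine ⟨⟨fun a ha => ?_, fun a ha => ?_⟩, .inr ⟨by simp, x, y, ?_, ?_, hpxy, ?_, ?_⟩⟩
        · simp only [List.mem_cons, List.not_mem_nil, or_false, not_or] at ha
          simp only [run_seq, run_setNat]
          rw [State.setN_nat_ne _ _ _ _ _ _ ha.2.2.2.2, State.setN_nat_ne _ _ _ _ _ _ ha.2.2.2.1,
            State.setN_nat_ne _ _ _ _ _ _ ha.2.2.1]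
          exact h1.nat a (by simp [ha])
        · simp only [run_seq, run_setNat, run_setReal, State.setN_real]
          rw [State.setR_real_ne _ _ _ _ _ _ ha, h1.real a ha]
        · simp [hx]
        · simp [hy]
        · simp [hf' hpxy]
        · intro x' y' hmem hp''
          rcases Finset.mem_insert.1 hmem with h' | h'
          · obtain ⟨rfl, rfl⟩ := Prod.mk.inj h'; exact le_rfl
          · rcases h2 with ⟨-, h2⟩ | ⟨h24, u, v, -, -, -, hbest, h2⟩
            · exact absurd hp'' (h2 _ _ h')
            · have := h.2
              rw [hbest, hf' hpxy] at this
              exact (not_le.1 (fun hle => this ⟨h24, hle⟩)).le.trans (h2 _ _ h' hp'')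
      · simp only [Test.Holds, Test.isOne_holds, NExp.eval, RExp.eval] at h
        refine ⟨h1, ?_⟩
        rcases h2 with ⟨h24, h2⟩ | ⟨h24, u, v, hu, hv, huv, hbest, h2⟩
        · refine .inl ⟨h24, fun x' y' hmem hp'' => ?_⟩
          rcases Finset.mem_insert.1 hmem with h' | h'
          · obtain ⟨rfl, rfl⟩ := Prod.mk.inj h'
            exact h ⟨hp'.2 hp'', fun h' => by simp [h24] at h'⟩
          · exact h2 _ _ h' hp''
        · refine .inr ⟨h24, u, v, hu, hv, huv, hbest, fun x' y' hmem hp'' => ?_⟩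
          rcases Finset.mem_insert.1 hmem with h' | h'
          · obtain ⟨rfl, rfl⟩ := Prod.mk.inj h'
            by_contra! hlt
            refine h ⟨hp'.2 hp'', fun h' => ?_⟩
            rw [hbest, hf' hp''] at h'
            exact absurd h'.2 (not_le.2 hlt)
          · exact h2 _ _ h' hp'')
  rcases main.2 with ⟨h, h'⟩ | ⟨h, x, y, hx, hy, hxy, -, h'⟩
  · exact .inl ⟨h, fun x y => h' x y (Finset.mem_univ _)⟩
  · exact .inr ⟨h, x, y, hx, hy, hxy, fun x' y' => h' x' y' (Finset.mem_univ _)⟩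

end Cmd

end WSpanner

namespace WSpanner

variable {n : ℕ} {G H : SimpleGraph (Fin n)} {w : Sym2 (Fin n) → ℝ≥0}

/-! ### The distance matrix -/

open Classical in
/-- The distance that is stored in the memory. -/
noncomputable def State.dist (s : State) (a b : ℕ) : ℝ≥0∞ :=
  if s.nat 3 a b = 1 then ENNReal.ofReal (s.real 1 a b) else ⊤

theorem State.dist_le_iff {s : State} {a b : ℕ} {c : ℝ} (hc : 0 ≤ c) :
    s.dist a b ≤ ENNReal.ofReal c ↔ s.nat 3 a b = 1 ∧ s.real 1 a b ≤ c := by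
  rw [dist]
  split_ifs with h
  · simp [h, ENNReal.ofReal_le_ofReal_iff hc]
  · simp [h]

/-- The memory holds the distance matrix of the graph `H`. -/
structure HasDist (H : SimpleGraph (Fin n)) (w : Sym2 (Fin n) → ℝ≥0) (s : State) : Prop where
  nonneg : ∀ a b : Fin n, 0 ≤ s.real 1 a b
  eq : ∀ a b : Fin n, s.dist a b = wdist H w a b

theorem HasDist.congr {s s' : State} (h : HasDist H w s) (h3 : s'.nat 3 = s.nat 3)
    (h1 : s'.real 1 = s.real 1) : HasDist H w s' := by
  refine ⟨by rw [h1]; exact h.nonneg, fun a b => ?_⟩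
  rw [State.dist, h3, h1]
  exact h.eq a b

theorem natCast_mul_coe (l : ℕ) (W : ℝ≥0) :
    (l : ℝ≥0∞) * W = ENNReal.ofReal (l * (W : ℝ)) := by
  rw [ENNReal.ofReal_mul (by positivity), ENNReal.ofReal_natCast, ENNReal.ofReal_coe_nnreal]

theorem HasDist.le_iff {s : State} (h : HasDist H w s) (a b : Fin n) (l : ℕ) (W : ℝ≥0) :
    wdist H w a b ≤ l * W ↔ s.nat 3 a b = 1 ∧ s.real 1 a b ≤ l * (W : ℝ) := by
  rw [← h.eq, natCast_mul_coe, State.dist_le_iff (by positivity)]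

namespace Cmd

/-- Improve the distance of the vertices `20` and `21` by a path through the edge from `p` to
`q`. -/
def relax (p q : ℕ) : Cmd :=
  .branch (.and (.and (.isOne (.load 3 (.var 20) (.var p))) (.isOne (.load 3 (.var q) (.var 21))))
      (.not (.and (.isOne (.load 3 (.var 20) (.var 21)))
        (.realLe (.load 1 (.var 20) (.var 21))
          (.add (.add (.load 1 (.var 20) (.var p)) (.load 0 (.var 25) (.var 26)))
            (.load 1 (.var q) (.var 21)))))))
    (.seq (.setReal 1 (.var 20) (.var 21)
      (.add (.add (.load 1 (.var 20) (.var p)) (.load 0 (.var 25) (.var 26)))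
        (.load 1 (.var q) (.var 21))))
      (.setNat 3 (.var 20) (.var 21) (.const 1))) .skip

/-- The guard demands that both legs be finite; otherwise the candidate is infinite and the old
entry is the minimum. Nonnegativity of the stored numbers lets sums of reals be compared as extended
distances. -/
theorem run_relax {p q : ℕ} {s : State} {a b x y : Fin n} (h20 : s.nat 20 0 0 = a)
    (h21 : s.nat 21 0 0 = b) (hx : s.nat p 0 0 = x) (hy : s.nat q 0 0 = y) {W : ℝ≥0}
    (hW : s.real 0 (s.nat 25 0 0) (s.nat 26 0 0) = W) (hpos : ∀ a b : Fin n, 0 ≤ s.real 1 a b) :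
    let s' := (relax p q).run s
    (∀ a b : Fin n, 0 ≤ s'.real 1 a b) ∧
    s'.dist a b = min (s.dist a b) (s.dist a x + W + s.dist y b) ∧
    ∀ c d : Fin n, (c, d) ≠ (a, b) → s'.dist c d = s.dist c d := by
  intro s'
  have hs' : s' = (relax p q).run s := rfl
  have hsum : s.nat 3 a x = 1 → s.nat 3 y b = 1 → s.dist a x + W + s.dist y b =
      ENNReal.ofReal (s.real 1 a x + W + s.real 1 y b) := by
    intro h1 h2
    have := hpos a x
    have := hpos y b
    rw [State.dist, State.dist, if_pos h1, if_pos h2, ENNReal.ofReal_add (by positivity) this,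
      ENNReal.ofReal_add (by positivity) (by positivity), ENNReal.ofReal_coe_nnreal]
  have hc0 : 0 ≤ s.real 1 a x + W + s.real 1 y b := by
    have := hpos a x
    have := hpos y b
    positivity
  rw [relax, run_branch] at hs'
  split_ifs at hs' with h
  · simp only [Test.Holds, Test.isOne_holds, NExp.eval, RExp.eval, h20, h21, hx, hy, hW] at h
    have hr (c d : Fin n) : s'.real 1 c d =
        if c = a ∧ d = b then s.real 1 a x + W + s.real 1 y b else s.real 1 c d := by
      simp [hs', h20, h21, hx, hy, hW, Fin.ext_iff]
    have hn (c d : Fin n) : s'.nat 3 c d = if c = a ∧ d = b then 1 else s.nat 3 c d := by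
      simp [hs', h20, h21, Fin.ext_iff]
    refine ⟨fun c d => ?_, ?_, fun c d hcd => ?_⟩
    · rw [hr]; split_ifs
      · exact hc0
      · exact hpos c d
    · rw [hsum h.1.1 h.1.2, State.dist, hn, hr]
      simp only [and_self, if_true]
      rw [min_eq_right]
      by_contra! hlt
      exact h.2 ((State.dist_le_iff hc0).1 hlt.le)
    · have : ¬ (c = a ∧ d = b) := by rintro ⟨rfl, rfl⟩; exact hcd rfl
      rw [State.dist, State.dist, hn, hr, if_neg this, if_neg this]
  · simp only [Test.Holds, Test.isOne_holds, NExp.eval, RExp.eval, h20, h21, hx, hy, hW] at h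
    rw [run_skip] at hs'
    rw [hs']
    refine ⟨hpos, ?_, fun _ _ _ => rfl⟩
    rw [eq_comm, min_eq_left_iff]
    by_cases h1 : s.nat 3 a x = 1
    · by_cases h2 : s.nat 3 y b = 1
      · rw [hsum h1 h2, State.dist_le_iff hc0]
        by_contra h3
        exact h ⟨⟨h1, h2⟩, h3⟩
      · simp [State.dist, h2]
    · simp [State.dist, h1]

/-- Update the distance matrix after the insertion of the edge between the vertices `25` and
`26`. -/
def updateDist : Cmd := .loop 20 0 (.loop 21 0 (.seq (relax 25 26) (relax 26 25)))

/-- The matrix is overwritten while it is still being read. This is harmless because every entry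
stays between the new and the old distance: candidates formed from such entries are never below the
new distance, and they are at most those formed from old distances, whose minimum is the new
distance by `wdist_sup_edge`. -/
theorem run_updateDist {s : State} (hs : s.nat 0 0 0 = n) {x y : Fin n} (hx : s.nat 25 0 0 = x)
    (hy : s.nat 26 0 0 = y) (hxy : x ≠ y) (hW : s.real 0 x y = w s(x, y)) (hd : HasDist H w s) :
    HasDist (H ⊔ SimpleGraph.edge x y) w (updateDist.run s) := by
  have hle : H ≤ H ⊔ SimpleGraph.edge x y := le_sup_left
  have main := run_loop_loop (a := 20) (b := 21) (p := .seq (relax 25 26) (relax 26 25)) hs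
    (fun P s => s.nat 25 0 0 = x ∧ s.nat 26 0 0 = y ∧ s.real 0 x y = w s(x, y) ∧
      (∀ a b : Fin n, 0 ≤ s.real 1 a b) ∧
      (∀ a b : Fin n, wdist (H ⊔ SimpleGraph.edge x y) w a b ≤ s.dist a b ∧
        s.dist a b ≤ wdist H w a b) ∧
      ∀ a b : Fin n, (a, b) ∈ P → s.dist a b = wdist (H ⊔ SimpleGraph.edge x y) w a b)
    (by decide) (by decide) (by decide) rfl rfl
    (by intro P s z h; simpa [State.dist] using h) (by intro P s z h; simpa [State.dist] using h)
    ⟨hx, hy, hW, hd.nonneg, fun a b => by rw [hd.eq]; exact ⟨wdist_mono hle _ _ _, le_rfl⟩,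
      by simp⟩
    (by
      rintro P a b - s h20 h21 ⟨hx, hy, hW, hpos, hbd, hP⟩
      rw [run_seq]
      obtain ⟨p1, e1, o1⟩ := run_relax h20 h21 hx hy (by rw [hx, hy]; exact hW) hpos
      have f1 (c : ℕ) (hc : (relax 25 26).writesNat c = false) := run_nat (relax 25 26) c hc s
      have f1' := run_real (relax 25 26) 0 rfl s
      generalize (relax 25 26).run s = s₁ at *
      have hx' : s₁.nat 25 0 0 = x := by rw [f1 25 rfl, hx]
      have hy' : s₁.nat 26 0 0 = y := by rw [f1 26 rfl, hy]
      obtain ⟨p2, e2, o2⟩ := run_relax (by rw [f1 20 rfl, h20]) (by rw [f1 21 rfl, h21]) hy' hx'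
        (by rw [hx', hy', f1']; exact hW) p1
      have f2 (c : ℕ) (hc : (relax 26 25).writesNat c = false) := run_nat (relax 26 25) c hc s₁
      have f2' := run_real (relax 26 25) 0 rfl s₁
      generalize (relax 26 25).run s₁ = s₂ at *
      have hadj : (H ⊔ SimpleGraph.edge x y).Adj x y := by simp [SimpleGraph.edge_adj, hxy]
      have through (u v : Fin n) (he : wdist (H ⊔ SimpleGraph.edge x y) w u v ≤ w s(x, y))
          {t : State} (ht : ∀ a b : Fin n, wdist (H ⊔ SimpleGraph.edge x y) w a b ≤ t.dist a b) :
          wdist (H ⊔ SimpleGraph.edge x y) w a b ≤ t.dist a u + w s(x, y) + t.dist v b :=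
        calc _ ≤ _ := wdist_triangle _ _ _ v _
          _ ≤ _ := add_le_add_left (wdist_triangle _ _ _ u _) _
          _ ≤ _ := by gcongr <;> apply ht
      have b1 (c d : Fin n) : wdist (H ⊔ SimpleGraph.edge x y) w c d ≤ s₁.dist c d ∧
          s₁.dist c d ≤ wdist H w c d := by
        by_cases hcd : (c, d) = (a, b)
        · obtain ⟨rfl, rfl⟩ := Prod.mk.inj hcd
          rw [e1]
          exact ⟨le_min (hbd c d).1 (through x y (wdist_of_adj w hadj) fun a b => (hbd a b).1),
            min_le_of_left_le (hbd c d).2⟩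
        · rw [o1 c d hcd]; exact hbd c d
      have b2 : s₂.dist a b = wdist (H ⊔ SimpleGraph.edge x y) w a b := by
        rw [e2]
        refine le_antisymm ?_ (le_min (b1 a b).1
          (through y x (by rw [wdist_comm]; exact wdist_of_adj w hadj) fun a b => (b1 a b).1))
        rw [wdist_sup_edge H w hxy]
        refine le_min (min_le_of_left_le (b1 a b).2) (le_min (min_le_of_left_le ?_)
          (min_le_of_right_le ?_))
        · rw [e1]
          refine min_le_of_right_le ?_
          gcongr <;> apply (hbd _ _).2
        · gcongr <;> apply (b1 _ _).2
      refine ⟨by rw [f2 25 rfl, hx'], by rw [f2 26 rfl, hy'], by rw [f2', f1', hW], p2, ?_, ?_⟩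
      · intro c d
        by_cases hcd : (c, d) = (a, b)
        · obtain ⟨rfl, rfl⟩ := Prod.mk.inj hcd
          rw [b2]
          exact ⟨le_rfl, wdist_mono hle _ _ _⟩
        · rw [o2 c d hcd]; exact b1 c d
      · intro c d hmem
        by_cases hcd : (c, d) = (a, b)
        · obtain ⟨rfl, rfl⟩ := Prod.mk.inj hcd
          exact b2
        · rw [o2 c d hcd, o1 c d hcd]
          exact hP c d ((Finset.mem_insert.1 hmem).resolve_left hcd))
  obtain ⟨-, -, -, hpos, -, h⟩ := main
  exact ⟨hpos, fun a b => h a b (Finset.mem_univ _)⟩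

/-! ### Multiples of an edge weight -/

/-- Multiply the weight of the edge between the vertices `25` and `26` with a variable. -/
def scale (c o : ℕ) : Cmd :=
  .seq (.setRVar o .zero) (.loop 20 2 (.branch (.natLe (.add (.var 20) (.const 1)) (.var c))
    (.setRVar o (.add (.var o) (.load 0 (.var 25) (.var 26)))) .skip))

theorem run_scale {c o l : ℕ} (hc : c ≠ 20) (ho : o ≠ 0) {s : State} (hs : s.nat 0 0 0 = n)
    (hl : s.nat c 0 0 = l) (hln : l ≤ n + 2) :
    ((scale c o).run s).real o 0 0 = l * s.real 0 (s.nat 25 0 0) (s.nat 26 0 0) := by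
  set W := s.real 0 (s.nat 25 0 0) (s.nat 26 0 0) with hW
  have main := run_loop_nat (a := 20) (c := 2) (s := (setRVar o .zero).run s)
    (p := .branch (.natLe (.add (.var 20) (.const 1)) (.var c))
      (.setRVar o (.add (.var o) (.load 0 (.var 25) (.var 26)))) .skip)
    (fun m s => s.nat c 0 0 = l ∧ s.real 0 (s.nat 25 0 0) (s.nat 26 0 0) = W ∧
      s.real o 0 0 = (min m l : ℕ) * W)
    (by rintro m s z ⟨h1, h2, h3⟩; simp [*])
    (by simp [hl, ← hW, Ne.symm ho])
    (by
      rintro m - s hm ⟨h1, h2, h3⟩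
      by_cases h : m + 1 ≤ l
      · rw [run_branch_pos (by simpa [hm, h1] using h)]
        rw [min_eq_left (show m ≤ l by omega)] at h3
        rw [min_eq_left h]
        refine ⟨by simpa using h1, by simpa [Ne.symm ho] using h2, ?_⟩
        simp [h2, h3]
        ring
      · rw [run_branch_neg (by simpa [hm, h1] using h)]
        refine ⟨h1, h2, ?_⟩
        rw [run_skip, h3, min_eq_right (show l ≤ m by omega), min_eq_right (show l ≤ m + 1 by omega)])
  have e : ((setRVar o .zero).run s).nat 0 0 0 = n := by simpa using hs
  rw [e, min_eq_right hln] at main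
  exact main.2.2

/-! ### Balls -/

end Cmd

/-- The array with the flags of the vertices with a large ball of type `b`. -/
def flagArr (b : Bool) : ℕ := bif b then 6 else 5

/-- The array with the balls of type `b`. -/
def rowArr (b : Bool) : ℕ := bif b then 8 else 7

/-- The real variable with the radius of the balls of type `b`. -/
def distVar (b : Bool) : ℕ := bif b then 5 else 4

namespace Cmd

/-- Store the ball of type `b` around the vertex `z`, unless it has been stored already, and set the
flag if it is large. -/
def settle (b : Bool) (z : ℕ) : Cmd :=
  .branch (.isOne (.load (flagArr b) (.var z) (.const 0))) .skip <|
  .seq (.setVar 27 (.const 0)) <|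
  .seq (.loop 20 0 (.branch (.and (.isOne (.load 3 (.var z) (.var 20)))
      (.realLe (.load 1 (.var z) (.var 20)) (.var (distVar b))))
    (.seq (.setNat (rowArr b) (.var z) (.var 20) (.const 1))
      (.setVar 27 (.add (.var 27) (.const 1))))
    (.setNat (rowArr b) (.var z) (.var 20) (.const 0)))) <|
  .branch (.natLe (.var (sizeVar b)) (.var 27))
    (.setNat (flagArr b) (.var z) (.const 0) (.const 1)) .skip

end Cmd

/-- The pairs that have been dealt with. -/
def State.Done (s : State) (u v : Fin n) : Prop := s.nat 4 u v = 1

/-- The vertices with a large ball. -/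
def State.Flag (s : State) (b : Bool) (z : Fin n) : Prop := s.nat (flagArr b) z 0 = 1

/-- The balls. -/
def State.Row (s : State) (b : Bool) (z v : Fin n) : Prop := s.nat (rowArr b) z v = 1

open Classical in
-- The row is rewritten whether or not the ball turns out to be large; only the flag makes it count.
-- All other rows and flags are framed, as the invariant of the greedy phase requires.
theorem Cmd.run_settle {b : Bool} {zv : ℕ} (hzv : zv = 25 ∨ zv = 26) {s : State}
    (hs : s.nat 0 0 0 = n) {z : Fin n} (hz : s.nat zv 0 0 = z) {W : ℝ≥0} {l m : ℕ}
    (hl : s.real (distVar b) 0 0 = l * (W : ℝ)) (hm : s.nat (sizeVar b) 0 0 = m)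
    (hd : HasDist H w s) (hF : ¬ s.Flag b z) :
    let s' := (settle b zv).run s
    (∀ v, s'.Row b z v ↔ wdist H w z v ≤ l * W) ∧
    (s'.Flag b z ↔ m ≤ {v | wdist H w z v ≤ l * W}.ncard) ∧
    (∀ b' (z' : Fin n), ¬ (b' = b ∧ z' = z) →
      (s'.Flag b' z' ↔ s.Flag b' z') ∧ ∀ v : Fin n, s'.Row b' z' v ↔ s.Row b' z' v) := by
  have main := run_loop (a := 20) (s := (setVar 27 (.const 0)).run s) (n := n)
    (p := .branch (.and (.isOne (.load 3 (.var zv) (.var 20)))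
      (.realLe (.load 1 (.var zv) (.var 20)) (.var (distVar b))))
    (.seq (.setNat (rowArr b) (.var zv) (.var 20) (.const 1))
      (.setVar 27 (.add (.var 27) (.const 1))))
    (.setNat (rowArr b) (.var zv) (.var 20) (.const 0))) (by simpa using hs)
    (fun P s' => s'.nat zv 0 0 = z ∧ s'.real (distVar b) 0 0 = l * (W : ℝ) ∧
      s'.nat (sizeVar b) 0 0 = m ∧ HasDist H w s' ∧
      s'.nat 27 0 0 = (P.filter fun v => wdist H w z v ≤ l * W).card ∧
      (∀ v ∈ P, s'.Row b z v ↔ wdist H w z v ≤ l * W) ∧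
      (∀ b' (z' : Fin n), s'.Flag b' z' ↔ s.Flag b' z') ∧
      ∀ b' (z' : Fin n), ¬ (b' = b ∧ z' = z) → ∀ v : Fin n, s'.Row b' z' v ↔ s.Row b' z' v)
    (by
      rintro P s' x ⟨h1, h2, h3, h4, h5, h6, h7, h8⟩
      refine ⟨?_, h2, ?_, h4.congr (State.setN_nat_ne _ _ _ _ _ _ (by decide)) rfl, ?_, ?_, ?_, ?_⟩
      · rcases hzv with rfl | rfl <;> simpa using h1
      · cases b <;> simpa [sizeVar] using h3
      · simpa using h5
      · cases b <;> simpa [State.Row, rowArr] using h6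
      · intro b' z'; rw [← h7]; cases b' <;> simp [State.Flag, flagArr]
      · intro b' z' hb v; rw [← h8 b' z' hb]; cases b' <;> simp [State.Row, rowArr])
    (by
      refine ⟨?_, hl, ?_, hd.congr (State.setN_nat_ne _ _ _ _ _ _ (by decide)) rfl, by simp,
        by simp, ?_, ?_⟩
      · rcases hzv with rfl | rfl <;> simpa using hz
      · cases b <;> simpa [sizeVar] using hm
      · intro b' z'; cases b' <;> simp [State.Flag, flagArr]
      · intro b' z' hb v; cases b' <;> simp [State.Row, rowArr])
    (by
      rintro P v hv s' h20 ⟨h1, h2, h3, h4, h5, h6, h7, h8⟩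
      have hiff := h4.le_iff z v l W
      have hne (v' : Fin n) (hv' : v' ∈ P) : v' ≠ v := by rintro rfl; exact hv hv'
      rw [run_branch]
      split_ifs with h
      · simp only [Test.Holds, Test.isOne_holds, NExp.eval, RExp.eval, h20, h1, h2] at h
        have h' := hiff.2 h
        refine ⟨?_, ?_, ?_, h4.congr ?_ rfl, ?_, ?_, ?_, ?_⟩
        · rcases hzv with rfl | rfl <;> cases b <;> simpa [rowArr] using h1
        · simpa using h2
        · cases b <;> simpa [sizeVar, rowArr] using h3
        · funext i j; cases b <;> simp [rowArr]
        · rw [Finset.filter_insert, if_pos h', Finset.card_insert_of_notMem (by simp [hv]), ← h5]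
          cases b <;> simp [rowArr]
        · intro v' hv'
          rcases Finset.mem_insert.1 hv' with rfl | hv'
          · simp [State.Row, h', h1, h20]
            cases b <;> simp [rowArr]
          · rw [← h6 v' hv']
            have := Fin.val_ne_of_ne (hne v' hv')
            cases b <;> simp [State.Row, rowArr, h20, this]
        · intro b' z'; rw [← h7]
          cases b <;> cases b' <;> simp [State.Flag, flagArr, rowArr]
        · intro b' z' hb v'
          rw [← h8 b' z' hb]
          rw [Fin.ext_iff] at hb
          cases b <;> cases b' <;> simp [State.Row, rowArr, h1] <;> simp at hb <;> simp [hb]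
      · simp only [Test.Holds, Test.isOne_holds, NExp.eval, RExp.eval, h20, h1, h2] at h
        have h' := mt hiff.1 h
        refine ⟨?_, ?_, ?_, h4.congr ?_ rfl, ?_, ?_, ?_, ?_⟩
        · rcases hzv with rfl | rfl <;> cases b <;> simpa [rowArr] using h1
        · simpa using h2
        · cases b <;> simpa [sizeVar, rowArr] using h3
        · funext i j; cases b <;> simp [rowArr]
        · rw [Finset.filter_insert, if_neg h', ← h5]
          cases b <;> simp [rowArr]
        · intro v' hv'
          rcases Finset.mem_insert.1 hv' with rfl | hv'
          · simpa [State.Row, h1, h20] using h'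
          · rw [← h6 v' hv']
            have := Fin.val_ne_of_ne (hne v' hv')
            cases b <;> simp [State.Row, rowArr, h20, this]
        · intro b' z'; rw [← h7]
          cases b <;> cases b' <;> simp [State.Flag, flagArr, rowArr]
        · intro b' z' hb v'
          rw [← h8 b' z' hb]
          rw [Fin.ext_iff] at hb
          cases b <;> cases b' <;> simp [State.Row, rowArr, h1] <;> simp at hb <;> simp [hb])
  intro s'
  have hs' : s' = (settle b zv).run s := rfl
  rw [settle, run_branch_neg (by simpa [hz, State.Flag] using hF), run_seq, run_seq] at hs'
  generalize run _ (run _ s) = t at hs' main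
  obtain ⟨h1, -, h3, -, h5, h6, h7, h8⟩ := main
  have hcard : {v | wdist H w z v ≤ l * W}.ncard = t.nat 27 0 0 := by
    rw [h5, ← Set.ncard_coe_finset]; simp
  rw [hcard]
  by_cases h : m ≤ t.nat 27 0 0
  · rw [run_branch_pos (by simpa [h3] using h)] at hs'
    rw [hs']
    refine ⟨fun v => ?_, ?_, fun b' z' hb => ⟨?_, fun v => ?_⟩⟩
    · rw [← h6 v (Finset.mem_univ _)]
      cases b <;> simp [State.Row, rowArr, flagArr]
    · simp [State.Flag, h1, h]
    · rw [← h7]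
      rw [Fin.ext_iff] at hb
      cases b <;> cases b' <;> simp [State.Flag, flagArr, h1] <;> simp at hb <;> simp [hb]
    · rw [← h8 b' z' hb]
      cases b <;> cases b' <;> simp [State.Row, rowArr, flagArr]
  · rw [run_branch_neg (by simpa [h3] using h), run_skip] at hs'
    rw [hs']
    exact ⟨fun v => h6 v (Finset.mem_univ _), by simpa [h, h7] using hF,
      fun b' z' hb => ⟨h7 b' z', h8 b' z' hb⟩⟩

end WSpanner

namespace WSpanner

variable {n k r : ℕ} {ρ : Bool → ℕ} {G H : SimpleGraph (Fin n)} {w : Sym2 (Fin n) → ℝ≥0}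

/-! ### The greedy phase as a program -/

/-- The memory holds the state of the greedy phase with the current graph `H`. -/
structure PhaseInv (n k r : ℕ) (ρ : Bool → ℕ) (G : SimpleGraph (Fin n)) (w : Sym2 (Fin n) → ℝ≥0)
    (s : State) (H : SimpleGraph (Fin n)) : Prop where
  params : HasParams n k r ρ s
  adj : ∀ u v : Fin n, s.nat 1 u v = 1 ↔ G.Adj u v
  weight : ∀ u v : Fin n, G.Adj u v → s.real 0 u v = w s(u, v)
  out : IsOutput s H
  dist : HasDist H w s
  greedy : Greedy G w k ρ r H s.Done s.Flag s.Row

theorem HasParams.congr {s s' : State} (h : HasParams n k r ρ s)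
    (hN : ∀ a ∈ [0, 28, 30, 31, 32, 33], s'.nat a = s.nat a) : HasParams n k r ρ s' where
  hn := by rw [hN 0 (by simp), h.hn]
  hk := by rw [hN 28 (by simp), h.hk]
  radius := by intro b; rw [hN _ (by cases b <;> simp [radiusVar]), h.radius]
  size := by intro b; rw [hN _ (by cases b <;> simp [sizeVar]), h.size]

theorem PhaseInv.congr {s s' : State} (h : PhaseInv n k r ρ G w s H)
    (hN : ∀ a ∈ [0, 1, 2, 3, 4, 5, 6, 7, 8, 28, 30, 31, 32, 33], s'.nat a = s.nat a)
    (hR : ∀ a ∈ [0, 1], s'.real a = s.real a) : PhaseInv n k r ρ G w s' H where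
  params := h.params.congr fun a ha => hN a (by simp only [List.mem_cons] at ha ⊢; tauto)
  adj := by rw [hN 1 (by simp)]; exact h.adj
  weight := by rw [hR 0 (by simp)]; exact h.weight
  out := by intro u v; rw [hN 2 (by simp)]; exact h.out u v
  dist := h.dist.congr (hN 3 (by simp)) (hR 1 (by simp))
  greedy := by
    have h1 : (s'.Done : Fin n → Fin n → Prop) = s.Done := by
      funext u v; rw [State.Done, hN 4 (by simp)]; rfl
    have h2 : (s'.Flag : Bool → Fin n → Prop) = s.Flag := by
      funext b z; rw [State.Flag, hN _ (by cases b <;> simp [flagArr])]; rfl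
    have h3 : (s'.Row : Bool → Fin n → Fin n → Prop) = s.Row := by
      funext b z v; rw [State.Row, hN _ (by cases b <;> simp [rowArr])]; rfl
    rw [h1, h2, h3]; exact h.greedy

theorem State.done_setN (s : State) {a : ℕ} (ha : 4 ≠ a) (i j x : ℕ) :
    ((s.setN a i j x).Done : Fin n → Fin n → Prop) = s.Done := by
  funext u v; rw [State.Done, State.setN_nat_ne _ _ _ _ _ _ ha]; rfl

/-! ### Dealing with a single edge -/

/-- The memory is prepared for dealing with the edge between `x` and `y`. -/
structure Ready (n k r : ℕ) (ρ : Bool → ℕ) (G : SimpleGraph (Fin n)) (w : Sym2 (Fin n) → ℝ≥0)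
    (s : State) (H : SimpleGraph (Fin n)) (x y : Fin n) : Prop where
  inv : PhaseInv n k r ρ G w s H
  left : s.nat 25 0 0 = x
  right : s.nat 26 0 0 = y
  bound : s.real 3 0 0 = k * (w s(x, y) : ℝ)
  radius : ∀ b, s.real (distVar b) 0 0 = ρ b * (w s(x, y) : ℝ)
  adj : G.Adj x y
  undone : ¬ s.Done x y
  min : ∀ u v, G.Adj u v → ¬ s.Done u v → w s(x, y) ≤ w s(u, v)

namespace Cmd

/-- A flag that was already set stands for a ball stored at an earlier edge, which remains usable; a
flag still unset afterwards certifies that the present ball is small. Flags are never cleared, so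
the calls for both ends and both types can be chained. -/
theorem run_settle_of_ready {s : State} {x y : Fin n} (h : Ready n k r ρ G w s H x y) {b : Bool} {zv : ℕ}
    {z : Fin n} (hz : zv = 25 ∧ z = x ∨ zv = 26 ∧ z = y) :
    Ready n k r ρ G w ((settle b zv).run s) H x y ∧
    (((settle b zv).run s).Flag b z ∨
      {v | wdist H w z v ≤ ρ b * w s(x, y)}.ncard < r ^ ρ b) ∧
    ∀ b' (z' : Fin n), s.Flag b' z' → ((settle b zv).run s).Flag b' z' := by
  have hzv : zv = 25 ∨ zv = 26 := by tauto
  have hsz : s.nat zv 0 0 = z := by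
    rcases hz with ⟨rfl, rfl⟩ | ⟨rfl, rfl⟩
    · exact h.left
    · exact h.right
  by_cases hF : s.Flag b z
  · rw [Cmd.settle, run_branch_pos (by simpa [hsz, State.Flag] using hF), run_skip]
    exact ⟨h, .inl hF, fun _ _ h => h⟩
  obtain ⟨h1, h2, h3⟩ := run_settle hzv h.inv.params.hn hsz (h.radius b) (h.inv.params.size b)
    h.inv.dist hF
  have fN (a : ℕ) (ha : (Cmd.settle b zv).writesNat a = false) := run_nat _ a ha s
  have fR (a : ℕ) := run_real (Cmd.settle b zv) a (by simp [Cmd.settle, writesReal]) s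
  generalize (Cmd.settle b zv).run s = s' at *
  have fN' (a : ℕ) (ha : a ∈ [0, 1, 2, 3, 4, 25, 26, 28, 30, 31, 32, 33]) : s'.nat a = s.nat a := by
    refine fN a ?_
    simp only [List.mem_cons, List.not_mem_nil, or_false] at ha
    rcases ha with rfl | rfl | rfl | rfl | rfl | rfl | rfl | rfl | rfl | rfl | rfl | rfl <;>
      cases b <;> rfl
  have hDone : (s'.Done : Fin n → Fin n → Prop) = s.Done := by
    funext u v; rw [State.Done, fN' 4 (by simp)]; rfl
  refine ⟨⟨⟨?_, ?_, ?_, ?_, ?_, ?_⟩, ?_, ?_, ?_, ?_, h.adj, ?_, ?_⟩, ?_, ?_⟩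
  · exact h.inv.params.congr fun a ha => fN' a (by simp only [List.mem_cons] at ha ⊢; tauto)
  · rw [fN' 1 (by simp)]; exact h.inv.adj
  · rw [fR]; exact h.inv.weight
  · intro u v; rw [fN' 2 (by simp)]; exact h.inv.out u v
  · exact h.inv.dist.congr (fN' 3 (by simp)) (fR 1)
  · rw [hDone]
    refine h.inv.greedy.settle h.min hF (fun b' z' hb => (h3 b' z' hb).1)
      (fun b' z' hb => (h3 b' z' hb).2) (fun hf => ?_) h1
    simp only [h1]
    exact h2.1 hf
  · rw [fN' 25 (by simp)]; exact h.left
  · rw [fN' 26 (by simp)]; exact h.right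
  · rw [fR]; exact h.bound
  · intro b; rw [fR]; exact h.radius b
  · rw [hDone]; exact h.undone
  · rw [hDone]; exact h.min
  · rw [h2]; exact le_or_gt _ _
  · intro b' z' hf
    by_cases hb : b' = b ∧ z' = z
    · obtain ⟨rfl, rfl⟩ := hb; exact absurd hf hF
    · exact (h3 b' z' hb).1.2 hf

/-- Insert the edge between the vertices `25` and `26`. -/
def addEdge : Cmd :=
  .seq (.setNat 2 (.var 25) (.var 26) (.const 1)) <|
  .seq (.setNat 2 (.var 26) (.var 25) (.const 1)) updateDist

/-- The test whether the edge between the vertices `25` and `26` is to be inserted. -/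
def needed : Test :=
  .and (.not (.and (.isOne (.load 3 (.var 25) (.var 26)))
      (.realLe (.load 1 (.var 25) (.var 26)) (.var 3))))
    (.not (.and (.and (.isOne (.load 5 (.var 25) (.const 0))) (.isOne (.load 6 (.var 25) (.const 0))))
      (.and (.isOne (.load 5 (.var 26) (.const 0))) (.isOne (.load 6 (.var 26) (.const 0))))))

theorem isOutput_sup_edge {s s' : State} (h : IsOutput s H) {x y : Fin n} (hxy : x ≠ y)
    (hs : ∀ u v : Fin n, s'.nat 2 u v = if (u = x ∧ v = y) ∨ (u = y ∧ v = x) then 1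
      else s.nat 2 u v) : IsOutput s' (H ⊔ SimpleGraph.edge x y) := by
  intro u v
  rw [SimpleGraph.sup_adj, SimpleGraph.edge_adj, hs, h u v]
  split_ifs with h'
  · have : u ≠ v := by
      rintro rfl
      rcases h' with ⟨rfl, rfl⟩ | ⟨rfl, rfl⟩ <;> exact hxy rfl
    simp [h', this]
  · simp [h']

theorem run_addEdge {s : State} {x y : Fin n} (hs : s.nat 0 0 0 = n) (hx : s.nat 25 0 0 = x)
    (hy : s.nat 26 0 0 = y) (hxy : x ≠ y) (hW : s.real 0 x y = w s(x, y)) (hd : HasDist H w s)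
    (ho : IsOutput s H) : HasDist (H ⊔ SimpleGraph.edge x y) w (addEdge.run s) ∧
      IsOutput (addEdge.run s) (H ⊔ SimpleGraph.edge x y) := by
  obtain ⟨t, ht⟩ : ∃ t, t = (setNat 2 (.var 26) (.var 25) (.const 1)).run
    ((setNat 2 (.var 25) (.var 26) (.const 1)).run s) := ⟨_, rfl⟩
  have hrun : addEdge.run s = updateDist.run t := by rw [addEdge, run_seq, run_seq, ht]
  have tN (a : ℕ) (ha : a ≠ 2) : t.nat a = s.nat a := by
    rw [ht, run_setNat, State.setN_nat_ne _ _ _ _ _ _ ha, run_setNat,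
      State.setN_nat_ne _ _ _ _ _ _ ha]
  have tR : t.real = s.real := by rw [ht]; rfl
  have t2 (u v : Fin n) : t.nat 2 u v = if (u = x ∧ v = y) ∨ (u = y ∧ v = x) then 1
      else s.nat 2 u v := by
    simp only [ht, run_setNat, State.setN_nat, NExp.eval, Fin.ext_iff]
    simp [hx, hy]
    split_ifs <;> tauto
  clear ht
  have hdist := run_updateDist (s := t) (H := H) (w := w) (x := x) (y := y)
    (by rw [tN 0 (by decide), hs]) (by rw [tN 25 (by decide), hx])
    (by rw [tN 26 (by decide), hy]) hxy (by rw [tR, hW])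
    (hd.congr (tN 3 (by decide)) (by rw [tR]))
  rw [hrun]
  refine ⟨hdist, isOutput_sup_edge ho hxy fun u v => ?_⟩
  rw [run_nat updateDist 2 rfl, t2]

/-- An insertion requires a missing flag, and by `hsettled` this means a small ball at one end, as
`Greedy.add_edge` demands. Only the ordered pair `(x, y)` is marked; the reversed pair is dealt with
separately. -/
theorem run_decide_of_ready {s : State} {x y : Fin n} (h : Ready n k r ρ G w s H x y) (hk : 1 ≤ k)
    (hρ : ∀ b, 2 * ρ b ≤ k)
    (hsettled : ∀ b z, z = x ∨ z = y → s.Flag b z ∨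
      {v | wdist H w z v ≤ ρ b * w s(x, y)}.ncard < r ^ ρ b) :
    let s' := ((branch needed addEdge .skip).seq (.setNat 4 (.var 25) (.var 26) (.const 1))).run s
    (∃ H', PhaseInv n k r ρ G w s' H') ∧
    ∀ u v : Fin n, s'.Done u v ↔ s.Done u v ∨ u = x ∧ v = y := by
  intro s'
  have hle := h.inv.dist.le_iff x y k (w s(x, y))
  have hs' : s' = ((branch needed addEdge .skip).seq
    (.setNat 4 (.var 25) (.var 26) (.const 1))).run s := rfl
  rw [run_seq, run_branch] at hs'
  split_ifs at hs' with hneed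
  · simp only [needed, Test.Holds, Test.isOne_holds, NExp.eval, RExp.eval, h.left, h.right,
      h.bound] at hneed
    obtain ⟨hd, hF⟩ := hneed
    rw [← hle] at hd
    have hsmall : ∃ b z, (z = x ∨ z = y) ∧
        {v | wdist H w z v ≤ ρ b * w s(x, y)}.ncard < r ^ ρ b := by
      by_contra! hcon
      have hall (b z) (hz : z = x ∨ z = y) : s.Flag b z :=
        (hsettled b z hz).resolve_right (not_lt.2 (hcon b z hz))
      exact hF ⟨⟨hall false x (.inl rfl), hall true x (.inl rfl)⟩,
        hall false y (.inr rfl), hall true y (.inr rfl)⟩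
    obtain ⟨b, z, hz, hball⟩ := hsmall
    obtain ⟨hdist, hout⟩ := run_addEdge h.inv.params.hn h.left h.right h.adj.ne
      (h.inv.weight x y h.adj) h.inv.dist h.inv.out
    have tN (a : ℕ) (ha : addEdge.writesNat a = false) := run_nat addEdge a ha s
    have tR := run_real addEdge 0 rfl s
    generalize addEdge.run s = t at *
    have s4 (a : ℕ) (h4 : a ≠ 4) : s'.nat a = t.nat a := by
      rw [hs', run_setNat, State.setN_nat_ne _ _ _ _ _ _ h4]
    have sR : s'.real = t.real := by rw [hs']; rfl
    have sN (a : ℕ) (ha : addEdge.writesNat a = false) (h4 : a ≠ 4) : s'.nat a = s.nat a := by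
      rw [s4 a h4, tN a ha]
    have hDone (u v : Fin n) : s'.Done u v ↔ s.Done u v ∨ u = x ∧ v = y := by
      rw [State.Done, hs', run_setNat]
      simp only [State.setN_nat, NExp.eval, tN 25 rfl, tN 26 rfl, tN 4 rfl, h.left, h.right,
        Fin.ext_iff, true_and]
      rw [State.Done]
      split_ifs with hif
      · simp [hif]
      · simp [hif]
    clear hs'
    have h2 : (s'.Flag : Bool → Fin n → Prop) = s.Flag := by
      funext b z
      rw [State.Flag, sN _ (by cases b <;> rfl) (by cases b <;> decide)]
      rfl
    have h3 : (s'.Row : Bool → Fin n → Fin n → Prop) = s.Row := by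
      funext b z v
      rw [State.Row, sN _ (by cases b <;> rfl) (by cases b <;> decide)]
      rfl
    refine ⟨⟨H ⊔ SimpleGraph.edge x y, ?_, ?_, ?_, ?_, ?_, ?_⟩, hDone⟩
    · refine h.inv.params.congr fun a ha => ?_
      simp only [List.mem_cons, List.not_mem_nil, or_false] at ha
      rcases ha with rfl | rfl | rfl | rfl | rfl | rfl <;>
        exact sN _ rfl (by decide)
    · rw [sN 1 rfl (by decide)]; exact h.inv.adj
    · rw [sR, tR]; exact h.inv.weight
    · intro u v; rw [s4 2 (by decide)]; exact hout u v
    · exact hdist.congr (s4 3 (by decide)) (by rw [sR])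
    · rw [h2, h3]
      exact h.inv.greedy.add_edge h.undone h.adj h.min hk hρ hDone hd hz hball
  · simp only [needed, Test.Holds, Test.isOne_holds, NExp.eval, RExp.eval, h.left, h.right,
      h.bound] at hneed
    rw [← hle] at hneed
    rw [run_skip, run_setNat] at hs'
    have sN (a : ℕ) (h4 : a ≠ 4) : s'.nat a = s.nat a := by
      rw [hs', State.setN_nat_ne _ _ _ _ _ _ h4]
    have hDone (u v : Fin n) : s'.Done u v ↔ s.Done u v ∨ u = x ∧ v = y := by
      simp [hs', State.Done, h.left, h.right, Fin.ext_iff]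
      tauto
    have h2 : (s'.Flag : Bool → Fin n → Prop) = s.Flag := by
      funext b z
      rw [State.Flag, sN _ (by cases b <;> decide)]
      rfl
    have h3 : (s'.Row : Bool → Fin n → Fin n → Prop) = s.Row := by
      funext b z v
      rw [State.Row, sN _ (by cases b <;> decide)]
      rfl
    refine ⟨⟨H, ?_, ?_, ?_, ?_, ?_, ?_⟩, hDone⟩
    · refine h.inv.params.congr fun a ha => sN a ?_
      rintro rfl; simp at ha
    · rw [sN 1 (by decide)]; exact h.inv.adj
    · rw [hs']; exact h.inv.weight
    · intro u v; rw [sN 2 (by decide)]; exact h.inv.out u v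
    · exact h.inv.dist.congr (sN 3 (by decide)) (by rw [hs']; rfl)
    · rw [h2, h3]
      refine h.inv.greedy.skip_edge h.undone h.adj hDone ?_
      rw [not_and_or, not_not, not_not] at hneed
      refine hneed.imp_right ?_
      rintro ⟨⟨f1, f2⟩, f3, f4⟩ b z (rfl | rfl) <;> cases b <;> assumption

/-- Deal with the edge between the vertices `25` and `26`. -/
def process : Cmd :=
  .seq (scale 28 3) <| .seq (scale 30 4) <| .seq (scale 31 5) <|
  .seq (settle false 25) <| .seq (settle true 25) <| .seq (settle false 26) <|
  .seq (settle true 26) <|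
  (branch needed addEdge .skip).seq (.setNat 4 (.var 25) (.var 26) (.const 1))

theorem run_process {s : State} {x y : Fin n} (h : PhaseInv n k r ρ G w s H) (hk : 1 ≤ k)
    (hkn : k ≤ n + 2) (hρ : ∀ b, 2 * ρ b ≤ k) (hx : s.nat 25 0 0 = x) (hy : s.nat 26 0 0 = y)
    (hadj : G.Adj x y) (hundone : ¬ s.Done x y)
    (hmin : ∀ u v, G.Adj u v → ¬ s.Done u v → w s(x, y) ≤ w s(u, v)) :
    (∃ H', PhaseInv n k r ρ G w (process.run s) H') ∧
    ∀ u v : Fin n, (process.run s).Done u v ↔ s.Done u v ∨ u = x ∧ v = y := by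
  have hρn (b : Bool) : ρ b ≤ n + 2 := by have := hρ b; omega
  have hscale {s : State} (h : PhaseInv n k r ρ G w s H) (hx : s.nat 25 0 0 = x)
      (hy : s.nat 26 0 0 = y) {c o l : ℕ} (hc : c ≠ 20) (ho : o ∉ [0, 1]) (hl : s.nat c 0 0 = l)
      (hln : l ≤ n + 2) : ((scale c o).run s).real o 0 0 = l * (w s(x, y) : ℝ) ∧
        PhaseInv n k r ρ G w ((scale c o).run s) H ∧
        (∀ a, a ≠ 20 → ((scale c o).run s).nat a = s.nat a) ∧
        (∀ a, a ≠ o → ((scale c o).run s).real a = s.real a) := by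
    have fN (a : ℕ) (ha : a ≠ 20) := run_nat (scale c o) a (by simp [scale, writesNat, ha]) s
    have fR (a : ℕ) (ha : a ≠ o) := run_real (scale c o) a (by simp [scale, writesReal, ha]) s
    refine ⟨?_, ?_, fN, fR⟩
    · rw [run_scale (n := n) hc (by rintro rfl; simp at ho) h.params.hn hl hln, hx, hy,
        h.weight x y hadj]
    · exact h.congr (fun a ha => fN a (by rintro rfl; simp at ha))
        (fun a ha => fR a (by rintro rfl; exact ho ha))
  rw [process]
  simp only [run_seq]
  obtain ⟨v1, i1, n1, r1⟩ := hscale h hx hy (c := 28) (o := 3) (by decide) (by decide)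
    h.params.hk hkn
  generalize (scale 28 3).run s = s₁ at *
  obtain ⟨v2, i2, n2, r2⟩ := hscale i1 (by rw [n1 25 (by decide), hx])
    (by rw [n1 26 (by decide), hy]) (c := 30) (o := 4) (by decide) (by decide)
    (i1.params.radius false) (hρn _)
  generalize (scale 30 4).run s₁ = s₂ at *
  obtain ⟨v3, i3, n3, r3⟩ := hscale i2 (by rw [n2 25 (by decide), n1 25 (by decide), hx])
    (by rw [n2 26 (by decide), n1 26 (by decide), hy]) (c := 31) (o := 5) (by decide) (by decide)
    (i2.params.radius true) (hρn _)
  generalize (scale 31 5).run s₂ = s₃ at *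
  have nN (a : ℕ) (ha : a ≠ 20) : s₃.nat a = s.nat a := by rw [n3 a ha, n2 a ha, n1 a ha]
  have hDone : (s₃.Done : Fin n → Fin n → Prop) = s.Done := by
    funext u v; rw [State.Done, nN 4 (by decide)]; rfl
  have ready : Ready n k r ρ G w s₃ H x y := by
    refine ⟨i3, by rw [nN 25 (by decide), hx], by rw [nN 26 (by decide), hy], ?_, ?_, hadj,
      by rwa [hDone], by rwa [hDone]⟩
    · rw [r3 3 (by decide), r2 3 (by decide), v1]
    · rintro (_ | _)
      · simp only [distVar, cond_false]; rw [r3 4 (by decide), v2]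
      · exact v3
  obtain ⟨q1, f1, m1⟩ := run_settle_of_ready ready (b := false) (.inl ⟨rfl, rfl⟩)
  have d1 := run_nat (Cmd.settle false 25) 4 rfl s₃
  generalize (Cmd.settle false 25).run s₃ = s₄ at *
  obtain ⟨q2, f2, m2⟩ := run_settle_of_ready q1 (b := true) (.inl ⟨rfl, rfl⟩)
  have d2 := run_nat (Cmd.settle true 25) 4 rfl s₄
  generalize (Cmd.settle true 25).run s₄ = s₅ at *
  obtain ⟨q3, f3, m3⟩ := run_settle_of_ready q2 (b := false) (.inr ⟨rfl, rfl⟩)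
  have d3 := run_nat (Cmd.settle false 26) 4 rfl s₅
  generalize (Cmd.settle false 26).run s₅ = s₆ at *
  obtain ⟨q4, f4, m4⟩ := run_settle_of_ready q3 (b := true) (.inr ⟨rfl, rfl⟩)
  have d4 := run_nat (Cmd.settle true 26) 4 rfl s₆
  generalize (Cmd.settle true 26).run s₆ = s₇ at *
  -- None of the four calls changes the graph, so a ball found small stays small, while flags set
  -- early persist.
  have final := run_decide_of_ready q4 hk hρ (by
    rintro (_ | _) z (rfl | rfl)
    · exact f1.imp_left fun h => m4 _ _ (m3 _ _ (m2 _ _ h))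
    · exact f3.imp_left fun h => m4 _ _ h
    · exact f2.imp_left fun h => m4 _ _ (m3 _ _ h)
    · exact f4)
  refine ⟨final.1, fun u v => ?_⟩
  have : s₇.Done u v ↔ s.Done u v := by
    rw [State.Done, d4, d3, d2, d1, nN 4 (by decide)]; rfl
  rw [← this]
  exact final.2 u v

/-! ### The loop over all edges -/

/-- The greedy phase: deal with all edges in the order of their weights. -/
def greedyPhase : Cmd :=
  .loop 22 0 (.loop 23 0 (.seq
    (findMin (.and (.isOne (.load 1 (.var 20) (.var 21)))
      (.not (.isOne (.load 4 (.var 20) (.var 21))))) (.load 0 (.var 20) (.var 21)))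
    (.branch (.isOne (.var 24)) process .skip)))

open Classical in
-- Instead of sorting, every pass selects a lightest edge not yet dealt with. As long as such an
-- edge exists, a pass marks a new ordered pair, so the marked pairs are at least as many as the
-- passes, and `n * n` passes exhaust all pairs.
theorem run_greedyPhase {s : State} (h : PhaseInv n k r ρ G w s H) (hk : 1 ≤ k)
    (hkn : k ≤ n + 2) (hρ : ∀ b, 2 * ρ b ≤ k) :
    ∃ H', PhaseInv n k r ρ G w (greedyPhase.run s) H' ∧
      ∀ u v : Fin n, G.Adj u v → (greedyPhase.run s).Done u v := by
  have main := run_loop_loop (a := 22) (b := 23) (p := .seq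
    (findMin (.and (.isOne (.load 1 (.var 20) (.var 21)))
      (.not (.isOne (.load 4 (.var 20) (.var 21))))) (.load 0 (.var 20) (.var 21)))
    (.branch (.isOne (.var 24)) process .skip)) h.params.hn
    (fun P s => (∃ H', PhaseInv n k r ρ G w s H') ∧
      ((∀ u v : Fin n, G.Adj u v → s.Done u v) ∨
        P.card ≤ (Finset.univ.filter fun e : Fin n × Fin n => s.Done e.1 e.2).card))
    (by decide) (by decide) (by decide) rfl rfl
    (by
      rintro P s z ⟨⟨H', h1⟩, h2⟩
      refine ⟨⟨H', h1.congr (fun a ha => State.setN_nat_ne _ _ _ _ _ _ ?_) fun _ _ => rfl⟩,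
        by rwa [State.done_setN _ (by decide)]⟩
      rintro rfl; simp at ha)
    (by
      rintro P s z ⟨⟨H', h1⟩, h2⟩
      refine ⟨⟨H', h1.congr (fun a ha => State.setN_nat_ne _ _ _ _ _ _ ?_) fun _ _ => rfl⟩,
        by rwa [State.done_setN _ (by decide)]⟩
      rintro rfl; simp at ha)
    ⟨⟨H, h⟩, .inr (by simp)⟩
    (by
      rintro P a b hab s - - ⟨⟨H', h1⟩, h2⟩
      rw [run_seq]
      have hmin := run_findMin (n := n) (s := s)
        (test := (.and (.isOne (.load 1 (.var 20) (.var 21)))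
          (.not (.isOne (.load 4 (.var 20) (.var 21)))))) (val := .load 0 (.var 20) (.var 21))
        h1.params.hn (fun x y => G.Adj x y ∧ ¬ s.Done x y) (fun x y => w s(x, y))
        (by
          intro s' x y hag hx hy
          simp only [Test.Holds, Test.isOne_holds, NExp.eval, hx, hy, hag.nat 1 (by simp),
            hag.nat 4 (by simp), h1.adj, State.Done])
        (by
          intro s' x y hag hx hy hp
          simp only [RExp.eval, NExp.eval, hx, hy, hag.real 0 (by simp), h1.weight x y hp.1])
      have fN (a : ℕ) (ha : a ∉ [20, 21, 24, 25, 26]) := run_nat (findMin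
        (.and (.isOne (.load 1 (.var 20) (.var 21)))
          (.not (.isOne (.load 4 (.var 20) (.var 21))))) (.load 0 (.var 20) (.var 21))) a
          (by simp only [List.mem_cons, List.not_mem_nil, or_false, not_or] at ha
              simp [findMin, writesNat, ha]) s
      have fR (a : ℕ) (ha : a ≠ 2) := run_real (findMin
        (.and (.isOne (.load 1 (.var 20) (.var 21)))
          (.not (.isOne (.load 4 (.var 20) (.var 21))))) (.load 0 (.var 20) (.var 21))) a
          (by simp [findMin, writesReal, ha]) s
      generalize (findMin _ _).run s = s₁ at *
      have i1 : PhaseInv n k r ρ G w s₁ H' := h1.congr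
        (fun a ha => fN a (by
          simp only [List.mem_cons, List.not_mem_nil, or_false] at ha ⊢
          omega))
        (fun a ha => fR a (by rintro rfl; simp at ha))
      have hD (u v : Fin n) : s₁.Done u v ↔ s.Done u v := by
        rw [State.Done, fN 4 (by simp)]; rfl
      rcases hmin with ⟨h24, hnone⟩ | ⟨h24, x, y, hx, hy, ⟨hadj, hund⟩, hle⟩
      · rw [run_branch_neg (by simp [h24]), run_skip]
        refine ⟨⟨H', i1⟩, .inl fun u v huv => (hD u v).2 ?_⟩
        by_contra hcon
        exact hnone u v ⟨huv, hcon⟩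
      · rw [run_branch_pos (by simp [h24])]
        obtain ⟨hinv, hdone⟩ := run_process i1 hk hkn hρ hx hy hadj (by rwa [hD])
          (fun u v huv hu => by exact_mod_cast hle u v ⟨huv, by rwa [hD] at hu⟩)
        refine ⟨hinv, .inr ?_⟩
        rcases h2 with h2 | h2
        · exact absurd (h2 x y hadj) hund
        · rw [Finset.card_insert_of_notMem hab]
          have hsub : insert (x, y) (Finset.univ.filter fun e : Fin n × Fin n => s.Done e.1 e.2) ⊆
              Finset.univ.filter fun e : Fin n × Fin n => (process.run s₁).Done e.1 e.2 := by
            intro e he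
            rw [Finset.mem_filter, hdone, hD]
            rcases Finset.mem_insert.1 he with rfl | he
            · exact ⟨Finset.mem_univ _, .inr ⟨rfl, rfl⟩⟩
            · exact ⟨Finset.mem_univ _, .inl (Finset.mem_filter.1 he).2⟩
          refine le_trans ?_ (Finset.card_le_card hsub)
          rw [Finset.card_insert_of_notMem (by simp [hund])]
          omega)
  obtain ⟨⟨H', h1⟩, h2⟩ := main
  refine ⟨H', h1, ?_⟩
  rcases h2 with h2 | h2
  · exact h2
  · intro u v _
    have := (Finset.eq_univ_iff_forall.1 (Finset.eq_univ_of_card _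
      (le_antisymm (Finset.card_le_univ _) h2))) (u, v)
    exact (Finset.mem_filter.1 this).2

end Cmd

end WSpanner

namespace WSpanner

variable {n k r : ℕ} {ρ : Bool → ℕ} {G H : SimpleGraph (Fin n)} {w : Sym2 (Fin n) → ℝ≥0}

/-! ### Hitting sets as a program -/

/-- The array with the hitting set for the balls of type `b`. -/
def centerArr (b : Bool) : ℕ := bif b then 10 else 9

open Classical in
/-- The hitting set for the balls of type `b`. -/
noncomputable def State.centers (n : ℕ) (s : State) (b : Bool) : Finset (Fin n) :=
  Finset.univ.filter fun v => s.nat (centerArr b) v 0 = 1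

open Classical in
/-- The balls that are not yet hit. -/
noncomputable def State.unhit (n : ℕ) (s : State) : Finset (Fin n) :=
  Finset.univ.filter fun x => s.nat 11 x 0 = 1

theorem State.mem_centers {s : State} {b : Bool} {v : Fin n} :
    v ∈ s.centers n b ↔ s.nat (centerArr b) v 0 = 1 := by
  simp [centers]

theorem State.centers_congr {s s' : State} {b : Bool} (h : s'.nat (centerArr b) = s.nat (centerArr b)) :
    s'.centers n b = s.centers n b := by
  simp only [centers, h]

theorem State.unhit_congr {s s' : State} (h : s'.nat 11 = s.nat 11) : s'.unhit n = s.unhit n := by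
  simp only [unhit, h]

theorem State.row_congr {s s' : State} {b : Bool} (h : s'.nat (rowArr b) = s.nat (rowArr b)) :
    (s'.Row b : Fin n → Fin n → Prop) = s.Row b := by
  funext u v; rw [Row, h]; rfl

theorem State.flag_congr {s s' : State} {b : Bool} (h : s'.nat (flagArr b) = s.nat (flagArr b)) :
    (s'.Flag b : Fin n → Prop) = s.Flag b := by
  funext u; rw [Flag, h]; rfl

namespace Cmd

/-- Count the balls that contain the vertex `21` and are not yet hit. -/
def countRows (b : Bool) : Cmd :=
  .seq (.setVar 27 (.const 0)) (.loop 20 0 (.branch (.and (.isOne (.load 11 (.var 20) (.const 0)))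
    (.isOne (.load (rowArr b) (.var 20) (.var 21)))) (.setVar 27 (.add (.var 27) (.const 1))) .skip))

open Classical in
theorem run_countRows {b : Bool} {s : State} (hs : s.nat 0 0 0 = n) {v : Fin n}
    (hv : s.nat 21 0 0 = v) :
    ((countRows b).run s).nat 27 0 0 = ((s.unhit n).filter fun x => s.Row b x v).card := by
  have main := run_loop (a := 20) (n := n) (s := (setVar 27 (.const 0)).run s)
    (p := .branch (.and (.isOne (.load 11 (.var 20) (.const 0)))
      (.isOne (.load (rowArr b) (.var 20) (.var 21)))) (.setVar 27 (.add (.var 27) (.const 1))) .skip)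
    (by simpa using hs)
    (fun P t => t.nat 21 0 0 = v ∧ (∀ i j, t.nat 11 i j = s.nat 11 i j) ∧
      (∀ i j, t.nat (rowArr b) i j = s.nat (rowArr b) i j) ∧
      t.nat 27 0 0 = (P.filter fun x => x ∈ s.unhit n ∧ s.Row b x v).card)
    (by rintro P t z h; cases b <;> simpa [rowArr] using h)
    (by cases b <;> simpa [rowArr] using hv)
    (by
      rintro P x hx t h20 ⟨h1, h2, h3, h4⟩
      rw [run_branch, Finset.filter_insert]
      have hiff : (Test.and (.isOne (.load 11 (.var 20) (.const 0)))
          (.isOne (.load (rowArr b) (.var 20) (.var 21)))).Holds t ↔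
          x ∈ s.unhit n ∧ s.Row b x v := by
        simp [h20, h1, h2, h3, State.unhit, State.Row]
      by_cases h : x ∈ s.unhit n ∧ s.Row b x v
      · rw [if_pos (hiff.2 h), if_pos h, Finset.card_insert_of_notMem (by simp [hx]), ← h4]
        cases b <;> simp [h1, h2, rowArr] <;> simpa [rowArr] using h3
      · rw [if_neg (mt hiff.1 h), if_neg h]
        exact ⟨h1, h2, h3, h4⟩)
  rw [countRows, run_seq, main.2.2.2]
  congr 1
  ext x
  simp

/-- Find the vertex that is contained in the largest number of balls that are not yet hit. -/
def selectMax (b : Bool) : Cmd :=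
  .seq (.setVar 34 (.const 0)) (.loop 21 0 (.seq (countRows b)
    (.branch (.natLe (.add (.var 34) (.const 1)) (.var 27))
      (.seq (.setVar 34 (.var 27)) (.setVar 25 (.var 21))) .skip)))

open Classical in
theorem run_selectMax {b : Bool} {s : State} (hs : s.nat 0 0 0 = n) :
    let count (v : Fin n) := ((s.unhit n).filter fun x => s.Row b x v).card
    let s' := (selectMax b).run s
    (s'.nat 34 0 0 = 0 ∧ ∀ v, count v = 0) ∨
    (0 < s'.nat 34 0 0 ∧ ∃ v : Fin n, s'.nat 25 0 0 = v ∧ 0 < count v ∧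
      ∀ u, count u ≤ count v) := by
  intro count s'
  have main := run_loop (a := 21) (n := n) (s := (setVar 34 (.const 0)).run s)
    (p := .seq (countRows b) (.branch (.natLe (.add (.var 34) (.const 1)) (.var 27))
      (.seq (.setVar 34 (.var 27)) (.setVar 25 (.var 21))) .skip))
    (by simpa using hs)
    (fun P t => t.nat 0 0 0 = n ∧ t.nat 11 = s.nat 11 ∧ t.nat (rowArr b) = s.nat (rowArr b) ∧
      (∀ v ∈ P, count v ≤ t.nat 34 0 0) ∧ (0 < t.nat 34 0 0 → ∃ v : Fin n, t.nat 25 0 0 = v ∧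
        t.nat 34 0 0 = count v))
    (by
      rintro P t z ⟨h1, h2, h3, h4, h5⟩
      rw [State.setN_nat_ne _ _ _ _ _ _ (by decide : 0 ≠ 21),
        State.setN_nat_ne _ _ _ _ _ _ (by decide : 11 ≠ 21),
        State.setN_nat_ne _ _ _ _ _ _ (by cases b <;> decide : rowArr b ≠ 21),
        State.setN_nat_ne _ _ _ _ _ _ (by decide : 34 ≠ 21),
        State.setN_nat_ne _ _ _ _ _ _ (by decide : 25 ≠ 21)]
      exact ⟨h1, h2, h3, h4, h5⟩)
    (by
      refine ⟨by simpa using hs, ?_, ?_, by simp, by simp⟩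
      · rw [run_setNat, State.setN_nat_ne _ _ _ _ _ _ (by decide)]
      · rw [run_setNat, State.setN_nat_ne _ _ _ _ _ _ (by cases b <;> decide)])
    (by
      rintro P v hv t h21 ⟨h1, h2, h3, h4, h5⟩
      have hc : ((countRows b).run t).nat 27 0 0 = count v := by
        rw [run_countRows h1 h21]
        simp only [count, State.unhit_congr h2, State.row_congr h3]
      have fN (a : ℕ) (ha : (countRows b).writesNat a = false) := run_nat (countRows b) a ha t
      rw [run_seq]
      generalize (countRows b).run t = t₁ at *
      rw [← fN 0 rfl] at h1
      rw [← fN 11 rfl] at h2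
      rw [← fN (rowArr b) (by cases b <;> rfl)] at h3
      rw [← fN 34 rfl] at h4 h5
      rw [← fN 25 rfl] at h5
      rw [← fN 21 rfl] at h21
      by_cases h : t₁.nat 34 0 0 + 1 ≤ count v
      · rw [run_branch_pos (by simpa [hc] using h), run_seq, run_setNat, run_setNat]
        refine ⟨by simpa using h1, ?_, ?_, fun u hu => ?_, fun _ => ⟨v, ?_, ?_⟩⟩
        · rw [State.setN_nat_ne _ _ _ _ _ _ (by decide), State.setN_nat_ne _ _ _ _ _ _ (by decide),
            h2]
        · rw [State.setN_nat_ne _ _ _ _ _ _ (by cases b <;> decide),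
            State.setN_nat_ne _ _ _ _ _ _ (by cases b <;> decide), h3]
        · simp only [State.setN_nat, NExp.eval]
          simp only [hc]
          rcases Finset.mem_insert.1 hu with rfl | hu
          · simp
          · have := h4 u hu
            simp
            omega
        · simp [h21]
        · simp [hc]
      · rw [run_branch_neg (by simpa [hc] using h), run_skip]
        refine ⟨h1, h2, h3, fun u hu => ?_, h5⟩
        rcases Finset.mem_insert.1 hu with rfl | hu
        · omega
        · exact h4 u hu)
  obtain ⟨-, -, -, h4, h5⟩ := main
  rcases Nat.eq_zero_or_pos (s'.nat 34 0 0) with h0 | h0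
  · refine .inl ⟨h0, fun v => ?_⟩
    have := (h4 v (Finset.mem_univ _)).trans_eq h0
    omega
  · obtain ⟨v, hv, hv'⟩ := h5 h0
    have hv'' : s'.nat 34 0 0 = count v := hv'
    exact .inr ⟨h0, v, hv, by omega, fun u => (h4 u (Finset.mem_univ _)).trans_eq hv'⟩

/-- Remove the balls that contain the vertex `25` from the set of the balls that are not yet hit. -/
def removeRows (b : Bool) : Cmd :=
  .loop 20 0 (.branch (.isOne (.load (rowArr b) (.var 20) (.var 25)))
    (.setNat 11 (.var 20) (.const 0) (.const 0)) .skip)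

open Classical in
theorem run_removeRows {b : Bool} {s : State} (hs : s.nat 0 0 0 = n) {v : Fin n}
    (hv : s.nat 25 0 0 = v) :
    ((removeRows b).run s).unhit n = (s.unhit n).filter fun x => ¬ s.Row b x v := by
  have main := run_loop (a := 20) (n := n) (s := s)
    (p := .branch (.isOne (.load (rowArr b) (.var 20) (.var 25)))
      (.setNat 11 (.var 20) (.const 0) (.const 0)) .skip) hs
    (fun P t => t.nat 25 0 0 = v ∧ (∀ i j, t.nat (rowArr b) i j = s.nat (rowArr b) i j) ∧
      ∀ x : Fin n, t.nat 11 x 0 = 1 ↔ s.nat 11 x 0 = 1 ∧ (x ∈ P → ¬ s.Row b x v))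
    (by rintro P t z h; cases b <;> simpa [rowArr] using h)
    (by simpa using hv)
    (by
      rintro P x hx t h20 ⟨h1, h2, h3⟩
      have hiff : (Test.isOne (.load (rowArr b) (.var 20) (.var 25))).Holds t ↔ s.Row b x v := by
        simp [h20, h1, h2, State.Row]
      by_cases h : s.Row b x v
      · rw [run_branch_pos (hiff.2 h)]
        refine ⟨by simpa using h1, by cases b <;> simpa [rowArr] using h2, fun y => ?_⟩
        by_cases hyx : y = x
        · subst hyx
          simp [h20, h]
        · have := Fin.val_ne_of_ne hyx
          simp [h20, this, h3, hyx]
      · rw [run_branch_neg (mt hiff.1 h)]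
        refine ⟨h1, h2, fun y => ?_⟩
        rw [run_skip, h3, Finset.mem_insert]
        by_cases hyx : y = x
        · subst hyx
          simp [h]
        · simp [hyx])
  ext x
  have := main.2.2 x
  simp only [State.unhit, Finset.mem_filter, Finset.mem_univ, true_and]
  exact this.trans (by simp)

/-- Compute a hitting set for the large balls of type `b`. -/
def hit (b : Bool) : Cmd :=
  .seq (.loop 20 0 (.setNat 11 (.var 20) (.const 0) (.load (flagArr b) (.var 20) (.const 0))))
    (.loop 22 0 (.seq (selectMax b) (.branch (.natLe (.const 1) (.var 34))
      (.seq (.setNat (centerArr b) (.var 25) (.const 0) (.const 1)) (removeRows b)) .skip)))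

open Classical in
-- Each pass of the outer loop is one round of `Hitting`; a pass in which no vertex lies in an unhit
-- ball is the exhausted case.
theorem run_hit {b : Bool} {m : ℕ} {s : State} (hs : s.nat 0 0 0 = n) (hm : 0 < m)
    (hlarge : ∀ x : Fin n, s.Flag b x → m ≤ {v | s.Row b x v}.ncard)
    (h0 : s.centers n b = ∅) :
    ∃ U, Hitting m (s.Row b) (s.Flag b) n (((hit b).run s).centers n b) U := by
  have first := run_loop (a := 20) (n := n) (s := s)
    (p := .setNat 11 (.var 20) (.const 0) (.load (flagArr b) (.var 20) (.const 0))) hs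
    (fun P t => (∀ i j, t.nat (flagArr b) i j = s.nat (flagArr b) i j) ∧
      ∀ x ∈ P, t.nat 11 x 0 = s.nat (flagArr b) x 0)
    (by rintro P t z h; cases b <;> simpa [flagArr] using h) (by simp)
    (by
      rintro P x hx t h20 ⟨h1, h2⟩
      refine ⟨by cases b <;> simpa [flagArr] using h1, fun y hy => ?_⟩
      by_cases hyx : y = x
      · subst hyx
        simp [h20, h1]
      · have := Fin.val_ne_of_ne hyx
        simp [h20, this, h2 y ((Finset.mem_insert.1 hy).resolve_left hyx)])
  rw [hit, run_seq]
  have fN (a : ℕ) (ha : a ∉ [11, 20]) := run_nat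
    (.loop 20 0 (.setNat 11 (.var 20) (.const 0) (.load (flagArr b) (.var 20) (.const 0)))) a
    (by simp only [List.mem_cons, List.not_mem_nil, or_false, not_or] at ha
        simp [writesNat, ha]) s
  generalize run (.loop 20 0 _) s = s₁ at *
  have hU (x : Fin n) : x ∈ s₁.unhit n ↔ s.Flag b x := by
    simp [State.unhit, first.2 x (Finset.mem_univ _), State.Flag]
  have hs₁ : s₁.nat 0 0 0 = n := by rw [fN 0 (by simp), hs]
  have main := run_loop (a := 22) (n := n) (s := s₁)
    (p := .seq (selectMax b) (.branch (.natLe (.const 1) (.var 34))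
      (.seq (.setNat (centerArr b) (.var 25) (.const 0) (.const 1)) (removeRows b)) .skip)) hs₁
    (fun P t => t.nat 0 0 0 = n ∧ (t.Row b : Fin n → Fin n → Prop) = s.Row b ∧
      Hitting m (s.Row b) (s.Flag b) P.card (t.centers n b) (t.unhit n))
    (by
      rintro P t z ⟨h1, h2, h3⟩
      rw [State.row_congr (State.setN_nat_ne _ _ _ _ _ _ (by cases b <;> decide)),
        State.centers_congr (State.setN_nat_ne _ _ _ _ _ _ (by cases b <;> decide)),
        State.unhit_congr (State.setN_nat_ne _ _ _ _ _ _ (by decide))]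
      exact ⟨by simpa using h1, h2, h3⟩)
    ⟨hs₁, State.row_congr (fN _ (by cases b <;> decide)), by
      rw [State.centers_congr (fN _ (by cases b <;> decide)), h0]
      exact Hitting.init hU⟩
    (by
      rintro P x hx t - ⟨h1, h2, h3⟩
      rw [run_seq, Finset.card_insert_of_notMem hx]
      have hsel := run_selectMax (b := b) h1
      have gN (a : ℕ) (ha : (selectMax b).writesNat a = false) := run_nat (selectMax b) a ha t
      generalize (selectMax b).run t = t₁ at *
      rw [h2] at hsel
      have i1 : t₁.nat 0 0 0 = n := by rw [gN 0 rfl, h1]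
      have i2 : (t₁.Row b : Fin n → Fin n → Prop) = s.Row b := by
        rw [State.row_congr (gN _ (by cases b <;> rfl)), h2]
      have i3 : t₁.centers n b = t.centers n b := State.centers_congr (gN _ (by cases b <;> rfl))
      have i4 : t₁.unhit n = t.unhit n := State.unhit_congr (gN 11 rfl)
      rcases hsel with ⟨h34, hzero⟩ | ⟨h34, v, hv, hpos, hmax⟩
      · rw [run_branch_neg (by simp [h34]), run_skip, i3, i4]
        exact ⟨i1, i2, h3.of_exhausted hlarge hm hzero⟩
      · rw [run_branch_pos (by simp only [Test.Holds, NExp.eval]; exact h34), run_seq]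
        obtain ⟨t₂, ht₂⟩ : ∃ t₂, t₂ =
          (setNat (centerArr b) (.var 25) (.const 0) (.const 1)).run t₁ := ⟨_, rfl⟩
        rw [← ht₂]
        have hN (a : ℕ) (ha : a ≠ centerArr b) : t₂.nat a = t₁.nat a := by
          rw [ht₂, run_setNat, State.setN_nat_ne _ _ _ _ _ _ ha]
        have j1 : t₂.nat 0 0 0 = n := by rw [hN 0 (by cases b <;> decide), i1]
        have j2 : (t₂.Row b : Fin n → Fin n → Prop) = s.Row b := by
          rw [State.row_congr (hN _ (by cases b <;> decide)), i2]
        have j3 : t₂.centers n b = insert v (t.centers n b) := by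
          rw [← i3]
          ext y
          simp only [State.centers, ht₂, run_setNat, Finset.mem_filter, Finset.mem_univ, true_and,
            Finset.mem_insert, State.setN_nat, NExp.eval, Fin.ext_iff]
          simp only [hv]
          split_ifs with hif <;> simp_all
        have j4 : t₂.unhit n = t.unhit n := by
          rw [State.unhit_congr (hN 11 (by cases b <;> decide)), i4]
        have j5 := run_removeRows (b := b) j1 (v := v) (by rw [hN 25 (by cases b <;> decide), hv])
        have kN (a : ℕ) (ha : (removeRows b).writesNat a = false) := run_nat (removeRows b) a ha t₂
        generalize (removeRows b).run t₂ = t₃ at *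
        refine ⟨by rw [kN 0 rfl, j1], ?_, ?_⟩
        · rw [State.row_congr (kN _ (by cases b <;> rfl)), j2]
        · rw [j5, j4, j2, State.centers_congr (kN _ (by cases b <;> rfl)), j3]
          exact h3.pick hlarge hpos hmax)
  have final := main.2.2
  rw [Finset.card_univ, Fintype.card_fin] at final
  exact ⟨_, final⟩

/-! ### Connecting the centers -/

/-- Insert the best edge between each pair of centers of different types. -/
def connect : Cmd :=
  .loop 22 0 (.loop 23 0 (.branch
    (.and (.isOne (.load 9 (.var 22) (.const 0))) (.isOne (.load 10 (.var 23) (.const 0))))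
    (.seq (findMin (.and (.isOne (.load 1 (.var 20) (.var 21)))
        (.and (.isOne (.load 3 (.var 22) (.var 20))) (.isOne (.load 3 (.var 21) (.var 23)))))
      (.add (.add (.load 1 (.var 22) (.var 20)) (.load 0 (.var 20) (.var 21)))
        (.load 1 (.var 21) (.var 23))))
      (.branch (.isOne (.var 24)) (.seq (.setNat 2 (.var 25) (.var 26) (.const 1))
        (.setNat 2 (.var 26) (.var 25) (.const 1))) .skip)) .skip))

theorem ncard_edgeSet_sup_edge_le (H : SimpleGraph (Fin n)) (x y : Fin n) :
    (H ⊔ SimpleGraph.edge x y).edgeSet.ncard ≤ H.edgeSet.ncard + 1 := by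
  refine (Set.ncard_le_ncard (t := insert s(x, y) H.edgeSet) ?_).trans (Set.ncard_insert_le _ _)
  intro e he
  induction e with | _ a b =>
  rw [SimpleGraph.mem_edgeSet, SimpleGraph.sup_adj, SimpleGraph.edge_adj] at he
  rw [Set.mem_insert_iff, SimpleGraph.mem_edgeSet, Sym2.eq_iff]
  tauto

/-- The parts of the memory that are read in order to connect the centers. -/
structure SameData (s t : State) : Prop where
  adj : t.nat 1 = s.nat 1
  reach : t.nat 3 = s.nat 3
  center₀ : t.nat 9 = s.nat 9
  center₁ : t.nat 10 = s.nat 10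
  weight : t.real 0 = s.real 0
  dist : t.real 1 = s.real 1

open Classical in
-- Distances are read from the matrix of `H₀`, which is not updated in this phase. The value of the
-- selected edge bounds the new distance from `a` to `c` and is minimal among the finite values; for
-- all other edges the right-hand side is infinite.
theorem connect_step {s : State} {H₀ H : SimpleGraph (Fin n)} (hs : s.nat 0 0 0 = n)
    (hadj : ∀ u v : Fin n, s.nat 1 u v = 1 ↔ G.Adj u v)
    (hw : ∀ u v : Fin n, G.Adj u v → s.real 0 u v = w s(u, v))
    (hd : HasDist H₀ w s) (h₀ : H₀ ≤ H) (hG : H ≤ G) (ho : IsOutput s H) {a c : Fin n}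
    (ha : s.nat 22 0 0 = a) (hc : s.nat 23 0 0 = c) :
    let s' := (seq (findMin (.and (.isOne (.load 1 (.var 20) (.var 21)))
        (.and (.isOne (.load 3 (.var 22) (.var 20))) (.isOne (.load 3 (.var 21) (.var 23)))))
      (.add (.add (.load 1 (.var 22) (.var 20)) (.load 0 (.var 20) (.var 21)))
        (.load 1 (.var 21) (.var 23))))
      (.branch (.isOne (.var 24)) (.seq (.setNat 2 (.var 25) (.var 26) (.const 1))
        (.setNat 2 (.var 26) (.var 25) (.const 1))) .skip)).run s
    ∃ H', H ≤ H' ∧ H' ≤ G ∧ IsOutput s' H' ∧ H'.edgeSet.ncard ≤ H.edgeSet.ncard + 1 ∧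
      ∀ x y, G.Adj x y → wdist H' w a c ≤ wdist H₀ w a x + w s(x, y) + wdist H₀ w y c := by
  intro s'
  obtain ⟨s₁, hs₁⟩ : ∃ s₁, s₁ = (findMin (.and (.isOne (.load 1 (.var 20) (.var 21)))
        (.and (.isOne (.load 3 (.var 22) (.var 20))) (.isOne (.load 3 (.var 21) (.var 23)))))
      (.add (.add (.load 1 (.var 22) (.var 20)) (.load 0 (.var 20) (.var 21)))
        (.load 1 (.var 21) (.var 23)))).run s := ⟨_, rfl⟩
  have hs' : s' = (branch (.isOne (.var 24)) (.seq (.setNat 2 (.var 25) (.var 26) (.const 1))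
        (.setNat 2 (.var 26) (.var 25) (.const 1))) .skip).run s₁ := by rw [hs₁]; rfl
  have hmin := run_findMin (n := n) (s := s)
    (test := .and (.isOne (.load 1 (.var 20) (.var 21)))
        (.and (.isOne (.load 3 (.var 22) (.var 20))) (.isOne (.load 3 (.var 21) (.var 23)))))
    (val := .add (.add (.load 1 (.var 22) (.var 20)) (.load 0 (.var 20) (.var 21)))
        (.load 1 (.var 21) (.var 23))) hs
    (fun x y => G.Adj x y ∧ s.nat 3 a x = 1 ∧ s.nat 3 y c = 1)
    (fun x y => s.real 1 a x + w s(x, y) + s.real 1 y c)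
    (by
      intro t x y hag hx hy
      simp only [Test.Holds, Test.isOne_holds, NExp.eval, hx, hy, hag.nat 1 (by simp),
        hag.nat 3 (by simp), hag.nat 22 (by simp), hag.nat 23 (by simp), hadj, ha, hc])
    (by
      intro t x y hag hx hy hp
      simp only [RExp.eval, NExp.eval, hx, hy, hag.nat 22 (by simp), hag.nat 23 (by simp), ha, hc,
        hag.real 0 (by simp), hag.real 1 (by simp), hw x y hp.1])
  rw [← hs₁] at hmin
  have f2 : s₁.nat 2 = s.nat 2 := by rw [hs₁]; exact run_nat _ 2 rfl s
  have value {x y : Fin n} (h1 : s.nat 3 a x = 1) (h2 : s.nat 3 y c = 1) :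
      wdist H₀ w a x + w s(x, y) + wdist H₀ w y c =
        ENNReal.ofReal (s.real 1 a x + w s(x, y) + s.real 1 y c) := by
    have p1 := hd.nonneg a x
    have p2 := hd.nonneg y c
    rw [← hd.eq, ← hd.eq, State.dist, State.dist, if_pos h1, if_pos h2,
      ENNReal.ofReal_add (by positivity) p2, ENNReal.ofReal_add p1 (by positivity),
      ENNReal.ofReal_coe_nnreal]
  have infinite {x y : Fin n} (h : ¬ (s.nat 3 a x = 1 ∧ s.nat 3 y c = 1)) :
      wdist H₀ w a x + w s(x, y) + wdist H₀ w y c = ⊤ := by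
    rw [← hd.eq, ← hd.eq, State.dist, State.dist]
    by_cases h1 : s.nat 3 a x = 1
    · simp [show s.nat 3 y c ≠ 1 from fun h2 => h ⟨h1, h2⟩]
    · simp [h1]
  clear hs₁
  rcases hmin with ⟨h24, hnone⟩ | ⟨h24, x, y, hx, hy, ⟨hxy, h1, h2⟩, hle⟩
  · rw [run_branch_neg (by simp [h24]), run_skip] at hs'
    refine ⟨H, le_rfl, hG, fun u v => ?_, Nat.le_succ _, fun x y hxy => ?_⟩
    · rw [hs', f2]; exact ho u v
    · rw [infinite fun h => hnone x y ⟨hxy, h⟩]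
      exact le_top
  · rw [run_branch_pos (by simp [h24]), run_seq, run_setNat, run_setNat] at hs'
    have hle' : H ≤ H ⊔ SimpleGraph.edge x y := le_sup_left
    refine ⟨H ⊔ SimpleGraph.edge x y, hle', sup_le hG ?_, ?_,
      ncard_edgeSet_sup_edge_le H x y, fun x' y' hxy' => ?_⟩
    · rw [SimpleGraph.edge_le_iff]
      exact Or.inr hxy
    · refine isOutput_sup_edge ho hxy.ne fun u v => ?_
      rw [hs', ← f2]
      simp only [State.setN_nat, NExp.eval, Fin.ext_iff]
      simp [hx, hy]
      split_ifs <;> tauto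
    · by_cases h : s.nat 3 a x' = 1 ∧ s.nat 3 y' c = 1
      · have hbest := hle x' y' ⟨hxy', h⟩
        calc wdist (H ⊔ SimpleGraph.edge x y) w a c
            ≤ wdist (H ⊔ SimpleGraph.edge x y) w a y + wdist (H ⊔ SimpleGraph.edge x y) w y c :=
              wdist_triangle _ _ _ _ _
          _ ≤ (wdist (H ⊔ SimpleGraph.edge x y) w a x + wdist (H ⊔ SimpleGraph.edge x y) w x y) +
              wdist (H ⊔ SimpleGraph.edge x y) w y c := by
            gcongr; exact wdist_triangle _ _ _ _ _
          _ ≤ wdist H₀ w a x + w s(x, y) + wdist H₀ w y c := by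
            gcongr
            · exact wdist_mono (h₀.trans hle') _ _ _
            · exact wdist_of_adj w (by simp [SimpleGraph.edge_adj, hxy.ne])
            · exact wdist_mono (h₀.trans hle') _ _ _
          _ ≤ _ := by
            rw [value h1 h2, value h.1 h.2]
            exact ENNReal.ofReal_le_ofReal hbest
      · rw [infinite h]
        exact le_top

open Classical in
-- Each pair of centers is charged at most one new edge, and its inequality survives later
-- insertions because these only decrease distances.
theorem run_connect {s : State} {H₀ : SimpleGraph (Fin n)} (hs : s.nat 0 0 0 = n)
    (hadj : ∀ u v : Fin n, s.nat 1 u v = 1 ↔ G.Adj u v)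
    (hw : ∀ u v : Fin n, G.Adj u v → s.real 0 u v = w s(u, v))
    (hd : HasDist H₀ w s) (hG : H₀ ≤ G) (ho : IsOutput s H₀) :
    ∃ H, H₀ ≤ H ∧ H ≤ G ∧ IsOutput (connect.run s) H ∧
      H.edgeSet.ncard ≤ H₀.edgeSet.ncard + (s.centers n false).card * (s.centers n true).card ∧
      ∀ a ∈ s.centers n false, ∀ c ∈ s.centers n true, ∀ x y, G.Adj x y →
        wdist H w a c ≤ wdist H₀ w a x + w s(x, y) + wdist H₀ w y c := by
  set A := s.centers n false
  set C := s.centers n true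
  have main := run_loop_loop (a := 22) (b := 23) (n := n) (s := s) (p := .branch
    (.and (.isOne (.load 9 (.var 22) (.const 0))) (.isOne (.load 10 (.var 23) (.const 0))))
    (.seq (findMin (.and (.isOne (.load 1 (.var 20) (.var 21)))
        (.and (.isOne (.load 3 (.var 22) (.var 20))) (.isOne (.load 3 (.var 21) (.var 23)))))
      (.add (.add (.load 1 (.var 22) (.var 20)) (.load 0 (.var 20) (.var 21)))
        (.load 1 (.var 21) (.var 23))))
      (.branch (.isOne (.var 24)) (.seq (.setNat 2 (.var 25) (.var 26) (.const 1))
        (.setNat 2 (.var 26) (.var 25) (.const 1))) .skip)) .skip) hs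
    (fun P t => t.nat 0 0 0 = n ∧ SameData s t ∧ ∃ H, H₀ ≤ H ∧ H ≤ G ∧ IsOutput t H ∧
      H.edgeSet.ncard ≤ H₀.edgeSet.ncard + (P ∩ A ×ˢ C).card ∧
      ∀ a ∈ A, ∀ c ∈ C, (a, c) ∈ P → ∀ x y, G.Adj x y →
        wdist H w a c ≤ wdist H₀ w a x + w s(x, y) + wdist H₀ w y c)
    (by decide) (by decide) (by decide) rfl rfl
    (by
      rintro P t z ⟨h1, h2, H, h3, h4, h5, h6⟩
      refine ⟨by simpa using h1, ⟨?_, ?_, ?_, ?_, h2.weight, h2.dist⟩, H, h3, h4, fun u v => ?_, h6⟩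
      · rw [State.setN_nat_ne _ _ _ _ _ _ (by decide), h2.adj]
      · rw [State.setN_nat_ne _ _ _ _ _ _ (by decide), h2.reach]
      · rw [State.setN_nat_ne _ _ _ _ _ _ (by decide), h2.center₀]
      · rw [State.setN_nat_ne _ _ _ _ _ _ (by decide), h2.center₁]
      · rw [State.setN_nat_ne _ _ _ _ _ _ (by decide)]; exact h5 u v)
    (by
      rintro P t z ⟨h1, h2, H, h3, h4, h5, h6⟩
      refine ⟨by simpa using h1, ⟨?_, ?_, ?_, ?_, h2.weight, h2.dist⟩, H, h3, h4, fun u v => ?_, h6⟩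
      · rw [State.setN_nat_ne _ _ _ _ _ _ (by decide), h2.adj]
      · rw [State.setN_nat_ne _ _ _ _ _ _ (by decide), h2.reach]
      · rw [State.setN_nat_ne _ _ _ _ _ _ (by decide), h2.center₀]
      · rw [State.setN_nat_ne _ _ _ _ _ _ (by decide), h2.center₁]
      · rw [State.setN_nat_ne _ _ _ _ _ _ (by decide)]; exact h5 u v)
    ⟨hs, ⟨rfl, rfl, rfl, rfl, rfl, rfl⟩, H₀, le_rfl, hG, ho, by simp, by simp⟩
    (by
      rintro P a c hac t ha hc ⟨h1, h2, H, h3, h4, h5, h6, h7⟩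
      have hiff : (Test.and (.isOne (.load 9 (.var 22) (.const 0)))
          (.isOne (.load 10 (.var 23) (.const 0)))).Holds t ↔ a ∈ A ∧ c ∈ C := by
        simp only [Test.Holds, Test.isOne_holds, NExp.eval, ha, hc, h2.center₀, h2.center₁, A, C,
          State.mem_centers, centerArr, cond_false, cond_true]
      by_cases h : a ∈ A ∧ c ∈ C
      · rw [run_branch_pos (hiff.2 h)]
        obtain ⟨H', i1, i2, i3, i4, i5⟩ := connect_step (G := G) (w := w) (H₀ := H₀) h1
          (by rw [h2.adj]; exact hadj) (by rw [h2.weight]; exact hw) (hd.congr h2.reach h2.dist)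
          h3 h4 h5 ha hc
        have fN (p : Cmd) (e : ℕ) (he : p.writesNat e = false) := run_nat p e he t
        have fR (p : Cmd) (e : ℕ) (he : p.writesReal e = false) := run_real p e he t
        refine ⟨by rw [fN _ 0 rfl, h1], ⟨by rw [fN _ 1 rfl, h2.adj], by rw [fN _ 3 rfl, h2.reach],
          by rw [fN _ 9 rfl, h2.center₀], by rw [fN _ 10 rfl, h2.center₁],
          by rw [fR _ 0 rfl, h2.weight], by rw [fR _ 1 rfl, h2.dist]⟩, H', h3.trans i1, i2, i3,
          ?_, ?_⟩
        · rw [Finset.insert_inter_of_mem (Finset.mem_product.2 h),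
            Finset.card_insert_of_notMem (by simp [hac])]
          omega
        · intro a' ha' c' hc' hmem x y hxy
          rcases Finset.mem_insert.1 hmem with he | he
          · obtain ⟨rfl, rfl⟩ := Prod.mk.inj he
            exact i5 x y hxy
          · exact (wdist_mono i1 _ _ _).trans (h7 a' ha' c' hc' he x y hxy)
      · rw [run_branch_neg (mt hiff.1 h), run_skip]
        refine ⟨h1, h2, H, h3, h4, h5, ?_, ?_⟩
        · rw [Finset.insert_inter_of_notMem (by rw [Finset.mem_product]; exact h)]
          exact h6
        · intro a' ha' c' hc' hmem x y hxy
          rcases Finset.mem_insert.1 hmem with he | he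
          · obtain ⟨rfl, rfl⟩ := Prod.mk.inj he
            exact absurd ⟨ha', hc'⟩ h
          · exact h7 a' ha' c' hc' he x y hxy)
  obtain ⟨-, -, H, h3, h4, h5, h6, h7⟩ := main
  rw [Finset.univ_inter, Finset.card_product] at h6
  exact ⟨H, h3, h4, h5, h6, fun a ha c hc => h7 a ha c hc (Finset.mem_univ _)⟩

end Cmd

end WSpanner

namespace WSpanner

variable {n : ℕ} {G H : SimpleGraph (Fin n)} {w : Sym2 (Fin n) → ℝ≥0}

/-! ### The spanner program -/

/-- Permits the program to replace `k` by `min k (n + 2)`, so that its running time is bounded in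
terms of `n` alone. -/
theorem IsSpanner.mono {V : Type*} {G H : SimpleGraph V} {w : Sym2 V → ℝ≥0} {k l : ℕ}
    (h : IsSpanner k (k - 1) G w H) (hkl : k ≤ l) : IsSpanner l (l - 1) G w H := by
  refine ⟨h.1, fun u v => (h.2 u v).trans ?_⟩
  have h1 : (k : ℝ≥0∞) ≤ l := by exact_mod_cast hkl
  have h2 : ((k - 1 : ℕ) : ℝ≥0∞) ≤ (l - 1 : ℕ) := by exact_mod_cast Nat.sub_le_sub_right hkl 1
  gcongr

/-- Carries the result from `Fin n` to an arbitrary finite vertex set. -/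
theorem IsSpanner.comap {V V' : Type*} {G : SimpleGraph V} {w : Sym2 V → ℝ≥0} {α β : ℕ}
    (e : V ≃ V') {H : SimpleGraph V'}
    (h : IsSpanner α β (G.comap e.symm) (w ∘ Sym2.map e.symm) H) :
    IsSpanner α β G w (H.comap e) := by
  have hw : (w ∘ Sym2.map e.symm) ∘ Sym2.map e = w := by
    ext a
    induction a with | _ x y => simp
  refine ⟨fun u v huv => by simpa using h.1 (show H.Adj (e u) (e v) from huv), fun u v => ?_⟩
  have h1 := wdist_iso (SimpleGraph.Iso.comap e H) (w ∘ Sym2.map e.symm) u v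
  have h2 := wdist_iso (SimpleGraph.Iso.comap e.symm G) w (e u) (e v)
  have h3 := h.2 (e u) (e v)
  simp only [SimpleGraph.Iso.comap_apply, Equiv.symm_apply_apply] at h1 h2
  have h4 : maxWeight (G.comap e.symm) (w ∘ Sym2.map e.symm) ≤ maxWeight G w := by
    refine iSup₂_le fun a ha => ?_
    induction a with
    | _ x y => exact le_iSup₂_of_le (f := fun b _ => (w b : ℝ≥0∞)) s(e.symm x, e.symm y) ha le_rfl
  change _ = wdist _ ((w ∘ Sym2.map e.symm) ∘ Sym2.map e) u v at h1
  change _ = wdist _ (w ∘ Sym2.map e.symm) _ _ at h2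
  rw [hw] at h1
  rw [← h1, h2]
  exact h3.trans (by gcongr)

namespace Cmd

/-- Initialize the distance matrix of the graph without edges. -/
def initDist : Cmd := .loop 20 0 (.setNat 3 (.var 20) (.var 20) (.const 1))

theorem run_initDist {s : State} (hs : s.nat 0 0 0 = n)
    (h3 : ∀ u v : Fin n, s.nat 3 u v = 0) (h1 : ∀ u v : Fin n, s.real 1 u v = 0) :
    HasDist ⊥ w (initDist.run s) := by
  have main := run_loop (a := 20) (n := n) (s := s)
    (p := .setNat 3 (.var 20) (.var 20) (.const 1)) hs
    (fun P t => ∀ u v : Fin n, t.nat 3 u v = if u = v ∧ u ∈ P then 1 else 0)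
    (by intro P t z h; simpa using h) (by simpa using h3)
    (by
      rintro P x hx t h20 h u v
      simp only [run_setNat, State.setN_nat, NExp.eval]
      simp only [h20, h, ← Fin.ext_iff, true_and, Finset.mem_insert]
      split_ifs <;> grind)
  have hR : (initDist.run s).real = s.real := by
    funext a; exact run_real initDist a rfl s
  refine ⟨fun u v => by rw [hR, h1], fun u v => ?_⟩
  rw [State.dist, hR, h1, initDist, main u v]
  by_cases h : u = v
  · subst h
    simp [wdist_self]
  · simp [h, wdist_bot w h]

/-- The program that computes a spanner. -/
def spanner : Cmd :=
  .seq params <| .seq initDist <| .seq greedyPhase <| .seq (hit false) <| .seq (hit true) connect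

theorem exists_run_spanner {k : ℕ} (hk : 2 ≤ k) (n : ℕ) (G : SimpleGraph (Fin n))
    (w : Sym2 (Fin n) → ℝ≥0) :
    ∃ H : SimpleGraph (Fin n), IsOutput (spanner.run (input k n G w)) H ∧
      IsSpanner k (k - 1) G w H ∧ (H.edgeSet.ncard : ℝ) ≤ sizeBound 6 2 k n := by
  classical
  set kk := min k (n + 2) with hkk
  have hkk2 : 2 ≤ kk := by omega
  have hadj (u v : Fin n) : (input k n G w).nat 1 u v = 1 ↔ G.Adj u v := by
    simp only [input]
    simp only [one_ne_zero, false_and, if_false, true_and, ite_eq_left_iff, zero_ne_one,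
      imp_false, not_not]
    constructor
    · rintro ⟨u', v', hu, hv, h⟩
      rwa [Fin.ext hu, Fin.ext hv]
    · exact fun h => ⟨u, v, rfl, rfl, h⟩
  have hw (u v : Fin n) (h : G.Adj u v) : (input k n G w).real 0 u v = w s(u, v) := by
    simp [input, h]
  have hzero (a : ℕ) (ha : 2 ≤ a) (i j : ℕ) : (input k n G w).nat a i j = 0 := by
    have h0 : a ≠ 0 := by omega
    have h1 : a ≠ 1 := by omega
    simp [input, h0, h1]
  have hreal (i j : ℕ) : (input k n G w).real 1 i j = 0 := by simp [input]
  have hn : (input k n G w).nat 0 0 0 = n := by simp [input]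
  obtain ⟨r, hr1, hr2, hr3, hpar⟩ := run_params hk hn (by simp [input])
    (hzero 30 (by decide) 0 0) (hzero 31 (by decide) 0 0)
  rw [← hkk] at hr2 hr3 hpar
  set ρ : Bool → ℕ := fun b => bif b then kk / 2 else (kk - 1) / 2 with hρ
  -- The growth of balls needs `2 * ρ b ≤ kk`; the stretch and the number of pairs of centers need
  -- the sum `kk - 1`.
  have hρ2 (b : Bool) : 2 * ρ b ≤ kk := by cases b <;> simp [hρ] <;> omega
  have hρs : ρ false + ρ true = kk - 1 := by simp [hρ]; omega
  rw [spanner]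
  simp only [run_seq]
  have fN (a : ℕ) (ha : params.writesNat a = false) := run_nat params a ha (input k n G w)
  have fR : (params.run (input k n G w)).real = (input k n G w).real := by
    funext a; exact run_real params a rfl _
  generalize params.run (input k n G w) = s₁ at *
  have hdist : HasDist ⊥ w (initDist.run s₁) := run_initDist hpar.hn
    (fun u v => by rw [fN 3 rfl, hzero 3 (by decide)]) (fun u v => by rw [fR, hreal])
  have gN (a : ℕ) (ha : initDist.writesNat a = false) := run_nat initDist a ha s₁
  have gR : (initDist.run s₁).real = s₁.real := by
    funext a; exact run_real initDist a rfl _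
  generalize initDist.run s₁ = s₂ at *
  have hN (a : ℕ) (ha : params.writesNat a = false) (ha' : initDist.writesNat a = false) :
      s₂.nat a = (input k n G w).nat a := by rw [gN a ha', fN a ha]
  have inv₂ : PhaseInv n kk r ρ G w s₂ ⊥ := by
    refine ⟨hpar.congr fun a ha => ?_, ?_, ?_, ?_, hdist, Greedy.init ?_ ?_⟩
    · simp only [List.mem_cons, List.not_mem_nil, or_false] at ha
      rcases ha with rfl | rfl | rfl | rfl | rfl | rfl <;> exact gN _ rfl
    · rw [hN 1 rfl rfl]; exact hadj
    · rw [gR, fR]; exact hw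
    · intro u v
      rw [hN 2 rfl rfl, hzero 2 le_rfl]
      simp
    · rintro (_ | _) z <;> simp [State.Flag, flagArr, hN 5 rfl rfl, hN 6 rfl rfl, hzero]
    · intro u v; simp [State.Done, hN 4 rfl rfl, hzero]
  obtain ⟨H₀, inv₃, hdone⟩ := run_greedyPhase inv₂ (by omega) (by omega) hρ2
  have c₃ (b : Bool) : (greedyPhase.run s₂).centers n b = ∅ := by
    rw [State.centers_congr (run_nat greedyPhase _ (by cases b <;> rfl) s₂)]
    ext v
    cases b <;> simp [State.mem_centers, centerArr, hN 9 rfl rfl, hN 10 rfl rfl, hzero]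
  generalize greedyPhase.run s₂ = s₃ at *
  obtain ⟨U₀, hit₀⟩ := run_hit (b := false) (m := r ^ ρ false) inv₃.params.hn (by positivity)
    (inv₃.greedy.large false) (c₃ false)
  have pN (a : ℕ) (ha : (hit false).writesNat a = false) := run_nat (hit false) a ha s₃
  have pR : ((hit false).run s₃).real = s₃.real := by
    funext a; exact run_real (hit false) a rfl _
  generalize (hit false).run s₃ = s₄ at *
  have row₄ : (s₄.Row true : Fin n → Fin n → Prop) = s₃.Row true := State.row_congr (pN _ rfl)
  have flag₄ : (s₄.Flag true : Fin n → Prop) = s₃.Flag true := State.flag_congr (pN _ rfl)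
  obtain ⟨U₁, hit₁⟩ := run_hit (n := n) (b := true) (m := r ^ ρ true) (s := s₄)
    (by rw [pN 0 rfl, inv₃.params.hn]) (by positivity)
    (by rw [row₄, flag₄]; exact inv₃.greedy.large true)
    (by rw [State.centers_congr (pN _ rfl), c₃])
  rw [row₄, flag₄] at hit₁
  have qN (a : ℕ) (ha : (hit true).writesNat a = false) := run_nat (hit true) a ha s₄
  have qR : ((hit true).run s₄).real = s₄.real := by
    funext a; exact run_real (hit true) a rfl _
  generalize (hit true).run s₄ = s₅ at *
  have c₅ : s₅.centers n false = s₄.centers n false := State.centers_congr (qN _ rfl)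
  rw [← c₅] at hit₀
  have sN (a : ℕ) (ha : (hit false).writesNat a = false) (ha' : (hit true).writesNat a = false) :
      s₅.nat a = s₃.nat a := by rw [qN a ha', pN a ha]
  obtain ⟨H, hle, hG, hout, hcard, hconn⟩ := run_connect (s := s₅) (H₀ := H₀) (G := G) (w := w)
    (by rw [sN 0 rfl rfl, inv₃.params.hn]) (by rw [sN 1 rfl rfl]; exact inv₃.adj)
    (by rw [qR, pR]; exact inv₃.weight)
    (inv₃.dist.congr (sN 3 rfl rfl) (by rw [qR, pR])) inv₃.greedy.le
    (fun u v => by rw [sN 2 rfl rfl]; exact inv₃.out u v)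
  have hhit (b : Bool) (z : Fin n) (hz : s₃.Flag b z) : ∃ a ∈ s₅.centers n b, s₃.Row b z a := by
    cases b
    · exact hit₀.exists_mem hz
    · exact hit₁.exists_mem hz
  refine ⟨H, hout, ?_, ?_⟩
  · refine IsSpanner.mono (k := kk) ?_ (by omega)
    refine isSpanner_of_centers hkk2 hρs hle hG (fun b v => v ∈ s₅.centers n b) ?_ ?_
    · intro x y hxy
      refine (inv₃.greedy.done x y hxy (hdone x y hxy)).imp_right fun h b z hz => ?_
      obtain ⟨a, ha, hza⟩ := hhit b z (h b z hz).1
      exact ⟨a, ha, (h b z hz).2 a hza⟩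
    · rintro (_ | _) a c ha hc x y hxy
      · exact hconn a ha c hc x y hxy
      -- Connecting edges are chosen for pairs of types `(false, true)`; the other order follows by
      -- reversing the edge.
      · have := hconn c hc a ha y x hxy.symm
        rw [wdist_comm H w c a, wdist_comm H₀ w c y, wdist_comm H₀ w x a, Sym2.eq_swap] at this
        refine this.trans (le_of_eq ?_)
        ring
  · rcases Nat.eq_zero_or_pos n with h0 | hpos
    · subst h0
      have : H.edgeSet = ∅ := by
        ext e
        induction e with | _ a b => exact a.elim0
      rw [this, Set.ncard_empty, Nat.cast_zero, sizeBound]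
      simpa using Real.rpow_nonneg le_rfl _
    · refine sizeBound_of_min hpos ?_
      refine edge_count (r := r) (by omega) hpos hr2 hr3 hρs hit₀.size hit₁.size (hcard.trans ?_)
      gcongr
      simpa using inv₃.greedy.degenerate.ncard_edgeSet_le

end Cmd

end WSpanner

/-! ### The main theorem -/

theorem theorem1 :
    ∃ C c : ℕ,
      (∀ (k : ℕ), 2 ≤ k → ∀ (V : Type*) [Fintype V] (G : SimpleGraph V) (w : Sym2 V → ℝ≥0),
        ∃ H : SimpleGraph V,
          IsSpanner k (k - 1) G w H ∧
          (H.edgeSet.ncard : ℝ) ≤ sizeBound C c k (Fintype.card V)) ∧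
      (∃ (P : Prog) (T : Polynomial ℕ),
        ∀ (k : ℕ), 2 ≤ k → ∀ (n : ℕ) (G : SimpleGraph (Fin n)) (w : Sym2 (Fin n) → ℝ≥0),
          ∃ (t : ℕ) (s : State) (H : SimpleGraph (Fin n)),
            Exec P (input k n G w) t s ∧
            t ≤ T.eval n ∧
            IsOutput s H ∧
            IsSpanner k (k - 1) G w H ∧
            (H.edgeSet.ncard : ℝ) ≤ sizeBound C c k n) := by
  refine ⟨6, 2, fun k hk V _ G w => ?_, Cmd.spanner.compile, Cmd.spanner.time,
    fun k hk n G w => ?_⟩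
  -- Existence is read off from the output of the program on a copy of `G` with vertex set `Fin n`.
  · let e := Fintype.equivFin V
    obtain ⟨H, -, hH, hcard⟩ := Cmd.exists_run_spanner hk (Fintype.card V) (G.comap e.symm)
      (w ∘ Sym2.map e.symm)
    refine ⟨H.comap e, hH.comap e, ?_⟩
    rwa [← Nat.card_coe_set_eq, Nat.card_congr (SimpleGraph.Iso.comap e H).mapEdgeSet,
      Nat.card_coe_set_eq]
  · obtain ⟨H, hout, hsp, hcard⟩ := Cmd.exists_run_spanner hk n G w
    -- The program is a fixed term, so its well-formedness and the fact that it never overwrites `n`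
    -- hold by evaluation.
    obtain ⟨t, ht, hex⟩ := Cmd.exec_compile Cmd.spanner rfl n (input k n G w) (by simp [input]) rfl
    exact ⟨t, _, H, hex, ht, hout, hsp, hcard⟩
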